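/- Let $(T,E)$ be the 3-regular tree, let $\vec E$ be its set of oriented edges, containing $(v,w)$ and $(w,v)$ for each $\{v,w\}\in E$, and let $\mathcal U=(U_e)_{e\in E}$ be i.i.d. random variables, uniformly distributed on $[0,1]$. A ray is a sequence $(v_n,w_n)_{n\ge 0}$ in $\vec E$ such that $v_{n+1}=w_n$ and $w_{n+1}\ne v_n$ for all $n\ge 0$. Let $\vec E_{(v,w)}$ be the set of oriented edges that lie on some ray starting with $(v,w)$, and let $E_{(v,w)}$ be the set of underlying unoriented edges. Let $\vec F$ be a random subset of $\vec E$, defined on the same probability space as $\mathcal U$, such that: (i) almost surely, for all $(v,w)\in\vec E$, one has $(v,w)\in\vec F$ if and only if there is a ray $(v_n,w_n)_{n\ge 0}$ with $(v_0,w_0)=(v,w)$ such that $U_{\{v_n,w_n\}}\le U_{\{v,w\}}$ and $(v_n,w_n)\notin\vec F$ for all $n\ge 1$; (ii) the law of $(\mathcal U,\vec F)$ is invariant under all automorphisms of the tree; (iii) for each finite $S\subset T$ whose induced subgraph is a tree, the random variables $\big((U_e)_{e\in E_{(v,w)}},\,\vec F\cap\vec E_{(v,w)}\big)$, indexed by the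 oriented edges $(v,w)$ with $v\in S$ and $w\notin S$, are independent of each other and of $(U_e)_{e\in E_S}$, where $E_S$ is the set of edges with both endvertices in $S$. Put $F:=\big\{\{v,w\}\in E:(v,w)\in\vec F\text{ or }(w,v)\in\vec F\big\}$. Then: (a) if $F'$ is a random subset of $E$, defined on the same probability space, such that $(\mathcal U,F')$ has the same law as $(\mathcal U,F)$ and such that $F$ and $F'$ are conditionally independent given $\mathcal U$, then $F\ne F'$ almost surely; (b) $F$ is not almost surely equal to any random subset of $E$ that is measurable with respect to the $\sigma$-field $\sigma(\mathcal U)$ generated by $\mathcal U$; in particular, $F$ is not measurable with respect to $\sigma(\mathcal U)$. -/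

import Mathlib

open MeasureTheory ProbabilityTheory Filter

namespace FrozenPercolation

section Graph

variable {V : Type*} (T : SimpleGraph V)

/-- A ray: an infinite non-backtracking sequence of oriented edges `(vₙ, wₙ)`, that is,
`vₙ₊₁ = wₙ` and `wₙ₊₁ ≠ vₙ`. Oriented edges of `T` are the terms of `T.Dart`. -/
def IsRay (r : ℕ → T.Dart) : Prop :=
  ∀ n, (r (n + 1)).fst = (r n).snd ∧ (r (n + 1)).snd ≠ (r n).fst

/-- The set of all oriented edges that lie on some ray starting with the oriented edge `d`. -/
def dartsFrom (d : T.Dart) : Set T.Dart :=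
  {d' | ∃ (r : ℕ → T.Dart) (m : ℕ), IsRay T r ∧ r 0 = d ∧ r m = d'}

/-- The unoriented edge underlying an oriented edge. -/
def toEdge (d : T.Dart) : T.edgeSet := ⟨d.edge, d.edge_mem⟩

/-- The set of unoriented edges underlying `dartsFrom T d`. -/
def edgesFrom (d : T.Dart) : Set T.edgeSet := toEdge T '' dartsFrom T d

/-- The oriented edges pointing out of the set of vertices `S`. -/
def outBoundary (S : Set V) : Set T.Dart := {d | d.fst ∈ S ∧ d.snd ∉ S}

/-- The unoriented edges both of whose endvertices lie in `S`. -/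
def inducedEdges (S : Set V) : Set T.edgeSet := {e | ∀ v ∈ (e : Sym2 V), v ∈ S}

/-- `{v, w}` belongs to the result if and only if `(v, w) ∈ F` or `(w, v) ∈ F`. -/
def unorient (F : Set T.Dart) : Set T.edgeSet := toEdge T '' F

end Graph

section Probability

variable {V : Type*} (T : SimpleGraph V) {Ω : Type*} [MeasurableSpace Ω] (P : Measure Ω)

/-- `U` is an i.i.d. family, indexed by the edges of `T`, of random variables that are uniformly
distributed on `[0, 1]`. -/
structure IsActivationTimes (U : Ω → T.edgeSet → ℝ) : Prop where
  measurable : Measurable U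
  indep : iIndepFun (fun e ω => U ω e) P
  uniform : ∀ e, P.map (fun ω => U ω e) = volume.restrict (Set.Icc 0 1)

/-- Frozen percolation on the oriented tree `T`: a family `U` of i.i.d. uniform activation times
coupled to a random set `F` of oriented edges. Sets of oriented edges carry the product
σ-algebra. -/
structure IsOrientedFrozenPercolation (U : Ω → T.edgeSet → ℝ) (F : Ω → Set T.Dart) : Prop where
  activation : IsActivationTimes T P U
  measurable : Measurable F
  /-- Almost surely, `d` is frozen if and only if at its activation time there is an open ray that
  starts just behind `d`. -/
  freezing : ∀ᵐ ω ∂P, ∀ d : T.Dart, d ∈ F ω ↔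
    ∃ r : ℕ → T.Dart, IsRay T r ∧ r 0 = d ∧
      ∀ n ≥ 1, U ω (toEdge T (r n)) ≤ U ω (toEdge T d) ∧ r n ∉ F ω
  /-- The joint law is invariant under all automorphisms of the tree. -/
  invariant : ∀ φ : T ≃g T,
    IdentDistrib (fun ω => (fun e => U ω (φ.mapEdgeSet e), {d | φ.toHom.mapDart d ∈ F ω}))
      (fun ω => (U ω, F ω)) P P
  /-- For each finite subtree, the restrictions of the process to the subtrees hanging off it are
  independent of each other. -/
  indep_branches : ∀ S : Set V, S.Finite → (T.induce S).IsTree →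
    iIndepFun (fun (d : outBoundary T S) ω =>
      ((fun e : edgesFrom T d => U ω e), F ω ∩ dartsFrom T d)) P
  /-- For each finite subtree, the restrictions of the process to the subtrees hanging off it are
  jointly independent of the activation times inside. -/
  indep_inside : ∀ S : Set V, S.Finite → (T.induce S).IsTree →
    IndepFun (fun ω (d : outBoundary T S) =>
        ((fun e : edgesFrom T d => U ω e), F ω ∩ dartsFrom T d))
      (fun ω (e : inducedEdges T S) => U ω e) P

/-- `Y` is a copy of `X` that is conditionally independent of `X` given `Z`: the joint laws of
`(Z, X)` and `(Z, Y)` agree (so `X` and `Y` have the same conditional law given `Z`), and `X` and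
`Y` are conditionally independent given the σ-algebra generated by `Z`. -/
structure IsCondIndepCopy {α β : Type*} [MeasurableSpace α] [MeasurableSpace β]
    (Z : Ω → α) (X Y : Ω → β) : Prop where
  measurable : Measurable Y
  identDistrib : IdentDistrib (fun ω => (Z ω, X ω)) (fun ω => (Z ω, Y ω)) P P
  condIndep : ∀ A B : Set β, MeasurableSet A → MeasurableSet B →
    P⟦X ⁻¹' A ∩ Y ⁻¹' B | MeasurableSpace.comap Z inferInstance⟧ =ᵐ[P]
      fun ω => (P⟦X ⁻¹' A | MeasurableSpace.comap Z inferInstance⟧) ω *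
        (P⟦Y ⁻¹' B | MeasurableSpace.comap Z inferInstance⟧) ω

end Probability

end FrozenPercolation

/-! Each oriented edge `d` has an explosion time: the first time at which an open ray starts with
`d`, the value 2 standing for infinity. Let `m` be the smaller of the explosion times of the two
edges that may follow `d`. Then `d` freezes if and only if `m ≤ U_d`, and its own explosion time is
`chi U_d m`. By the independence and invariance assumptions, `U_d` and the two branches behind `d`
are independent, and all explosion times have the same law. So the process is a recursive tree
process driven by `U`.

The law of an explosion time is forced. Among edges that have not exploded by time `s`, the open
cluster must not be supercritical (`two_mul_real_lt_explosion_le`). Together with a bound on the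
decrements of the tail, this makes the tail equal to `min 1 (1 / (2 t))` on `(0, 1]` and puts the
remaining mass at 2 (`map_explosion`).

The core is nonendogeny: a law `rho` of pairs, not concentrated on the diagonal and with the right
marginals, solves the recursion in which both coordinates use the same activation time
(`stepLaw_eq_rho`). After the time change `phi` one looks for a scale invariant solution. Its
distribution function is governed by a function `b` of the ratio of the two times, and the recursion
becomes a boundary value problem for `b`, solved explicitly in `nonempty_scalingProfile`. Place
i.i.d. pairs with law `rho` at the leaves of a tree of depth `n`. This gives two processes with the
same activation times inside, each with the true law, whose freezing at the root differs with a
probability that does not depend on `n`. Hence `n` generations of activation times cannot predict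
freezing at the root. Lévy's upward theorem extends this to all activation times, with a mean
squared error of at least some `δ > 0` (`exists_le_integral_sub_condExp`).

Positive uncertainty becomes almost sure disagreement by independence. The edges that hang off a ray
start independent branches, so two conditionally independent copies agree on `n` of them with
probability at most `(1 - 2 δ) ^ n` (`exists_collision_le`). Forgetting orientations loses nothing:
the oriented set is a function of `U` and the unoriented set, because the reverses of the edges on a
minimal ray never freeze (`mem_iff_of_freezingRule`). This gives (a). If the frozen set were almost
surely a function of `U`, it would be a conditionally independent copy of itself, so (a) implies
(b). -/

namespace FrozenPercolation

/-! ### Oriented edges as a binary tree: children, branches and small subtrees. -/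

section Children

variable {V : Type*} {T : SimpleGraph V}

/-- `ch false d` and `ch true d` are the two oriented edges that may follow `d` in a ray. -/
structure IsChildMap (T : SimpleGraph V) (ch : Bool → T.Dart → T.Dart) : Prop where
  fst_eq : ∀ b d, (ch b d).fst = d.snd
  snd_ne : ∀ b d, (ch b d).snd ≠ d.fst
  ne : ∀ d, ch false d ≠ ch true d
  exists_eq : ∀ d d' : T.Dart, d'.fst = d.snd → d'.snd ≠ d.fst → ∃ b, d' = ch b d

theorem exists_isChildMap [T.LocallyFinite] (hreg : T.IsRegularOfDegree 3) :
    ∃ ch, IsChildMap T ch := by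
  classical
  have key : ∀ d : T.Dart, ∃ c : Bool → T.Dart,
      (∀ b, (c b).fst = d.snd ∧ (c b).snd ≠ d.fst) ∧ c false ≠ c true ∧
      ∀ d' : T.Dart, d'.fst = d.snd → d'.snd ≠ d.fst → ∃ b, d' = c b := by
    intro d
    have hmem : d.fst ∈ T.neighborFinset d.snd := by
      rw [SimpleGraph.mem_neighborFinset]; exact d.adj.symm
    have hcard : ((T.neighborFinset d.snd).erase d.fst).card = 2 := by
      rw [Finset.card_erase_of_mem hmem, SimpleGraph.card_neighborFinset_eq_degree,
        hreg.degree_eq]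
    obtain ⟨x, y, hxy, hs⟩ := Finset.card_eq_two.1 hcard
    have hx : x ∈ (T.neighborFinset d.snd).erase d.fst := by rw [hs]; simp
    have hy : y ∈ (T.neighborFinset d.snd).erase d.fst := by rw [hs]; simp
    rw [Finset.mem_erase, SimpleGraph.mem_neighborFinset] at hx hy
    refine ⟨fun b => if b then ⟨(d.snd, y), hy.2⟩ else ⟨(d.snd, x), hx.2⟩, ?_, ?_, ?_⟩
    · rintro (_ | _)
      · exact ⟨rfl, hx.1⟩
      · exact ⟨rfl, hy.1⟩
    · intro h
      apply hxy
      simpa using h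
    · rintro ⟨⟨a, b⟩, hab⟩ h1 h2
      dsimp only at h1 h2
      subst h1
      have : b ∈ (T.neighborFinset d.snd).erase d.fst := by
        rw [Finset.mem_erase, SimpleGraph.mem_neighborFinset]; exact ⟨h2, hab⟩
      rw [hs, Finset.mem_insert, Finset.mem_singleton] at this
      rcases this with rfl | rfl
      · exact ⟨false, rfl⟩
      · exact ⟨true, rfl⟩
  choose c h1 h2 h3 using key
  exact ⟨fun b d => c d b, fun b d => (h1 d b).1, fun b d => (h1 d b).2, h2, h3⟩

/-- The oriented edge reached from `d` by following the word `l`. -/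
def addr (ch : Bool → T.Dart → T.Dart) (d : T.Dart) (l : List Bool) : T.Dart :=
  l.foldl (fun d b => ch b d) d

variable {ch : Bool → T.Dart → T.Dart}

@[simp] theorem addr_nil (d : T.Dart) : addr ch d [] = d := rfl

@[simp] theorem addr_cons (d : T.Dart) (b : Bool) (l : List Bool) :
    addr ch d (b :: l) = addr ch (ch b d) l := rfl

@[simp] theorem addr_append (d : T.Dart) (l l' : List Bool) :
    addr ch d (l ++ l') = addr ch (addr ch d l) l' := by
  simp [addr]

theorem IsChildMap.isRay_iff (hch : IsChildMap T ch) (r : ℕ → T.Dart) :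
    IsRay T r ↔ ∀ n, ∃ b, r (n + 1) = ch b (r n) := by
  refine forall_congr' fun n => ⟨fun h => hch.exists_eq _ _ h.1 h.2, ?_⟩
  rintro ⟨b, hb⟩
  rw [hb]
  exact ⟨hch.fst_eq _ _, hch.snd_ne _ _⟩

theorem IsChildMap.dartsFrom_eq (hch : IsChildMap T ch) (d : T.Dart) :
    dartsFrom T d = Set.range (addr ch d) := by
  ext d'
  constructor
  · rintro ⟨r, m, hr, rfl, rfl⟩
    rw [hch.isRay_iff] at hr
    induction m with
    | zero => exact ⟨[], rfl⟩
    | succ m ih =>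
      obtain ⟨l, hl⟩ := ih
      obtain ⟨b, hb⟩ := hr m
      exact ⟨l ++ [b], by simp [hl, hb]⟩
  · rintro ⟨l, rfl⟩
    have key : ∀ (l : List Bool) (d : T.Dart), ∃ r : ℕ → T.Dart,
        (∀ n, ∃ b, r (n + 1) = ch b (r n)) ∧ r 0 = d ∧ r l.length = addr ch d l := by
      intro l
      induction l with
      | nil =>
        intro d
        exact ⟨fun n => Nat.rec d (fun _ x => ch false x) n, fun n => ⟨false, rfl⟩, rfl, rfl⟩
      | cons b l ih =>
        intro d
        obtain ⟨r, h1, h2, h3⟩ := ih (ch b d)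
        refine ⟨fun n => Nat.casesOn n d r, ?_, rfl, h3⟩
        rintro (_ | n)
        · exact ⟨b, h2⟩
        · exact h1 n
    obtain ⟨r, h1, h2, h3⟩ := key l d
    exact ⟨r, l.length, (hch.isRay_iff r).2 h1, h2, h3⟩

theorem IsChildMap.self_mem_dartsFrom (hch : IsChildMap T ch) (d : T.Dart) :
    d ∈ dartsFrom T d := by
  rw [hch.dartsFrom_eq]; exact ⟨[], rfl⟩

theorem IsChildMap.child_mem_dartsFrom (hch : IsChildMap T ch) {d d' : T.Dart} (b : Bool)
    (h : d' ∈ dartsFrom T d) : ch b d' ∈ dartsFrom T d := by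
  rw [hch.dartsFrom_eq] at h ⊢
  obtain ⟨l, rfl⟩ := h
  exact ⟨l ++ [b], by simp⟩

theorem IsChildMap.dartsFrom_child_subset (hch : IsChildMap T ch) (b : Bool) (d : T.Dart) :
    dartsFrom T (ch b d) ⊆ dartsFrom T d := by
  rw [hch.dartsFrom_eq, hch.dartsFrom_eq]
  rintro _ ⟨l, rfl⟩
  exact ⟨b :: l, rfl⟩

theorem IsChildMap.edgesFrom_child_subset (hch : IsChildMap T ch) (b : Bool) (d : T.Dart) :
    edgesFrom T (ch b d) ⊆ edgesFrom T d :=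
  Set.image_mono (hch.dartsFrom_child_subset b d)

/-- If a vertex `x` is reached, then all its neighbours are reached. -/
theorem IsChildMap.exists_dart_of_adj (hch : IsChildMap T ch) {x y : V} {d d' : T.Dart}
    (hd' : d' ∈ dartsFrom T d) (hx : d'.snd = x) (hxy : T.Adj x y) :
    (y = d'.fst) ∨ (∃ d'' ∈ dartsFrom T d, d''.fst = x ∧ d''.snd = y) := by
  by_cases h : y = d'.fst
  · exact Or.inl h
  · right
    obtain ⟨b, hb⟩ := hch.exists_eq d' ⟨(x, y), hxy⟩ hx.symm h
    exact ⟨_, hch.child_mem_dartsFrom b hd', by rw [← hb], by rw [← hb]⟩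

theorem IsChildMap.fst_of_mem_dartsFrom (hch : IsChildMap T ch) {d d' : T.Dart}
    (hd' : d' ∈ dartsFrom T d) (hne : d' ≠ d) : ∃ d'' ∈ dartsFrom T d, d''.snd = d'.fst := by
  rw [hch.dartsFrom_eq] at hd' ⊢
  obtain ⟨l, rfl⟩ := hd'
  rcases List.eq_nil_or_concat' l with rfl | ⟨l', b, rfl⟩
  · exact absurd rfl hne
  · exact ⟨_, ⟨l', rfl⟩, by simp [hch.fst_eq]⟩

theorem toEdge_symm (d : T.Dart) : toEdge T d.symm = toEdge T d := by
  simp [toEdge]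

theorem toEdge_eq_of_endpoints {d d' : T.Dart} (h1 : d.fst = d'.snd) (h2 : d.snd = d'.fst) :
    toEdge T d = toEdge T d' := by
  rw [← toEdge_symm d']
  congr 1
  exact SimpleGraph.Dart.ext _ _ (Prod.ext h1 h2)

/-- Every vertex other than `v` is the endpoint of an oriented edge that is reached by a ray
starting at `v`. -/
theorem IsChildMap.exists_mem_dartsFrom (hch : IsChildMap T ch) (hconn : T.Connected) (v x : V) :
    x = v ∨ ∃ d : T.Dart, d.fst = v ∧ ∃ d' ∈ dartsFrom T d, d'.snd = x := by
  obtain ⟨p⟩ := hconn.preconnected x v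
  induction p with
  | nil => exact Or.inl rfl
  | @cons a b c hab p ih =>
    rcases ih with rfl | ⟨d, hd, d', hd', hb⟩
    · exact Or.inr ⟨⟨(b, a), hab.symm⟩, rfl, _, hch.self_mem_dartsFrom _, rfl⟩
    · rcases hch.exists_dart_of_adj hd' hb hab.symm with h | ⟨d'', h, -, h'⟩
      · by_cases hdd : d' = d
        · left; rw [h, hdd, hd]
        · obtain ⟨d3, h3, h4⟩ := hch.fst_of_mem_dartsFrom hd' hdd
          exact Or.inr ⟨d, hd, d3, h3, by rw [h4, h]⟩
      · exact Or.inr ⟨d, hd, d'', h, h'⟩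

/-- The branches that start at `v` carry all activation times together; this splits the σ-algebra of
`U` in `collision_comap`. -/
theorem IsChildMap.exists_mem_edgesFrom (hch : IsChildMap T ch) (hconn : T.Connected) (v : V)
    (e : T.edgeSet) : ∃ d : T.Dart, d.fst = v ∧ e ∈ edgesFrom T d := by
  obtain ⟨e, he⟩ := e
  induction e using Sym2.ind with
  | _ x y =>
  have hxy : T.Adj x y := he
  have hE : (⟨s(x, y), he⟩ : T.edgeSet) = toEdge T ⟨(x, y), hxy⟩ := rfl
  rw [hE]
  rcases hch.exists_mem_dartsFrom hconn v x with rfl | ⟨d, hd, d', hd', hx⟩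
  · exact ⟨_, rfl, _, hch.self_mem_dartsFrom _, rfl⟩
  · rcases hch.exists_dart_of_adj hd' hx hxy with h | ⟨d'', h, h1, h2⟩
    · exact ⟨d, hd, d', hd', toEdge_eq_of_endpoints h.symm hx⟩
    · refine ⟨d, hd, d'', h, congrArg _ ?_⟩
      exact SimpleGraph.Dart.ext _ _ (Prod.ext h1 h2)

theorem isTree_induce_singleton (v : V) : (T.induce ({v} : Set V)).IsTree :=
  SimpleGraph.IsTree.of_subsingleton

/-- For this subtree the edge of `d` is inside and both children of `d` point out, so `U_d` and the
two branches behind `d` are independent. -/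
theorem isTree_induce_pair (hT : T.IsTree) (d : T.Dart) :
    (T.induce ({d.fst, d.snd} : Set V)).IsTree := by
  refine ⟨?_, hT.isAcyclic.induce _⟩
  have h1 : d.fst ∈ ({d.fst, d.snd} : Set V) := by simp
  have h2 : d.snd ∈ ({d.fst, d.snd} : Set V) := by simp
  have hadj : (T.induce ({d.fst, d.snd} : Set V)).Adj ⟨_, h1⟩ ⟨_, h2⟩ := d.adj
  have key : ∀ x : ({d.fst, d.snd} : Set V),
      (T.induce ({d.fst, d.snd} : Set V)).Reachable ⟨_, h1⟩ x := by
    rintro ⟨x, rfl | rfl⟩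
    · exact SimpleGraph.Reachable.refl _
    · exact hadj.reachable
  have : Nonempty ({d.fst, d.snd} : Set V) := ⟨⟨_, h1⟩⟩
  exact ⟨fun x y => (key x).symm.trans (key y)⟩

end Children

/-! ### Coordinates on the tree and transitivity on oriented edges. -/

section Automorphisms

variable {V : Type*} {T : SimpleGraph V} {ch : Bool → T.Dart → T.Dart}

/-- Paths in a tree are unique, so only one neighbour of `x` is closer to `v`. -/
theorem eq_of_adj_of_dist (hT : T.IsTree) {v x y z : V} (hy : T.Adj y x) (hz : T.Adj z x)
    (hdy : T.dist v x = T.dist v y + 1) (hdz : T.dist v x = T.dist v z + 1) : y = z := by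
  obtain ⟨p, hp⟩ := hT.connected.exists_walk_length_eq_dist v y
  obtain ⟨q, hq⟩ := hT.connected.exists_walk_length_eq_dist v z
  have h1 : (p.concat hy).IsPath := SimpleGraph.Walk.isPath_of_length_eq_dist _ (by simp [hp, hdy])
  have h2 : (q.concat hz).IsPath := SimpleGraph.Walk.isPath_of_length_eq_dist _ (by simp [hq, hdz])
  have h3 : p.concat hy = q.concat hz :=
    (hT.existsUnique_path v x).unique h1 h2
  have := congrArg SimpleGraph.Walk.penultimate h3
  simpa using this

/-- Non-backtracking walks are geodesics: each step changes the distance by one, and it cannot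
decrease it, because the only closer neighbour is the vertex one has just left. -/
theorem IsChildMap.dist_addr (hch : IsChildMap T ch) (hT : T.IsTree) (e : T.Dart)
    (l : List Bool) : T.dist e.fst (addr ch e l).snd = l.length + 1 ∧
      T.dist e.fst (addr ch e l).fst = l.length := by
  induction l using List.reverseRecOn with
  | nil => simp [SimpleGraph.dist_eq_one_iff_adj.2 e.adj]
  | append_singleton l b ih =>
    have hfst : (addr ch e (l ++ [b])).fst = (addr ch e l).snd := by simp [hch.fst_eq]
    have hsnd : (addr ch e (l ++ [b])).snd ≠ (addr ch e l).fst := by simp [hch.snd_ne]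
    generalize addr ch e (l ++ [b]) = d at *
    generalize addr ch e l = d' at *
    rw [hfst]
    refine ⟨?_, by simpa using ih.1⟩
    rcases hT.dist_eq_dist_add_one_of_adj e.fst d.adj with h | h
    · exfalso
      apply hsnd
      refine eq_of_adj_of_dist hT (v := e.fst) d.adj.symm ?_ h ?_
      · rw [hfst]; exact d'.adj
      · rw [hfst, ih.1, ih.2]
    · rw [h, hfst, ih.1]; simp

/-- Equal endpoints are at equal distance, so the words have equal length. Since the closer
neighbour is unique, the two words can be retraced letter by letter. -/
theorem IsChildMap.addr_injective (hch : IsChildMap T ch) (hT : T.IsTree) {v : V} {e e' : T.Dart}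
    (he : e.fst = v) (he' : e'.fst = v) {l l' : List Bool}
    (h : (addr ch e l).snd = (addr ch e' l').snd) : e = e' ∧ l = l' := by
  induction l using List.reverseRecOn generalizing l' with
  | nil =>
    have h1 := (hch.dist_addr hT e []).1
    have h2 := (hch.dist_addr hT e' l').1
    rw [h, he, ← he', h2] at h1
    have : l' = [] := List.length_eq_zero_iff.1 (by simpa using h1)
    subst this
    exact ⟨SimpleGraph.Dart.ext _ _ (Prod.ext (he.trans he'.symm) h), rfl⟩
  | append_singleton l b ih =>
    have h1 := hch.dist_addr hT e (l ++ [b])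
    have h2 := hch.dist_addr hT e' l'
    have h3 : (l ++ [b]).length = l'.length := by
      have := h1.1
      rw [h, he, ← he', h2.1] at this
      omega
    rcases List.eq_nil_or_concat' l' with rfl | ⟨l', b', rfl⟩
    · simp at h3
    have h4 : (addr ch e (l ++ [b])).fst = (addr ch e' (l' ++ [b'])).fst := by
      refine eq_of_adj_of_dist hT (v := v) (SimpleGraph.Dart.adj _)
        (h ▸ SimpleGraph.Dart.adj _) ?_ ?_
      · rw [← he, h1.1, h1.2]
      · rw [h, ← he', h2.1, h2.2]
    have h5 : addr ch e (l ++ [b]) = addr ch e' (l' ++ [b']) :=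
      SimpleGraph.Dart.ext _ _ (Prod.ext h4 h)
    have h6 : (addr ch e l).snd = (addr ch e' l').snd := by
      simpa [hch.fst_eq] using h4
    obtain ⟨rfl, rfl⟩ := ih h6
    refine ⟨rfl, ?_⟩
    simp only [addr_append, addr_cons, addr_nil] at h5
    have := hch.ne (addr ch e l)
    cases b <;> cases b' <;> simp_all

/-- The vertex with coordinates `i`, seen from the oriented edge `d`. -/
def coordVertex (ch : Bool → T.Dart → T.Dart) (d : T.Dart) (i : Bool × List Bool) : V :=
  (addr ch (if i.1 then d else d.symm) i.2).snd

theorem IsChildMap.coordVertex_injective (hch : IsChildMap T ch) (hT : T.IsTree) (d : T.Dart) :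
    Function.Injective (coordVertex ch d) := by
  have hd : ∀ b, ch b d.symm ≠ d := by
    intro b h
    have := hch.snd_ne b d.symm
    rw [h] at this
    exact this rfl
  have hc : ∀ b, (ch b d.symm).fst = d.fst := fun b => hch.fst_eq b d.symm
  have hroot : ∀ (e : T.Dart) (l : List Bool), e.fst = d.fst → (addr ch e l).snd ≠ d.fst := by
    intro e l he h
    have := (hch.dist_addr hT e l).1
    rw [h, he] at this
    simp at this
  rintro ⟨b, l⟩ ⟨b', l'⟩ h
  simp only [coordVertex] at h
  -- All words are compared from `d.fst`: a nonempty word on the side of `d.symm` is stripped of its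
  -- first letter `a`, since `ch a d.symm` starts at `d.fst`.
  cases b <;> cases b'
  · rcases l with _ | ⟨a, l⟩ <;> rcases l' with _ | ⟨a', l'⟩
    · rfl
    · exact absurd h.symm (hroot (ch a' d.symm) l' (hc _))
    · exact absurd h (hroot (ch a d.symm) l (hc _))
    · simp only [Bool.false_eq_true, if_false, addr_cons] at h
      obtain ⟨h1, rfl⟩ := hch.addr_injective hT (hc _) (hc _) h
      have := hch.ne d.symm
      cases a <;> cases a' <;> simp_all
  · rcases l with _ | ⟨a, l⟩
    · exact absurd h.symm (hroot _ _ rfl)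
    · simp only [Bool.false_eq_true, if_false, addr_cons, if_true] at h
      exact absurd (hch.addr_injective hT (hc _) rfl h).1 (hd _)
  · rcases l' with _ | ⟨a, l'⟩
    · exact absurd h (hroot _ _ rfl)
    · simp only [Bool.false_eq_true, if_false, addr_cons, if_true] at h
      exact absurd (hch.addr_injective hT rfl (hc _) h).1.symm (hd _)
  · simp only [if_true] at h
    rw [(hch.addr_injective hT rfl rfl h).2]

/-- The adjacency relation in coordinates. -/
def CoordAdj (i j : Bool × List Bool) : Prop :=
  (∃ b, j = (i.1, i.2 ++ [b])) ∨ (∃ b, i = (j.1, j.2 ++ [b])) ∨ (i.2 = [] ∧ j = (!i.1, []))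

theorem IsChildMap.adj_coordVertex (hch : IsChildMap T ch) (d : T.Dart) {i j : Bool × List Bool}
    (h : CoordAdj i j) : T.Adj (coordVertex ch d i) (coordVertex ch d j) := by
  have key : ∀ (i : Bool × List Bool) (b : Bool),
      T.Adj (coordVertex ch d i) (coordVertex ch d (i.1, i.2 ++ [b])) := by
    intro i b
    simp only [coordVertex, addr_append, addr_cons, addr_nil]
    rw [← hch.fst_eq b]
    exact SimpleGraph.Dart.adj _
  rcases h with ⟨b, rfl⟩ | ⟨b, rfl⟩ | ⟨h, rfl⟩
  · exact key _ _
  · exact (key _ _).symm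
  · obtain ⟨b, l⟩ := i
    subst h
    cases b
    · exact d.adj
    · exact d.adj.symm

/-- With `adj_coordVertex`, adjacency depends on the coordinates alone, so a change of the base edge
is an automorphism. -/
theorem IsChildMap.exists_coordAdj (hch : IsChildMap T ch) (d : T.Dart) {i : Bool × List Bool}
    {y : V} (h : T.Adj (coordVertex ch d i) y) :
    ∃ j, coordVertex ch d j = y ∧ CoordAdj i j := by
  obtain ⟨b, l⟩ := i
  by_cases hy : y = (addr ch (if b then d else d.symm) l).fst
  · rcases List.eq_nil_or_concat' l with rfl | ⟨l', b', rfl⟩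
    · refine ⟨(!b, []), ?_, Or.inr (Or.inr ⟨rfl, rfl⟩)⟩
      rw [hy]
      cases b <;> rfl
    · refine ⟨(b, l'), ?_, Or.inr (Or.inl ⟨b', rfl⟩)⟩
      rw [hy]
      simp [coordVertex, hch.fst_eq]
  · obtain ⟨b', hb'⟩ := hch.exists_eq (addr ch (if b then d else d.symm) l) ⟨(_, y), h⟩ rfl hy
    refine ⟨(b, l ++ [b']), ?_, Or.inl ⟨b', rfl⟩⟩
    simp only [coordVertex, addr_append, addr_cons, addr_nil]
    rw [← hb']

theorem IsChildMap.coordVertex_surjective (hch : IsChildMap T ch) (hT : T.IsTree) (d : T.Dart) :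
    Function.Surjective (coordVertex ch d) := by
  intro y
  obtain ⟨v, hv⟩ : ∃ v, v = d.fst := ⟨_, rfl⟩
  obtain ⟨p⟩ := hT.connected.preconnected y v
  induction p with
  | nil => exact ⟨(false, []), hv.symm⟩
  | cons h p ih =>
    obtain ⟨i, hi⟩ := ih hv
    obtain ⟨j, hj, -⟩ := hch.exists_coordAdj d (i := i) (hi ▸ h.symm)
    exact ⟨j, hj⟩

/-- The automorphism group of a 3-regular tree acts transitively on the oriented edges. -/
theorem IsChildMap.exists_iso (hch : IsChildMap T ch) (hT : T.IsTree) (d d' : T.Dart) :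
    ∃ φ : T ≃g T, φ.toHom.mapDart d = d' := by
  let E : ∀ d : T.Dart, Bool × List Bool ≃ V := fun d =>
    Equiv.ofBijective _ ⟨hch.coordVertex_injective hT d, hch.coordVertex_surjective hT d⟩
  have hom : ∀ (d d' : T.Dart) {x y : V}, T.Adj x y →
      T.Adj (E d' ((E d).symm x)) (E d' ((E d).symm y)) := by
    intro d d' x y hxy
    obtain ⟨i, rfl⟩ := (E d).surjective x
    obtain ⟨j, rfl, hj⟩ := hch.exists_coordAdj d hxy
    have : coordVertex ch d j = E d j := rfl
    rw [this, Equiv.symm_apply_apply, Equiv.symm_apply_apply]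
    exact hch.adj_coordVertex d' hj
  refine ⟨⟨(E d).symm.trans (E d'), ?_⟩, ?_⟩
  · intro x y
    refine ⟨fun h => ?_, fun h => hom d d' h⟩
    simpa using hom d' d h
  · have h1 : E d' ((E d).symm d.fst) = d'.fst := by
      have : d.fst = E d (false, []) := rfl
      rw [this, Equiv.symm_apply_apply]; rfl
    have h2 : E d' ((E d).symm d.snd) = d'.snd := by
      have : d.snd = E d (true, []) := rfl
      rw [this, Equiv.symm_apply_apply]; rfl
    exact SimpleGraph.Dart.ext _ _ (Prod.ext h1 h2)

end Automorphisms
end FrozenPercolation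

namespace FrozenPercolation

/-! ### Explosion times, the freezing recursion and the recovery of orientations. -/

section Explosion

open Topology

variable {V : Type*} {T : SimpleGraph V} (ch : Bool → T.Dart → T.Dart)

open Classical in
/-- The first time at which there is an open path of `n + 1` oriented edges starting with `d`, where
the elements of `A` never open. The value `2` stands for `∞`. -/
noncomputable def reachTime (u : T.Dart → ℝ) (A : Set T.Dart) : ℕ → T.Dart → ℝ
  | 0, d => if d ∈ A then 2 else min 2 (u d)
  | n + 1, d => if d ∈ A then 2 else max (min 2 (u d))
      (min (reachTime u A n (ch false d)) (reachTime u A n (ch true d)))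

/-- The first time at which there is an open ray starting with `d`. -/
noncomputable def explosionTime (u : T.Dart → ℝ) (A : Set T.Dart) (d : T.Dart) : ℝ :=
  ⨆ n, reachTime ch u A n d

/-- An edge that activates at time `u` while behind it explosion occurs at time `m`. -/
noncomputable def chi (u m : ℝ) : ℝ := if u < m then m else 2

variable {ch} {u : T.Dart → ℝ} {A : Set T.Dart}

theorem reachTime_le_two (n : ℕ) (d : T.Dart) : reachTime ch u A n d ≤ 2 := by
  induction n generalizing d with
  | zero => unfold reachTime; split_ifs <;> simp
  | succ n ih =>
    unfold reachTime
    split_ifs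
    · simp
    · exact max_le (min_le_left _ _) ((min_le_left _ _).trans (ih _))

theorem reachTime_le_succ (n : ℕ) (d : T.Dart) :
    reachTime ch u A n d ≤ reachTime ch u A (n + 1) d := by
  induction n generalizing d with
  | zero => simp only [reachTime]; split_ifs <;> simp
  | succ n ih =>
    rw [reachTime, reachTime]
    split_ifs
    · simp
    · exact max_le_max le_rfl (min_le_min (ih _) (ih _))

theorem bddAbove_reachTime (d : T.Dart) : BddAbove (Set.range fun n => reachTime ch u A n d) :=
  ⟨2, by rintro _ ⟨n, rfl⟩; exact reachTime_le_two n d⟩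

theorem tendsto_reachTime (d : T.Dart) :
    Tendsto (fun n => reachTime ch u A n d) atTop (𝓝 (explosionTime ch u A d)) :=
  tendsto_atTop_ciSup (monotone_nat_of_le_succ fun n => reachTime_le_succ n d)
    (bddAbove_reachTime d)

theorem reachTime_le_explosionTime (n : ℕ) (d : T.Dart) :
    reachTime ch u A n d ≤ explosionTime ch u A d :=
  le_ciSup (bddAbove_reachTime d) n

theorem explosionTime_le_two (d : T.Dart) : explosionTime ch u A d ≤ 2 :=
  ciSup_le fun n => reachTime_le_two n d

theorem explosionTime_of_mem {d : T.Dart} (h : d ∈ A) : explosionTime ch u A d = 2 := by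
  refine le_antisymm (explosionTime_le_two d) ?_
  refine le_trans ?_ (reachTime_le_explosionTime 0 d)
  simp [reachTime, h]

/-- Minimum and maximum are continuous, so the recursion for `reachTime` passes to the limit. -/
theorem explosionTime_of_notMem {d : T.Dart} (h : d ∉ A) :
    explosionTime ch u A d = max (min 2 (u d))
      (min (explosionTime ch u A (ch false d)) (explosionTime ch u A (ch true d))) := by
  have h1 := (tendsto_reachTime (ch := ch) (u := u) (A := A) d).comp (tendsto_add_atTop_nat 1)
  refine tendsto_nhds_unique h1 ?_
  have h2 : ((fun n => reachTime ch u A n d) ∘ fun n => n + 1) = fun n => max (min 2 (u d))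
      (min (reachTime ch u A n (ch false d)) (reachTime ch u A n (ch true d))) := by
    funext n
    simp [reachTime, h]
  rw [h2]
  exact tendsto_const_nhds.max ((tendsto_reachTime _).min (tendsto_reachTime _))

theorem exists_seq_of_forall_exists_child (P : T.Dart → Prop) (h : ∀ d, P d → ∃ b, P (ch b d))
    {d : T.Dart} (hd : P d) :
    ∃ r : ℕ → T.Dart, (∀ n, ∃ b, r (n + 1) = ch b (r n)) ∧ r 0 = d ∧ ∀ n, P (r n) := by
  choose b hb using h
  let r : ℕ → {d // P d} := fun n => Nat.rec ⟨d, hd⟩ (fun _ x => ⟨_, hb x.1 x.2⟩) n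
  exact ⟨fun n => (r n).1, fun n => ⟨_, rfl⟩, rfl, fun n => (r n).2⟩

/-- König's lemma in terms of times: by the recursion, explosion by time `t` is inherited by some
child, and following such children produces the ray. The bound `t < 2` keeps away from the value
that encodes infinity. -/
theorem explosionTime_le_iff {t : ℝ} (ht : t < 2) (d : T.Dart) :
    explosionTime ch u A d ≤ t ↔ ∃ r : ℕ → T.Dart, (∀ n, ∃ b, r (n + 1) = ch b (r n)) ∧ r 0 = d ∧
      ∀ n, u (r n) ≤ t ∧ r n ∉ A := by
  constructor
  · intro h
    have hP : ∀ d, explosionTime ch u A d ≤ t → u d ≤ t ∧ d ∉ A ∧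
        ∃ b, explosionTime ch u A (ch b d) ≤ t := by
      intro d hd
      have hA : d ∉ A := fun hA => by rw [explosionTime_of_mem hA] at hd; linarith
      rw [explosionTime_of_notMem hA, max_le_iff, min_le_iff, min_le_iff] at hd
      refine ⟨hd.1.resolve_left (not_le.2 ht), hA, ?_⟩
      rcases hd.2 with h | h
      · exact ⟨_, h⟩
      · exact ⟨_, h⟩
    obtain ⟨r, h1, h2, h3⟩ := exists_seq_of_forall_exists_child
      (fun d => explosionTime ch u A d ≤ t) (fun d hd => (hP d hd).2.2) h
    exact ⟨r, h1, h2, fun n => ⟨(hP _ (h3 n)).1, (hP _ (h3 n)).2.1⟩⟩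
  · rintro ⟨r, h1, rfl, h3⟩
    refine ciSup_le fun n => ?_
    suffices ∀ m, reachTime ch u A n (r m) ≤ t from this 0
    induction n with
    | zero =>
      intro m
      simp only [reachTime, (h3 m).2, if_false]
      exact (min_le_right _ _).trans (h3 m).1
    | succ n ih =>
      intro m
      simp only [reachTime, (h3 m).2, if_false]
      refine max_le ((min_le_right _ _).trans (h3 m).1) ?_
      obtain ⟨b, hb⟩ := h1 m
      have := ih (m + 1)
      rw [hb] at this
      cases b
      · exact (min_le_left _ _).trans this
      · exact (min_le_right _ _).trans this

/-- The freezing rule, expressed in terms of explosion times. -/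
def FreezingRule (ch : Bool → T.Dart → T.Dart) (u : T.Dart → ℝ) (A : Set T.Dart) (d : T.Dart) :
    Prop :=
  d ∈ A ↔ min (explosionTime ch u A (ch false d)) (explosionTime ch u A (ch true d)) ≤ u d

theorem IsChildMap.freezingRule_iff (hch : IsChildMap T ch) {d : T.Dart} (hu : u d < 2) :
    FreezingRule ch u A d ↔ (d ∈ A ↔ ∃ r : ℕ → T.Dart, IsRay T r ∧ r 0 = d ∧
      ∀ n ≥ 1, u (r n) ≤ u d ∧ r n ∉ A) := by
  unfold FreezingRule
  refine iff_congr Iff.rfl ?_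
  rw [min_le_iff, explosionTime_le_iff hu, explosionTime_le_iff hu]
  have key : (∃ b, ∃ r : ℕ → T.Dart, (∀ n, ∃ b, r (n + 1) = ch b (r n)) ∧ r 0 = ch b d ∧
      ∀ n, u (r n) ≤ u d ∧ r n ∉ A) ↔ ∃ r : ℕ → T.Dart, IsRay T r ∧ r 0 = d ∧
      ∀ n ≥ 1, u (r n) ≤ u d ∧ r n ∉ A := by
    constructor
    · rintro ⟨b, r, h1, h2, h3⟩
      refine ⟨fun n => Nat.casesOn n d r, ?_, rfl, ?_⟩
      · rw [hch.isRay_iff]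
        rintro (_ | n)
        · exact ⟨b, h2⟩
        · exact h1 n
      · rintro (_ | n) hn
        · omega
        · exact h3 n
    · rintro ⟨r, h1, rfl, h3⟩
      rw [hch.isRay_iff] at h1
      obtain ⟨b, hb⟩ := h1 0
      exact ⟨b, fun n => r (n + 1), fun n => h1 (n + 1), hb, fun n => h3 (n + 1) (by omega)⟩
  rw [← key]
  simp [Bool.exists_bool]

/-- A frozen edge never explodes. An edge that does not freeze has activated before anything behind
it explodes, so its own activation time drops out of the maximum. -/
theorem FreezingRule.explosionTime_eq {d : T.Dart} (h : FreezingRule ch u A d) :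
    explosionTime ch u A d = chi (u d)
      (min (explosionTime ch u A (ch false d)) (explosionTime ch u A (ch true d))) := by
  unfold chi
  by_cases hd : d ∈ A
  · rw [explosionTime_of_mem hd, if_neg (not_lt.2 (h.1 hd))]
  · have h1 := not_le.1 (mt h.2 hd)
    rw [if_pos h1, explosionTime_of_notMem hd, max_eq_right ((min_le_right _ _).trans h1.le)]

theorem reachTime_mono_set {B : Set T.Dart} (hAB : A ⊆ B) (n : ℕ) (d : T.Dart) :
    reachTime ch u A n d ≤ reachTime ch u B n d := by
  induction n generalizing d with
  | zero =>
    by_cases hB : d ∈ B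
    · have := reachTime_le_two (ch := ch) (u := u) (A := A) 0 d
      simpa [reachTime, hB] using this
    · have hA : d ∉ A := fun h => hB (hAB h)
      simp [reachTime, hA, hB]
  | succ n ih =>
    by_cases hB : d ∈ B
    · have := reachTime_le_two (ch := ch) (u := u) (A := A) (n + 1) d
      rw [reachTime] at this
      simpa [reachTime, hB] using this
    · have hA : d ∉ A := fun h => hB (hAB h)
      simp only [reachTime, hA, hB, if_false]
      exact max_le_max le_rfl (min_le_min (ih _) (ih _))

theorem explosionTime_mono_set {B : Set T.Dart} (hAB : A ⊆ B) (d : T.Dart) :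
    explosionTime ch u A d ≤ explosionTime ch u B d :=
  ciSup_mono (bddAbove_reachTime d) fun n => reachTime_mono_set hAB n d

theorem IsChildMap.children_symm (hch : IsChildMap T ch) (b : Bool) (d : T.Dart) (b' : Bool) :
    ch b' (ch b d).symm = d.symm ∨ ch b' (ch b d).symm = ch (!b) d := by
  have h1 : (ch b' (ch b d).symm).fst = d.snd := by
    rw [hch.fst_eq]; exact hch.fst_eq b d
  have h2 : (ch b' (ch b d).symm).snd ≠ (ch b d).snd := hch.snd_ne b' (ch b d).symm
  by_cases h3 : (ch b' (ch b d).symm).snd = d.fst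
  · exact Or.inl (SimpleGraph.Dart.ext _ _ (Prod.ext h1 h3))
  · obtain ⟨a, ha⟩ := hch.exists_eq _ _ h1 h3
    right
    have : a ≠ b := by
      rintro rfl
      rw [ha] at h2
      exact h2 rfl
    rw [ha]
    cases a <;> cases b <;> simp_all

/-- The reverses of the oriented edges on a minimal ray never freeze, so that the set of frozen
oriented edges can be recovered from the unoriented frozen edges. -/
theorem IsChildMap.mem_iff_of_freezingRule (hch : IsChildMap T ch)
    (hA : ∀ d, FreezingRule ch u A d) (hu : ∀ d, u d < 2) (hsymm : ∀ d : T.Dart, u d.symm = u d)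
    (d : T.Dart) : d ∈ A ↔
      min (explosionTime ch u {d | d ∈ A ∨ d.symm ∈ A} (ch false d))
        (explosionTime ch u {d | d ∈ A ∨ d.symm ∈ A} (ch true d)) ≤ u d := by
  set B : Set T.Dart := {d | d ∈ A ∨ d.symm ∈ A} with hB
  have hAB : A ⊆ B := fun d hd => Or.inl hd
  have hmin : ∀ x : T.Dart, ∃ b, explosionTime ch u A (ch b x) =
      min (explosionTime ch u A (ch false x)) (explosionTime ch u A (ch true x)) := by
    intro x
    rcases min_choice (explosionTime ch u A (ch false x)) (explosionTime ch u A (ch true x))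
      with h | h
    · exact ⟨false, h.symm⟩
    · exact ⟨true, h.symm⟩
  have hle : ∀ (x : T.Dart) (b : Bool), min (explosionTime ch u A (ch false x))
      (explosionTime ch u A (ch true x)) ≤ explosionTime ch u A (ch b x) := by
    intro x b
    cases b
    · exact min_le_left _ _
    · exact min_le_right _ _
  constructor
  · intro hd
    obtain ⟨t, ht⟩ : ∃ t, t = min (explosionTime ch u A (ch false d))
      (explosionTime ch u A (ch true d)) := ⟨_, rfl⟩
    have htd : t ≤ u d := ht ▸ (hA d).1 hd
    have ht2 : t < 2 := htd.trans_lt (hu d)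
    -- the invariant along the minimal ray
    let P : T.Dart → Prop := fun x => explosionTime ch u A x = t ∧
      t ≤ explosionTime ch u A x.symm ∧ x.symm ∉ A
    have hnot : ∀ x, explosionTime ch u A x = t → x ∉ A := by
      intro x hx h
      rw [explosionTime_of_mem h] at hx
      linarith
    have hval : ∀ x, explosionTime ch u A x = t → u x < t ∧
        min (explosionTime ch u A (ch false x)) (explosionTime ch u A (ch true x)) = t := by
      intro x hx
      have h1 := not_le.1 (mt (hA x).2 (hnot x hx))
      have h2 := (hA x).explosionTime_eq
      rw [chi, if_pos h1, hx] at h2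
      exact ⟨h2 ▸ h1, h2.symm⟩
    have step : ∀ x, min (explosionTime ch u A (ch false x)) (explosionTime ch u A (ch true x)) = t →
        t ≤ explosionTime ch u A x.symm → ∃ b, P (ch b x) := by
      intro x hx hsx
      obtain ⟨b, hb⟩ := hmin x
      rw [hx] at hb
      -- Behind the reversed child lie the reverse of `x`, late by the invariant, and the sibling,
      -- late by minimality. The child activates before `t`, so at that moment nothing behind its
      -- reverse has exploded, and the reverse does not freeze.
      have hc : ∀ b', t ≤ explosionTime ch u A (ch b' (ch b x).symm) := by
        intro b'
        rcases hch.children_symm b x b' with h | h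
        · rw [h]; exact hsx
        · rw [h, ← hx]; exact hle x _
      have hc' : t ≤ min (explosionTime ch u A (ch false (ch b x).symm))
          (explosionTime ch u A (ch true (ch b x).symm)) := le_min (hc _) (hc _)
      have hnA : (ch b x).symm ∉ A := by
        intro h
        have h' := (hA (ch b x).symm).1 h
        rw [hsymm] at h'
        exact absurd (hc'.trans h') (not_le.2 (hval _ hb).1)
      refine ⟨b, hb, ?_, hnA⟩
      rw [explosionTime_of_notMem hnA]
      exact hc'.trans (le_max_right _ _)
    -- A frozen reverse has explosion time 2; otherwise explosion does not precede activation, which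
    -- happens at `u d ≥ t`.
    have hd0 : t ≤ explosionTime ch u A d.symm := by
      by_cases h : d.symm ∈ A
      · rw [explosionTime_of_mem h]; exact ht2.le
      · rw [explosionTime_of_notMem h, hsymm]
        exact (le_min ht2.le htd).trans (le_max_left _ _)
    obtain ⟨b, hb⟩ := step d ht.symm hd0
    obtain ⟨r, h1, h2, h3⟩ := exists_seq_of_forall_exists_child P
      (fun x hx => step x (hval x hx.1).2 hx.2.1) hb
    have h4 : explosionTime ch u B (ch b d) ≤ t := by
      rw [explosionTime_le_iff ht2]
      refine ⟨r, h1, h2, fun n => ⟨(hval _ (h3 n).1).1.le, ?_⟩⟩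
      rintro (h | h)
      · exact hnot _ (h3 n).1 h
      · exact (h3 n).2.2 h
    refine le_trans ?_ htd
    cases b
    · exact (min_le_left _ _).trans h4
    · exact (min_le_right _ _).trans h4
  · intro h
    refine (hA d).2 (le_trans ?_ h)
    exact min_le_min (explosionTime_mono_set hAB _) (explosionTime_mono_set hAB _)

/-- An automorphism may exchange the two children, which the symmetric minimum does not notice. -/
theorem IsChildMap.reachTime_map (hch : IsChildMap T ch) (φ : T ≃g T) (n : ℕ) (d : T.Dart) :
    reachTime ch (fun d => u (φ.toHom.mapDart d)) {d | φ.toHom.mapDart d ∈ A} n d =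
      reachTime ch u A n (φ.toHom.mapDart d) := by
  induction n generalizing d with
  | zero => simp [reachTime]
  | succ n ih =>
    have hc : ∀ b, ∃ b', φ.toHom.mapDart (ch b d) = ch b' (φ.toHom.mapDart d) := by
      intro b
      refine hch.exists_eq _ _ ?_ ?_
      · exact congrArg φ (hch.fst_eq b d)
      · exact fun h => hch.snd_ne b d (φ.injective h)
    have hne : φ.toHom.mapDart (ch false d) ≠ φ.toHom.mapDart (ch true d) := by
      intro h
      apply hch.ne d
      have h1 := congrArg (fun x => x.fst) h
      have h2 := congrArg (fun x => x.snd) h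
      exact SimpleGraph.Dart.ext _ _ (Prod.ext (φ.injective h1) (φ.injective h2))
    obtain ⟨b0, hb0⟩ := hc false
    obtain ⟨b1, hb1⟩ := hc true
    simp only [reachTime, ih, Set.mem_ofPred_eq, hb0, hb1]
    rw [hb0, hb1] at hne
    cases b0 <;> cases b1
    · exact absurd rfl hne
    · rfl
    · rw [min_comm (reachTime ch u A n (ch true _))]
    · exact absurd rfl hne

theorem IsChildMap.explosionTime_map (hch : IsChildMap T ch) (φ : T ≃g T) (d : T.Dart) :
    explosionTime ch (fun d => u (φ.toHom.mapDart d)) {d | φ.toHom.mapDart d ∈ A} d =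
      explosionTime ch u A (φ.toHom.mapDart d) := by
  simp only [explosionTime, hch.reachTime_map]

theorem IsChildMap.measurable_reachTime (hch : IsChildMap T ch) {Ω : Type*} {m : MeasurableSpace Ω}
    {u : Ω → T.Dart → ℝ} {A : Ω → Set T.Dart} (d : T.Dart)
    (hu : ∀ d' ∈ dartsFrom T d, Measurable fun ω => u ω d')
    (hA : ∀ d' ∈ dartsFrom T d, MeasurableSet {ω | d' ∈ A ω}) (n : ℕ) :
    Measurable fun ω => reachTime ch (u ω) (A ω) n d := by
  induction n generalizing d with
  | zero =>
    simp only [reachTime]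
    exact Measurable.ite (hA d (hch.self_mem_dartsFrom d)) measurable_const
      (measurable_const.min (hu d (hch.self_mem_dartsFrom d)))
  | succ n ih =>
    simp only [reachTime]
    have h : ∀ b, Measurable fun ω => reachTime ch (u ω) (A ω) n (ch b d) := fun b =>
      ih (ch b d) (fun d' hd' => hu d' (hch.dartsFrom_child_subset b d hd'))
        (fun d' hd' => hA d' (hch.dartsFrom_child_subset b d hd'))
    exact Measurable.ite (hA d (hch.self_mem_dartsFrom d)) measurable_const
      ((measurable_const.min (hu d (hch.self_mem_dartsFrom d))).max ((h _).min (h _)))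

theorem IsChildMap.measurable_explosionTime (hch : IsChildMap T ch) {Ω : Type*}
    {m : MeasurableSpace Ω} {u : Ω → T.Dart → ℝ} {A : Ω → Set T.Dart} (d : T.Dart)
    (hu : ∀ d' ∈ dartsFrom T d, Measurable fun ω => u ω d')
    (hA : ∀ d' ∈ dartsFrom T d, MeasurableSet {ω | d' ∈ A ω}) :
    Measurable fun ω => explosionTime ch (u ω) (A ω) d :=
  Measurable.iSup fun n => hch.measurable_reachTime d hu hA n

end Explosion
end FrozenPercolation

namespace FrozenPercolation

/-! ### The scaling function: an explicitly solved boundary value problem. -/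

section Profile

open Set

/-- A solution of the boundary value problem `b b' + b = c r`, `b 0 = 1`, `b 1 = b₁`,
`2 b' 1 = b₁ - 1`. The function `θ` is the parametrization `r = θ b`, with inverse `ψ`. -/
structure ScalingProfile where
  b₁ : ℝ
  c : ℝ
  θ : ℝ → ℝ
  b : ℝ → ℝ
  ψ : ℝ → ℝ
  b₁_pos : 0 < b₁
  b₁_le : b₁ ≤ 1
  two_c : 2 * c = b₁ ^ 2 + b₁
  continuous_θ : Continuous θ
  continuous_b : Continuous b
  measurable_ψ : Measurable ψ
  θ_nonneg : ∀ r, 0 ≤ θ r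
  θ_le : ∀ r, θ r ≤ 1 / b₁
  b_zero : b 0 = 1
  b_one : b 1 = b₁
  θ_mul_b : ∀ r ∈ Icc (0 : ℝ) 1, θ r * b r = r
  hasDerivAt_b : ∀ r ∈ Ioo (0 : ℝ) 1, HasDerivAt b (c * θ r - 1) r
  ψ_pos : ∀ q ∈ Ioc (0 : ℝ) (1 / b₁), 0 < ψ q
  ψ_le : ∀ q ∈ Ioc (0 : ℝ) (1 / b₁), ψ q ≤ 1
  le_ψ_iff : ∀ q ∈ Ioc (0 : ℝ) (1 / b₁), ∀ r ∈ Icc (0 : ℝ) 1, r ≤ ψ q ↔ θ r ≤ q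

/-- Here `v` plays the role of `b₁` and `p (1 + p)` that of `c`. The quadratic equation encodes the
condition on `b' 1`; the logarithmic one says that the solution starting from `b 0 = 1` reaches `b 1
= v`. The first gives `v` as a function of `p`, and the second is then solved by the intermediate
value theorem on `[1/64, 1/2]`. -/
theorem exists_parameter : ∃ p v : ℝ, 0 < p ∧ p < v ∧ v ≤ 1 ∧ v ^ 2 + v = 2 * (p * (1 + p)) ∧
    p * Real.log (v - p) + (1 + p) * Real.log (v + 1 + p) = 0 := by
  set v : ℝ → ℝ := fun p => (-1 + √(1 + 8 * (p * (1 + p)))) / 2 with hv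
  have hvc : Continuous v := by fun_prop
  have hv2 : ∀ p, 0 < p → v p ^ 2 + v p = 2 * (p * (1 + p)) ∧ 0 ≤ v p := by
    intro p hp
    have h0 : 0 ≤ 1 + 8 * (p * (1 + p)) := by positivity
    have h1 := Real.sq_sqrt h0
    have h2 : 1 ≤ √(1 + 8 * (p * (1 + p))) := Real.one_le_sqrt.2 (by nlinarith)
    simp only [hv]
    exact ⟨by nlinarith, by linarith⟩
  have hlt : ∀ p, 0 < p → p < v p := by
    intro p hp
    have := hv2 p hp
    nlinarith
  have hle : ∀ p, 0 < p → v p ≤ 2 * p := by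
    intro p hp
    have := hv2 p hp
    have := hlt p hp
    nlinarith
  set H : ℝ → ℝ := fun p => p * Real.log (v p - p) + (1 + p) * Real.log (v p + 1 + p) with hH
  have hHc : ContinuousOn H (Icc (1 / 64) (1 / 2)) := by
    have hpos : ∀ p ∈ Icc (1 / 64 : ℝ) (1 / 2), 0 < p := fun p hp => by linarith [hp.1]
    refine ContinuousOn.add (continuousOn_id.mul (ContinuousOn.log (by fun_prop) ?_))
      (ContinuousOn.mul (by fun_prop) (ContinuousOn.log (by fun_prop) ?_))
    · intro p hp
      have := hlt p (hpos p hp)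
      exact (sub_pos.2 this).ne'
    · intro p hp
      have := hlt p (hpos p hp)
      have := hpos p hp
      exact ne_of_gt (by linarith)
  have hlo : H (1 / 64) ≤ 0 := by
    have h1 := hlt (1 / 64) (by norm_num)
    have h2 := hle (1 / 64) (by norm_num)
    have h3 : Real.log (v (1 / 64) - 1 / 64) ≤ -4 := by
      rw [Real.log_le_iff_le_exp (by linarith)]
      have h5 : v (1 / 64) - 1 / 64 ≤ 1 / 64 := by linarith
      refine h5.trans ?_
      rw [Real.exp_neg, one_div]
      refine inv_anti₀ (Real.exp_pos _) ?_
      have h6 : Real.exp 4 = Real.exp 1 ^ 4 := by rw [← Real.exp_nat_mul]; norm_num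
      rw [h6]
      have h7 := Real.exp_one_lt_d9
      have h8 := Real.exp_pos 1
      calc Real.exp 1 ^ 4 ≤ (2.8 : ℝ) ^ 4 := by gcongr; linarith
        _ ≤ 64 := by norm_num
    have h4 : Real.log (v (1 / 64) + 1 + 1 / 64) ≤ 3 / 64 := by
      have := Real.log_le_sub_one_of_pos (x := v (1 / 64) + 1 + 1 / 64) (by linarith)
      linarith
    simp only [hH]
    nlinarith
  have hhi : 0 ≤ H (1 / 2) := by
    have h1 := (hv2 (1 / 2) (by norm_num)).1
    have h0 := (hv2 (1 / 2) (by norm_num)).2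
    have h2 : 4 / 5 ≤ v (1 / 2) := by nlinarith
    have h3 : 0 < v (1 / 2) - 1 / 2 := by linarith
    have h4 : 0 < v (1 / 2) + 1 + 1 / 2 := by linarith
    have h5 : H (1 / 2) = 1 / 2 * Real.log ((v (1 / 2) - 1 / 2) * (v (1 / 2) + 1 + 1 / 2) ^ 3) := by
      rw [Real.log_mul h3.ne' (by positivity), Real.log_pow]
      simp only [hH]
      push_cast
      ring
    rw [h5]
    refine mul_nonneg (by norm_num) (Real.log_nonneg ?_)
    calc (1 : ℝ) ≤ (3 / 10) * (23 / 10) ^ 3 := by norm_num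
      _ ≤ _ := by gcongr <;> linarith
  obtain ⟨p, hp, hp0⟩ := intermediate_value_Icc (by norm_num) hHc ⟨hlo, hhi⟩
  have hppos : 0 < p := by linarith [hp.1]
  refine ⟨p, v p, hppos, hlt p hppos, ?_, (hv2 p hppos).1, hp0⟩
  linarith [hle p hppos, hp.2]

/-- In the parameter `q = r / b` the equation separates: `db / b = (c q - 1) dq / (1 + q - c q²)`.
The denominator factors as `(1 - p q) (1 + (1 + p) q)` because `c = p (1 + p)`. Partial fractions
give `b = E q`, and `θ` is the inverse of `r = ψ q = q E q`. -/
theorem nonempty_scalingProfile : Nonempty ScalingProfile := by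
  obtain ⟨p, v, hp, hpv, hv1, hv, hH⟩ := exists_parameter
  have hv0 : 0 < v := hp.trans hpv
  set c := p * (1 + p) with hc
  set E : ℝ → ℝ := fun q => Real.exp (-(p / (1 + 2 * p)) * Real.log (1 - p * q)
    - (1 + p) / (1 + 2 * p) * Real.log (1 + (1 + p) * q)) with hE
  set ψ : ℝ → ℝ := fun q => q * E q with hψ
  have hE0 : ∀ q, 0 < E q := fun q => Real.exp_pos _
  have hfac : ∀ q ∈ Icc (0 : ℝ) (1 / v), 0 < 1 - p * q ∧ 0 < 1 + (1 + p) * q := by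
    intro q hq
    have h1 : p * q < 1 := by
      calc p * q ≤ p * (1 / v) := by gcongr; exact hq.2
        _ < 1 := by rw [mul_one_div, div_lt_one hv0]; exact hpv
    have h2 := hq.1
    exact ⟨by linarith, by positivity⟩
  have hEd : ∀ q ∈ Icc (0 : ℝ) (1 / v), HasDerivAt E
      (-E q * (1 - c * q) / ((1 - p * q) * (1 + (1 + p) * q))) q := by
    intro q hq
    obtain ⟨h1, h2⟩ := hfac q hq
    have d1 : HasDerivAt (fun q : ℝ => 1 - p * q) (-p) q := by
      simpa using ((hasDerivAt_id q).const_mul p).const_sub 1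
    have d2 : HasDerivAt (fun q : ℝ => 1 + (1 + p) * q) (1 + p) q := by
      simpa using ((hasDerivAt_id q).const_mul (1 + p)).const_add 1
    have d3 := (((d1.log h1.ne').const_mul (-(p / (1 + 2 * p)))).sub
      ((d2.log h2.ne').const_mul ((1 + p) / (1 + 2 * p)))).exp
    refine d3.congr_deriv ?_
    change E q * _ = _
    have h3 : (0 : ℝ) < 1 + 2 * p := by positivity
    obtain ⟨x, hx⟩ : ∃ x, x = 1 - p * q := ⟨_, rfl⟩
    obtain ⟨y, hy⟩ : ∃ y, y = 1 + (1 + p) * q := ⟨_, rfl⟩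
    rw [hc, ← hx, ← hy]
    rw [← hx] at h1
    rw [← hy] at h2
    field_simp
    rw [hx, hy]
    ring
  have hψd : ∀ q ∈ Icc (0 : ℝ) (1 / v), HasDerivAt ψ
      (E q / ((1 - p * q) * (1 + (1 + p) * q))) q := by
    intro q hq
    obtain ⟨h1, h2⟩ := hfac q hq
    refine ((hasDerivAt_id q).mul (hEd q hq)).congr_deriv ?_
    simp only [id, hc]
    obtain ⟨x, hx⟩ : ∃ x, x = 1 - p * q := ⟨_, rfl⟩
    obtain ⟨y, hy⟩ : ∃ y, y = 1 + (1 + p) * q := ⟨_, rfl⟩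
    rw [← hx, ← hy]
    rw [← hx] at h1
    rw [← hy] at h2
    field_simp
    rw [hx, hy]
    ring
  have hψc : ContinuousOn ψ (Icc 0 (1 / v)) := fun q hq =>
    (hψd q hq).continuousAt.continuousWithinAt
  have hψm : StrictMonoOn ψ (Icc 0 (1 / v)) := by
    refine strictMonoOn_of_deriv_pos (convex_Icc _ _) hψc ?_
    intro q hq
    rw [interior_Icc] at hq
    have hq' := Ioo_subset_Icc_self hq
    obtain ⟨h1, h2⟩ := hfac q hq'
    rw [(hψd q hq').deriv]
    exact div_pos (hE0 q) (mul_pos h1 h2)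
  have hψ0 : ψ 0 = 0 := by simp [hψ]
  have hψ1 : ψ (1 / v) = 1 := by
    have h1 : 0 < v - p := by linarith
    have h2 : 0 < v + 1 + p := by linarith
    have e1 : 1 - p * (1 / v) = (v - p) / v := by field_simp
    have e2 : 1 + (1 + p) * (1 / v) = (v + 1 + p) / v := by field_simp; ring
    simp only [hψ, hE]
    rw [e1, e2, Real.log_div h1.ne' hv0.ne', Real.log_div h2.ne' hv0.ne']
    -- The weights `p / (1 + 2 p)` and `(1 + p) / (1 + 2 p)` add up to one, which leaves `log v`;
    -- the other logarithms cancel by `hH`.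
    have e3 : -(p / (1 + 2 * p)) * (Real.log (v - p) - Real.log v)
        - (1 + p) / (1 + 2 * p) * (Real.log (v + 1 + p) - Real.log v) = Real.log v := by
      field_simp
      linear_combination -hH
    rw [e3, Real.exp_log hv0]
    field_simp
  have hv' : (0 : ℝ) ≤ 1 / v := by positivity
  have hmaps : ∀ q ∈ Icc (0 : ℝ) (1 / v), ψ q ∈ Icc (0 : ℝ) 1 := by
    intro q hq
    rw [← hψ0, ← hψ1]
    exact ⟨hψm.monotoneOn ⟨le_rfl, hv'⟩ hq hq.1, hψm.monotoneOn hq ⟨hv', le_rfl⟩ hq.2⟩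
  have hsurj : ∀ r ∈ Icc (0 : ℝ) 1, ∃ q ∈ Icc (0 : ℝ) (1 / v), ψ q = r := by
    intro r hr
    have := intermediate_value_Icc hv' hψc
    rw [hψ0, hψ1] at this
    exact this hr
  choose g hg hψg using hsurj
  let G : Icc (0 : ℝ) 1 → Icc (0 : ℝ) (1 / v) := fun r => ⟨g r.1 r.2, hg r.1 r.2⟩
  have hGm : Monotone G := by
    intro r r' h
    have : ψ (G r).1 ≤ ψ (G r').1 := by
      rw [show ψ (G r).1 = r.1 from hψg _ _, show ψ (G r').1 = r'.1 from hψg _ _]; exact h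
    exact (hψm.le_iff_le (G r).2 (G r').2).1 this
  have hGs : Function.Surjective G := by
    intro q
    refine ⟨⟨ψ q.1, hmaps _ q.2⟩, Subtype.ext (hψm.injOn (hg _ _) q.2 (hψg _ _))⟩
  have hGc : Continuous G := hGm.continuous_of_surjective hGs
  set θ : ℝ → ℝ := fun r => (G (projIcc 0 1 zero_le_one r)).1 with hθ
  have hθc : Continuous θ := continuous_subtype_val.comp (hGc.comp continuous_projIcc)
  have hθmem : ∀ r, θ r ∈ Icc (0 : ℝ) (1 / v) := fun r => (G _).2
  have hψθ : ∀ r ∈ Icc (0 : ℝ) 1, ψ (θ r) = r := by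
    intro r hr
    simp only [hθ, projIcc_of_mem zero_le_one hr]
    exact hψg _ _
  have hθ0 : θ 0 = 0 := hψm.injOn (hθmem 0) ⟨le_rfl, hv'⟩ (by rw [hψθ 0 (by simp), hψ0])
  have hθ1 : θ 1 = 1 / v := hψm.injOn (hθmem 1) ⟨hv', le_rfl⟩ (by rw [hψθ 1 (by simp), hψ1])
  have hθpos : ∀ r ∈ Ioo (0 : ℝ) 1, 0 < θ r := by
    intro r hr
    refine lt_of_le_of_ne (hθmem r).1 fun h => ?_
    have := hψθ r (Ioo_subset_Icc_self hr)
    rw [← h, hψ0] at this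
    exact hr.1.ne this
  have hEc : ContinuousOn E (Icc 0 (1 / v)) := fun q hq =>
    (hEd q hq).continuousAt.continuousWithinAt
  have hθd : ∀ r ∈ Ioo (0 : ℝ) 1, HasDerivAt θ
      (E (θ r) / ((1 - p * θ r) * (1 + (1 + p) * θ r)))⁻¹ r := by
    intro r hr
    obtain ⟨h1, h2⟩ := hfac _ (hθmem r)
    refine HasDerivAt.of_local_left_inverse hθc.continuousAt (hψd _ (hθmem r))
      (div_pos (hE0 _) (mul_pos h1 h2)).ne' ?_
    filter_upwards [Ioo_mem_nhds hr.1 hr.2] with y hy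
    exact hψθ y (Ioo_subset_Icc_self hy)
  refine ⟨{
    b₁ := v, c := c, θ := θ, b := fun r => E (θ r), ψ := ψ
    b₁_pos := hv0, b₁_le := hv1, two_c := by rw [hv]
    continuous_θ := hθc
    continuous_b := hEc.comp_continuous hθc hθmem
    measurable_ψ := by simp only [hψ, hE]; fun_prop
    θ_nonneg := fun r => (hθmem r).1
    θ_le := fun r => (hθmem r).2
    b_zero := by simp [hθ0, hE]
    b_one := ?_
    θ_mul_b := hψθ
    hasDerivAt_b := ?_
    ψ_pos := fun q hq => mul_pos hq.1 (hE0 q)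
    ψ_le := fun q hq => (hmaps q ⟨hq.1.le, hq.2⟩).2
    le_ψ_iff := ?_ }⟩
  · have := hψ1
    simp only [hψ] at this
    rw [hθ1]
    field_simp at this
    linarith
  · intro r hr
    obtain ⟨h1, h2⟩ := hfac _ (hθmem r)
    refine ((hEd _ (hθmem r)).comp r (hθd r hr)).congr_deriv ?_
    have := (hE0 (θ r)).ne'
    obtain ⟨x, hx⟩ : ∃ x, x = 1 - p * θ r := ⟨_, rfl⟩
    obtain ⟨y, hy⟩ : ∃ y, y = 1 + (1 + p) * θ r := ⟨_, rfl⟩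
    rw [← hx, ← hy]
    rw [← hx] at h1
    rw [← hy] at h2
    field_simp
    ring
  · intro q hq r hr
    have := hψm.le_iff_le (hθmem r) ⟨hq.1.le, hq.2⟩
    rw [hψθ r hr] at this
    exact this

end Profile
end FrozenPercolation

namespace FrozenPercolation

/-! ### The bivariate law `rho` and its distribution function. -/

section BivariateLaw

open Set

/-- The time change that maps `[0, 1]` to `[1/2, 1]`. -/
noncomputable def phi (z : ℝ) : ℝ := (2 - z)⁻¹

theorem phi_le_phi_iff {x y : ℝ} (hx : x < 2) (hy : y < 2) : phi x ≤ phi y ↔ x ≤ y := by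
  unfold phi
  rw [inv_le_inv₀ (by linarith) (by linarith)]
  constructor <;> intro h <;> linarith

theorem phi_le_one {x : ℝ} (hx : x ≤ 1) : phi x ≤ 1 := by
  unfold phi
  exact inv_le_one_of_one_le₀ (by linarith)

theorem half_le_phi {x : ℝ} (hx : 0 ≤ x) (hx' : x ≤ 1) : 1 / 2 ≤ phi x := by
  unfold phi
  rw [one_div]
  exact inv_anti₀ (by linarith) (by linarith)

theorem phi_zero : phi 0 = 1 / 2 := by norm_num [phi]

theorem phi_one : phi 1 = 1 := by norm_num [phi]

theorem phi_two_sub_inv {a : ℝ} : phi (2 - 1 / a) = a := by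
  simp [phi]

theorem measurable_phi : Measurable phi := by unfold phi; fun_prop

/-- The set of possible explosion times. -/
def timeSet : Set ℝ := Icc (1 / 2) 1 ∪ {2}

theorem measurableSet_timeSet : MeasurableSet timeSet :=
  measurableSet_Icc.union (measurableSet_singleton 2)

/-- Since `timeSet` has no points below `1/2` or in `(1, 2)`, every lower half-line cuts it
trivially or like one that ends at a value of `phi`. -/
theorem exists_inter_timeSet (a : ℝ) : ∃ C : Set ℝ, Iic a ∩ timeSet = C ∩ timeSet ∧
    (C = ∅ ∨ C = univ ∨ ∃ s ∈ Icc (0 : ℝ) 1, C = Iic (phi s)) := by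
  rcases lt_or_ge a (1 / 2) with h1 | h1
  · refine ⟨∅, ?_, Or.inl rfl⟩
    ext x
    simp only [timeSet, mem_inter_iff, mem_Iic, mem_union, mem_Icc, mem_singleton_iff,
      empty_inter, mem_empty_iff_false, iff_false]
    rintro ⟨h2, h3 | h3⟩ <;> linarith
  · rcases le_or_gt a 1 with h2 | h2
    · refine ⟨Iic a, rfl, Or.inr (Or.inr ⟨2 - 1 / a, ⟨?_, ?_⟩, by rw [phi_two_sub_inv]⟩)⟩
      · have : 1 / a ≤ 2 := by rw [div_le_iff₀ (by linarith)]; linarith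
        linarith
      · have : 1 ≤ 1 / a := by rw [le_div_iff₀ (by linarith)]; linarith
        linarith
    · rcases lt_or_ge a 2 with h3 | h3
      · refine ⟨Iic (phi 1), ?_, Or.inr (Or.inr ⟨1, by simp, rfl⟩)⟩
        ext x
        simp only [timeSet, mem_inter_iff, mem_Iic, mem_union, mem_Icc, mem_singleton_iff, phi_one]
        constructor
        · rintro ⟨h4, h5 | h5⟩
          · exact ⟨h5.2, Or.inl h5⟩
          · linarith
        · rintro ⟨h4, h5⟩
          exact ⟨by linarith, h5⟩
      · refine ⟨univ, ?_, Or.inr (Or.inl rfl)⟩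
        ext x
        simp only [timeSet, mem_inter_iff, mem_Iic, mem_union, mem_Icc, mem_singleton_iff, mem_univ,
          true_and, and_iff_right_iff_imp]
        rintro (h4 | h4) <;> linarith

theorem measure_prod_eq_of_inter {μ : Measure (ℝ × ℝ)} {D : Set ℝ} (hμ : μ (D ×ˢ D)ᶜ = 0)
    {A B A' B' : Set ℝ} (hA : A ∩ D = A' ∩ D) (hB : B ∩ D = B' ∩ D) :
    μ (A ×ˢ B) = μ (A' ×ˢ B') := by
  have h : ∀ A B : Set ℝ, μ (A ×ˢ B) = μ ((A ∩ D) ×ˢ (B ∩ D)) := by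
    intro A B
    rw [← Set.prod_inter_prod]
    exact (measure_inter_conull hμ).symm
  rw [h A B, h A' B', hA, hB]

theorem ext_of_timeSet {μ ν : Measure (ℝ × ℝ)} [IsProbabilityMeasure μ] [IsProbabilityMeasure ν]
    (hμ : μ (timeSet ×ˢ timeSet)ᶜ = 0) (hν : ν (timeSet ×ˢ timeSet)ᶜ = 0)
    (h : ∀ s ∈ Icc (0 : ℝ) 1, ∀ t ∈ Icc (0 : ℝ) 1,
      μ (Iic (phi s) ×ˢ Iic (phi t)) = ν (Iic (phi s) ×ˢ Iic (phi t)))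
    (h1 : ∀ s ∈ Icc (0 : ℝ) 1, μ (Iic (phi s) ×ˢ univ) = ν (Iic (phi s) ×ˢ univ))
    (h2 : ∀ s ∈ Icc (0 : ℝ) 1, μ (univ ×ˢ Iic (phi s)) = ν (univ ×ˢ Iic (phi s))) : μ = ν := by
  have hgen : (inferInstance : MeasurableSpace (ℝ × ℝ)) =
      MeasurableSpace.generateFrom (image2 (· ×ˢ ·) (range Iic) (range Iic)) := by
    have h0 : MeasurableSpace.generateFrom (range Iic) = (inferInstance : MeasurableSpace ℝ) := by
      rw [← borel_eq_generateFrom_Iic ℝ]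
      exact (BorelSpace.measurable_eq (α := ℝ)).symm
    refine (generateFrom_eq_prod h0 h0 ?_ ?_).symm
    · exact ⟨fun n : ℕ => Iic (n : ℝ), fun n => ⟨_, rfl⟩, iUnion_Iic_of_not_bddAbove_range
        (not_bddAbove_iff.2 fun x => by
          obtain ⟨n, hn⟩ := exists_nat_gt x; exact ⟨n, ⟨n, rfl⟩, hn⟩)⟩
    · exact ⟨fun n : ℕ => Iic (n : ℝ), fun n => ⟨_, rfl⟩, iUnion_Iic_of_not_bddAbove_range
        (not_bddAbove_iff.2 fun x => by
          obtain ⟨n, hn⟩ := exists_nat_gt x; exact ⟨n, ⟨n, rfl⟩, hn⟩)⟩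
  refine ext_of_generate_finite _ hgen (isPiSystem_Iic.prod isPiSystem_Iic) ?_ (by simp)
  rintro _ ⟨_, ⟨a, rfl⟩, _, ⟨b, rfl⟩, rfl⟩
  obtain ⟨C, hC, hC'⟩ := exists_inter_timeSet a
  obtain ⟨C₂, hC₂, hC₂'⟩ := exists_inter_timeSet b
  dsimp only
  rw [measure_prod_eq_of_inter hμ hC hC₂, measure_prod_eq_of_inter hν hC hC₂]
  rcases hC' with rfl | rfl | ⟨s, hs, rfl⟩
  · simp
  · rcases hC₂' with rfl | rfl | ⟨t, ht, rfl⟩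
    · simp
    · simp
    · exact h2 t ht
  · rcases hC₂' with rfl | rfl | ⟨t, ht, rfl⟩
    · simp
    · exact h1 s hs
    · exact h s hs t ht

namespace ScalingProfile

variable (S : ScalingProfile)

theorem c_pos : 0 < S.c := by
  have := S.two_c
  have := S.b₁_pos
  nlinarith

/-- The base measure of the parametrization of `S.eta`. -/
noncomputable def base : Measure (ℝ × ℝ) :=
  (volume.restrict (Ioc (0 : ℝ) 1)).prod (volume.restrict (Ioc (0 : ℝ) (1 / S.b₁)))

/-- The parameter `x` is the smaller of the two explosion times and `S.ψ q` is the ratio of the two,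
on the scale on which the law is scale invariant. -/
noncomputable def pairMap (p : ℝ × ℝ) : ℝ × ℝ :=
  (phi p.1, if p.1 ≤ S.ψ p.2 then phi (p.1 / S.ψ p.2) else 2)

theorem measurable_pairMap : Measurable S.pairMap := by
  have h1 : Measurable fun p : ℝ × ℝ => S.ψ p.2 := S.measurable_ψ.comp measurable_snd
  refine (measurable_phi.comp measurable_fst).prodMk ?_
  exact Measurable.ite (measurableSet_le measurable_fst h1)
    (measurable_phi.comp (measurable_fst.div h1)) measurable_const

/-- The part of the bivariate law in which the first explosion time is the smaller one. -/
noncomputable def eta : Measure (ℝ × ℝ) := ENNReal.ofReal (S.c / 2) • S.base.map S.pairMap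

/-- A bivariate law of explosion times that is not concentrated on the diagonal. -/
noncomputable def rho : Measure (ℝ × ℝ) :=
  S.eta + S.eta.map Prod.swap + ENNReal.ofReal ((1 - S.b₁) / 2) • Measure.dirac (2, 2)

theorem base_Ioc (s : ℝ) (hs : s ∈ Icc (0 : ℝ) 1) (B : ℝ → Set ℝ)
    (hB : MeasurableSet {p : ℝ × ℝ | p.1 ≤ s ∧ p.2 ∈ B p.1}) :
    S.base {p | p.1 ≤ s ∧ p.2 ∈ B p.1} =
      ∫⁻ x in Ioc 0 s, volume (B x ∩ Ioc 0 (1 / S.b₁)) := by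
  have h1 : ∀ x, (volume.restrict (Ioc (0 : ℝ) (1 / S.b₁)))
      (Prod.mk x ⁻¹' {p : ℝ × ℝ | p.1 ≤ s ∧ p.2 ∈ B p.1}) =
      (Iic s).indicator (fun x => volume (B x ∩ Ioc 0 (1 / S.b₁))) x := by
    intro x
    rw [Measure.restrict_apply (measurable_prodMk_left hB)]
    by_cases hx : x ≤ s
    · rw [indicator_of_mem (mem_Iic.2 hx)]
      congr 2
      ext q
      simp [hx]
    · rw [indicator_of_notMem (by simpa using hx)]
      convert measure_empty (μ := volume)
      ext q
      simp [hx]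
  rw [base, Measure.prod_apply hB, lintegral_congr h1, lintegral_indicator measurableSet_Iic,
    Measure.restrict_restrict measurableSet_Iic, inter_comm, Ioc_inter_Iic, min_eq_right hs.2]

theorem volume_setOf_le_inter (r : ℝ) :
    volume ({q | S.θ r ≤ q} ∩ Ioc 0 (1 / S.b₁)) = ENNReal.ofReal (1 / S.b₁ - S.θ r) := by
  refine le_antisymm ?_ ?_
  · rw [← Real.volume_Icc]
    exact measure_mono fun q hq => ⟨hq.1, hq.2.2⟩
  · rw [← Real.volume_Ioc]
    exact measure_mono fun q hq => ⟨hq.1.le, (S.θ_nonneg r).trans_lt hq.1, hq.2⟩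

theorem base_ae : ∀ᵐ p ∂S.base, p.1 ∈ Ioc (0 : ℝ) 1 ∧ p.2 ∈ Ioc 0 (1 / S.b₁) := by
  rw [base, Measure.prod_restrict]
  exact ae_restrict_mem (measurableSet_Ioc.prod measurableSet_Ioc)

theorem eta_apply {A : Set (ℝ × ℝ)} (hA : MeasurableSet A) :
    S.eta A = ENNReal.ofReal (S.c / 2) * S.base (S.pairMap ⁻¹' A) := by
  rw [eta, Measure.smul_apply, Measure.map_apply S.measurable_pairMap hA, smul_eq_mul]

theorem pairMap_mem_iff {p : ℝ × ℝ} (hp : p.1 ∈ Ioc (0 : ℝ) 1 ∧ p.2 ∈ Ioc 0 (1 / S.b₁)) {t : ℝ}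
    (ht : t ∈ Icc (0 : ℝ) 1) : (S.pairMap p).2 ≤ phi t ↔ p.1 ≤ t * S.ψ p.2 := by
  obtain ⟨⟨h1, h2⟩, h3⟩ := hp
  have h4 := S.ψ_pos _ h3
  have h5 := S.ψ_le _ h3
  have h7 : phi t ≤ 1 := phi_le_one ht.2
  simp only [pairMap]
  split_ifs with h6
  · have h8 : p.1 / S.ψ p.2 ≤ 1 := (div_le_one h4).2 h6
    rw [phi_le_phi_iff (by linarith) (by linarith [ht.2]), div_le_iff₀ h4]
  · constructor
    · intro h; linarith
    · intro h
      exact absurd (h.trans (mul_le_of_le_one_left h4.le ht.2)) h6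

/-- The second coordinate of `pairMap` is never the smaller one, so a bound on it also bounds the
first. -/
theorem eta_Iic_Iic_self_of_le {s t : ℝ} (hs : s ∈ Icc (0 : ℝ) 1) (ht : t ∈ Icc (0 : ℝ) 1)
    (A : Set ℝ) (hA : MeasurableSet A) (hA' : Iic (phi t) ⊆ A) (hst : s ≤ t) :
    S.eta (A ×ˢ Iic (phi s)) = S.eta (Iic (phi s) ×ˢ Iic (phi s)) := by
  rw [S.eta_apply (hA.prod measurableSet_Iic),
    S.eta_apply (measurableSet_Iic.prod measurableSet_Iic)]
  congr 1
  refine measure_congr ?_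
  filter_upwards [S.base_ae] with p hp
  refine propext (and_congr_left fun h => ?_)
  have h1 : p.1 ≤ s := by
    have := (S.pairMap_mem_iff hp hs).1 h
    exact this.trans (mul_le_of_le_one_right hs.1 (S.ψ_le _ hp.2))
  have h2 : phi p.1 ≤ phi s :=
    (phi_le_phi_iff (by linarith [hp.1.2]) (by linarith [hs.2])).2 h1
  exact ⟨fun _ => h2, fun _ => hA' (h2.trans
    ((phi_le_phi_iff (by linarith [hs.2]) (by linarith [ht.2])).2 hst))⟩

/-- Here the differential equation enters the law: `b' = c θ - 1` provides a primitive of the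
integrand. -/
theorem integral_theta {s t : ℝ} (hs : 0 ≤ s) (hst : s ≤ t) (ht0 : 0 < t) :
    ∫ x in (0 : ℝ)..s, (1 / S.b₁ - S.θ (x / t)) =
      s / S.b₁ - (t * S.b (s / t) - t + s) / S.c := by
  have hc := S.c_pos
  have hcont : Continuous fun x : ℝ => x / S.b₁ - (t * S.b (x / t) + x) / S.c := by
    have := S.continuous_b
    fun_prop
  rw [intervalIntegral.integral_eq_sub_of_hasDerivAt_of_le hs
    (f := fun x => x / S.b₁ - (t * S.b (x / t) + x) / S.c) hcont.continuousOn]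
  · simp only [zero_div, S.b_zero]
    ring
  · intro x hx
    have hxt : x / t ∈ Ioo (0 : ℝ) 1 :=
      ⟨div_pos hx.1 ht0, (div_lt_one ht0).2 (hx.2.trans_le hst)⟩
    have d1 := (S.hasDerivAt_b _ hxt).comp x ((hasDerivAt_id x).div_const t)
    have d2 := ((hasDerivAt_id x).div_const S.b₁).sub
      (((d1.const_mul t).add (hasDerivAt_id x)).div_const S.c)
    refine d2.congr_deriv ?_
    field_simp
    ring
  · have := S.continuous_θ
    exact Continuous.intervalIntegrable (by fun_prop) _ _

theorem eta_Iic_Iic {s t : ℝ} (hs : 0 ≤ s) (hst : s ≤ t) (ht0 : 0 < t) (ht : t ≤ 1) :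
    S.eta (Iic (phi s) ×ˢ Iic (phi t)) =
      ENNReal.ofReal (s * (S.b₁ + 1) / 4 - (t * S.b (s / t) - t + s) / 2) := by
  have hc := S.c_pos
  have hs1 : s ∈ Icc (0 : ℝ) 1 := ⟨hs, hst.trans ht⟩
  have hmeas : MeasurableSet {p : ℝ × ℝ | p.1 ≤ s ∧ p.2 ∈ {q | S.θ (p.1 / t) ≤ q}} := by
    refine (measurableSet_le measurable_fst measurable_const).inter
      (measurableSet_le ?_ measurable_snd)
    exact S.continuous_θ.measurable.comp (measurable_fst.div_const t)
  have h1 : S.base (S.pairMap ⁻¹' (Iic (phi s) ×ˢ Iic (phi t))) =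
      S.base {p : ℝ × ℝ | p.1 ≤ s ∧ p.2 ∈ {q | S.θ (p.1 / t) ≤ q}} := by
    refine measure_congr ?_
    filter_upwards [S.base_ae] with p hp
    refine propext ?_
    change (phi p.1 ≤ phi s ∧ (S.pairMap p).2 ≤ phi t) ↔ (p.1 ≤ s ∧ S.θ (p.1 / t) ≤ p.2)
    rw [S.pairMap_mem_iff hp ⟨ht0.le, ht⟩,
      phi_le_phi_iff (by linarith [hp.1.2]) (by linarith [hs1.2])]
    refine and_congr_right fun h => ?_
    rw [← S.le_ψ_iff _ hp.2 _ ⟨div_nonneg hp.1.1.le ht0.le, (div_le_one ht0).2 (h.trans hst)⟩,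
      div_le_iff₀' ht0]
  rw [S.eta_apply (measurableSet_Iic.prod measurableSet_Iic), h1,
    S.base_Ioc s hs1 (fun x => {q | S.θ (x / t) ≤ q}) hmeas]
  simp only [S.volume_setOf_le_inter]
  have hcθ := S.continuous_θ
  rw [← ofReal_integral_eq_lintegral_ofReal, ← intervalIntegral.integral_of_le hs,
    S.integral_theta hs hst ht0, ← ENNReal.ofReal_mul (by positivity)]
  · congr 1
    have := S.b₁_pos.ne'
    have h2 := S.two_c
    have h3 : S.c / S.b₁ = (S.b₁ + 1) / 2 := by
      field_simp
      linarith
    calc S.c / 2 * (s / S.b₁ - (t * S.b (s / t) - t + s) / S.c)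
        = (S.c / S.b₁) * s / 2 - (t * S.b (s / t) - t + s) / 2 := by field_simp
      _ = _ := by rw [h3]; ring
  · exact ((by fun_prop : Continuous fun x : ℝ => 1 / S.b₁ - S.θ (x / t)).integrableOn_Ioc)
  · exact ae_of_all _ fun x => sub_nonneg.2 (S.θ_le _)

theorem eta_Iic_univ {s : ℝ} (hs : s ∈ Icc (0 : ℝ) 1) :
    S.eta (Iic (phi s) ×ˢ univ) = ENNReal.ofReal (s * (S.b₁ + 1) / 4) := by
  have hc := S.c_pos
  have hb := S.b₁_pos
  have hmeas : MeasurableSet {p : ℝ × ℝ | p.1 ≤ s ∧ p.2 ∈ (univ : Set ℝ)} := by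
    simp only [mem_univ, and_true]
    exact measurableSet_le measurable_fst measurable_const
  have h1 : S.base (S.pairMap ⁻¹' (Iic (phi s) ×ˢ univ)) =
      S.base {p : ℝ × ℝ | p.1 ≤ s ∧ p.2 ∈ (univ : Set ℝ)} := by
    refine measure_congr ?_
    filter_upwards [S.base_ae] with p hp
    refine propext ?_
    change (phi p.1 ≤ phi s ∧ True) ↔ (p.1 ≤ s ∧ True)
    rw [phi_le_phi_iff (by linarith [hp.1.2]) (by linarith [hs.2])]
  have h0 : S.base {p : ℝ × ℝ | p.1 ≤ s ∧ p.2 ∈ (univ : Set ℝ)} =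
      ENNReal.ofReal (1 / S.b₁) * ENNReal.ofReal s := by
    refine (S.base_Ioc s hs (fun _ => univ) hmeas).trans ?_
    simp
  rw [S.eta_apply (measurableSet_Iic.prod MeasurableSet.univ), h1, h0]
  rw [← ENNReal.ofReal_mul (by positivity), ← ENNReal.ofReal_mul (by positivity)]
  congr 1
  have h2 := S.two_c
  field_simp
  linear_combination 2 * s * h2

theorem eta_univ : S.eta univ = ENNReal.ofReal ((S.b₁ + 1) / 4) := by
  have h : S.eta univ = S.eta (Iic (phi 1) ×ˢ univ) := by
    rw [S.eta_apply MeasurableSet.univ, S.eta_apply (measurableSet_Iic.prod MeasurableSet.univ)]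
    congr 1
    refine measure_congr ?_
    filter_upwards [S.base_ae] with p hp
    refine propext ⟨fun _ => ⟨?_, mem_univ _⟩, fun _ => mem_univ _⟩
    exact (phi_le_phi_iff (by linarith [hp.1.2]) (by norm_num)).2 hp.1.2
  rw [h, S.eta_Iic_univ (by simp)]
  congr 1
  ring

theorem eta_compl_timeSet : S.eta (timeSet ×ˢ timeSet)ᶜ = 0 := by
  rw [S.eta_apply (measurableSet_timeSet.prod measurableSet_timeSet).compl]
  have : S.base (S.pairMap ⁻¹' (timeSet ×ˢ timeSet)ᶜ) = 0 := by
    change ∀ᵐ p ∂S.base, S.pairMap p ∈ timeSet ×ˢ timeSet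
    filter_upwards [S.base_ae] with p hp
    refine ⟨Or.inl ⟨half_le_phi hp.1.1.le hp.1.2, phi_le_one hp.1.2⟩, ?_⟩
    simp only [pairMap]
    split_ifs with h
    · have h4 := S.ψ_pos _ hp.2
      have h8 : p.1 / S.ψ p.2 ≤ 1 := (div_le_one h4).2 h
      exact Or.inl ⟨half_le_phi (div_nonneg hp.1.1.le h4.le) h8, phi_le_one h8⟩
    · exact Or.inr rfl
  rw [this, mul_zero]

theorem rho_apply {A : Set (ℝ × ℝ)} (hA : MeasurableSet A) : S.rho A =
    S.eta A + S.eta (Prod.swap ⁻¹' A) +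
      ENNReal.ofReal ((1 - S.b₁) / 2) * A.indicator 1 (2, 2) := by
  rw [rho, Measure.add_apply, Measure.add_apply, Measure.map_apply measurable_swap hA,
    Measure.smul_apply, Measure.dirac_apply' _ hA, smul_eq_mul]

instance : IsProbabilityMeasure S.rho := by
  constructor
  have hb := S.b₁_pos
  have hb' := S.b₁_le
  rw [S.rho_apply MeasurableSet.univ, preimage_univ, S.eta_univ, indicator_of_mem (mem_univ _),
    Pi.one_apply, mul_one, ← ENNReal.ofReal_add (by linarith) (by linarith),
    ← ENNReal.ofReal_add (by linarith) (by linarith), ← ENNReal.ofReal_one]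
  congr 1
  ring

theorem rho_compl_timeSet : S.rho (timeSet ×ˢ timeSet)ᶜ = 0 := by
  have hm := (measurableSet_timeSet.prod measurableSet_timeSet).compl
  rw [S.rho_apply hm]
  have h1 : Prod.swap ⁻¹' (timeSet ×ˢ timeSet)ᶜ = (timeSet ×ˢ timeSet)ᶜ := by
    rw [preimage_compl, preimage_swap_prod]
  have h2 : ((2 : ℝ), (2 : ℝ)) ∉ (timeSet ×ˢ timeSet)ᶜ := by
    simp [timeSet]
  rw [h1, S.eta_compl_timeSet, indicator_of_notMem h2]
  simp

theorem map_swap_rho : S.rho.map Prod.swap = S.rho := by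
  have h : (S.eta.map Prod.swap).map Prod.swap = S.eta := by
    rw [Measure.map_map measurable_swap measurable_swap]
    simp
  rw [rho, Measure.map_add _ _ measurable_swap, Measure.map_add _ _ measurable_swap, h,
    Measure.map_smul, Measure.map_dirac' measurable_swap, add_comm S.eta]
  rfl

theorem phi_lt_two {s : ℝ} (hs : s ∈ Icc (0 : ℝ) 1) : phi s < 2 :=
  (phi_le_one hs.2).trans_lt one_lt_two

/-- The part `eta` contributes its mass on the rectangle, the mirrored part its mass on the square
with corner `phi s`, and the terms linear in `s` cancel. -/
theorem rho_Iic_Iic {s t : ℝ} (hs : 0 ≤ s) (hst : s ≤ t) (ht : t ≤ 1) :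
    S.rho (Iic (phi s) ×ˢ Iic (phi t)) = ENNReal.ofReal ((t - t * S.b (s / t)) / 2) := by
  have hs1 : s ∈ Icc (0 : ℝ) 1 := ⟨hs, hst.trans ht⟩
  have ht1 : t ∈ Icc (0 : ℝ) 1 := ⟨hs.trans hst, ht⟩
  have h2 : ((2 : ℝ), (2 : ℝ)) ∉ Iic (phi s) ×ˢ Iic (phi t) := by
    intro h
    exact absurd h.1 (not_le.2 (phi_lt_two hs1))
  rw [S.rho_apply (measurableSet_Iic.prod measurableSet_Iic), indicator_of_notMem h2,
    preimage_swap_prod, S.eta_Iic_Iic_self_of_le hs1 ht1 _ measurableSet_Iic subset_rfl hst,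
    mul_zero, add_zero]
  rcases hs.eq_or_lt with rfl | hs0
  · have h0 : S.eta (Iic (phi 0) ×ˢ univ) = 0 := by
      rw [S.eta_Iic_univ (by simp)]; simp
    rw [measure_mono_null (prod_mono_right (subset_univ _)) h0,
      measure_mono_null (prod_mono_right (subset_univ _)) h0]
    simp [S.b_zero]
  · have ht0 := hs0.trans_le hst
    have e1 := S.eta_Iic_Iic hs hst ht0 ht
    have e2 := S.eta_Iic_Iic hs le_rfl hs0 hs1.2
    rw [div_self hs0.ne', S.b_one] at e2
    have hb := S.b₁_pos
    have hb' := S.b₁_le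
    have n2 : 0 ≤ s * (S.b₁ + 1) / 4 - (s * S.b₁ - s + s) / 2 := by nlinarith
    have n1 : 0 ≤ s * (S.b₁ + 1) / 4 - (t * S.b (s / t) - t + s) / 2 := by
      have h3 := S.integral_theta hs hst ht0
      have h4 : 0 ≤ ∫ x in (0 : ℝ)..s, (1 / S.b₁ - S.θ (x / t)) :=
        intervalIntegral.integral_nonneg hs fun x _ => sub_nonneg.2 (S.θ_le _)
      rw [h3] at h4
      have hc := S.c_pos
      have h5 : s / S.b₁ = s * (S.b₁ + 1) / (2 * S.c) := by
        rw [S.two_c]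
        field_simp
      rw [h5] at h4
      have h6 : 0 ≤ S.c / 2 * (s * (S.b₁ + 1) / (2 * S.c) -
        (t * S.b (s / t) - t + s) / S.c) := by positivity
      refine h6.trans (le_of_eq ?_)
      field_simp
      ring
    rw [e1, e2, ← ENNReal.ofReal_add n1 n2]
    congr 1
    ring

/-- The marginal does not depend on the profile. At `t = phi s` it equals `1 - 1 / (2 t)`, the
distribution function that `real_lt_explosion` finds for every frozen percolation process. -/
theorem rho_Iic_univ {s : ℝ} (hs : s ∈ Icc (0 : ℝ) 1) :
    S.rho (Iic (phi s) ×ˢ univ) = ENNReal.ofReal (s / 2) := by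
  have h2 : ((2 : ℝ), (2 : ℝ)) ∉ Iic (phi s) ×ˢ (univ : Set ℝ) := by
    intro h
    exact absurd h.1 (not_le.2 (phi_lt_two hs))
  rw [S.rho_apply (measurableSet_Iic.prod MeasurableSet.univ), indicator_of_notMem h2,
    preimage_swap_prod, S.eta_Iic_Iic_self_of_le hs hs _ MeasurableSet.univ (subset_univ _) le_rfl,
    mul_zero, add_zero, S.eta_Iic_univ hs]
  rcases hs.1.eq_or_lt with rfl | hs0
  · have h0 : S.eta (Iic (phi 0) ×ˢ univ) = 0 := by
      rw [S.eta_Iic_univ (by simp)]; simp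
    rw [measure_mono_null (prod_mono_right (subset_univ _)) h0]
    simp
  · rw [S.eta_Iic_Iic hs.1 le_rfl hs0 hs.2, div_self hs0.ne', S.b_one]
    have hb := S.b₁_pos
    have hb' := S.b₁_le
    rw [← ENNReal.ofReal_add (by positivity) (by nlinarith)]
    congr 1
    ring

end ScalingProfile
end BivariateLaw
end FrozenPercolation

namespace FrozenPercolation

/-! ### One step of the bivariate recursion, and the integral of the squared survival function. -/

section FixedPoint

open Set

/-- The uniform distribution on `[0, 1]`. -/
noncomputable def unif : Measure ℝ := volume.restrict (Icc 0 1)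

instance : IsProbabilityMeasure unif := ⟨by simp [unif]⟩

theorem measurable_chi : Measurable fun p : ℝ × ℝ => chi p.1 p.2 := by
  unfold chi
  exact Measurable.ite (measurableSet_lt measurable_fst measurable_snd) measurable_snd
    measurable_const

theorem chi_le_iff {u m a : ℝ} (ha : a < 2) : chi u m ≤ a ↔ m ∈ Ioc u a := by
  unfold chi
  split_ifs with h
  · simp [h]
  · simp [h, ha]

/-- The pair of first explosion times behind an oriented edge. -/
def minPair (p : (ℝ × ℝ) × (ℝ × ℝ)) : ℝ × ℝ := (min p.1.1 p.2.1, min p.1.2 p.2.2)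

theorem measurable_minPair : Measurable minPair := by
  unfold minPair; fun_prop

/-- The pair of explosion times of an oriented edge with activation time `p.1`. -/
noncomputable def chiPair (p : ℝ × (ℝ × ℝ)) : ℝ × ℝ := (chi p.1 p.2.1, chi p.1 p.2.2)

theorem measurable_chiPair : Measurable chiPair := by
  unfold chiPair
  exact (measurable_chi.comp (by fun_prop : Measurable fun p : ℝ × (ℝ × ℝ) => (p.1, p.2.1))).prodMk
    (measurable_chi.comp (by fun_prop : Measurable fun p : ℝ × (ℝ × ℝ) => (p.1, p.2.2)))

theorem measureReal_unif_prod {ν : Measure (ℝ × ℝ)} [IsProbabilityMeasure ν]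
    {A : Set (ℝ × (ℝ × ℝ))} (hA : MeasurableSet A) :
    (unif.prod ν).real A = ∫ u in (0 : ℝ)..1, ν.real (Prod.mk u ⁻¹' A) := by
  have hm : Measurable fun u => ν (Prod.mk u ⁻¹' A) := measurable_measure_prodMk_left hA
  rw [intervalIntegral.integral_of_le zero_le_one, ← integral_Icc_eq_integral_Ioc,
    Measure.real, Measure.prod_apply hA]
  simp only [Measure.real]
  rw [integral_toReal hm.aemeasurable (ae_of_all _ fun u => measure_lt_top _ _)]
  rfl

/-- Inclusion–exclusion is carried out with upper quadrants, because the minimum of two independent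
pairs squares their probabilities (`minLaw_Ioi`). -/
theorem measureReal_Ioc_prod_Ioc {ν : Measure (ℝ × ℝ)} [IsProbabilityMeasure ν] {u a b : ℝ}
    (ha : u ≤ a) (hb : u ≤ b) : ν.real (Ioc u a ×ˢ Ioc u b) =
      ν.real (Ioi u ×ˢ Ioi u) - ν.real (Ioi a ×ˢ Ioi u) - ν.real (Ioi u ×ˢ Ioi b) +
        ν.real (Ioi a ×ˢ Ioi b) := by
  have h1 : ∀ A : Set ℝ, MeasurableSet A → ν.real (A ×ˢ Ioi u) =
      ν.real (A ×ˢ Ioc u b) + ν.real (A ×ˢ Ioi b) := by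
    intro A hA
    rw [← measureReal_union, ← prod_union, Ioc_union_Ioi_eq_Ioi hb]
    · exact Disjoint.set_prod_right (Ioc_disjoint_Ioi le_rfl) _ _
    · exact hA.prod measurableSet_Ioi
  have h2 : ν.real (Ioi u ×ˢ Ioc u b) =
      ν.real (Ioc u a ×ˢ Ioc u b) + ν.real (Ioi a ×ˢ Ioc u b) := by
    rw [← measureReal_union, ← union_prod, Ioc_union_Ioi_eq_Ioi ha]
    · exact Disjoint.set_prod_left (Ioc_disjoint_Ioi le_rfl) _ _
    · exact measurableSet_Ioi.prod measurableSet_Ioc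
  have h3 := h1 (Ioi u) measurableSet_Ioi
  have h4 := h1 (Ioi a) measurableSet_Ioi
  linarith

theorem measureReal_Ioi_prod_Ioi {ν : Measure (ℝ × ℝ)} [IsProbabilityMeasure ν] (a b : ℝ) :
    ν.real (Ioi a ×ˢ Ioi b) = 1 - ν.real (Iic a ×ˢ univ) - ν.real (univ ×ˢ Iic b) +
      ν.real (Iic a ×ˢ Iic b) := by
  have h1 : ∀ A : Set ℝ, MeasurableSet A → ν.real (A ×ˢ univ) =
      ν.real (A ×ˢ Iic b) + ν.real (A ×ˢ Ioi b) := by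
    intro A hA
    rw [← measureReal_union, ← prod_union, Iic_union_Ioi]
    · exact Disjoint.set_prod_right (Iic_disjoint_Ioi le_rfl) _ _
    · exact hA.prod measurableSet_Ioi
  have h2 : ∀ B : Set ℝ, MeasurableSet B → ν.real (univ ×ˢ B) =
      ν.real (Iic a ×ˢ B) + ν.real (Ioi a ×ˢ B) := by
    intro B hB
    rw [← measureReal_union, ← union_prod, Iic_union_Ioi]
    · exact Disjoint.set_prod_left (Iic_disjoint_Ioi le_rfl) _ _
    · exact measurableSet_Ioi.prod hB
  have h3 := h1 (Ioi a) measurableSet_Ioi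
  have h4 := h2 univ MeasurableSet.univ
  have h5 := h2 (Iic b) measurableSet_Iic
  have h6 : ν.real ((univ : Set ℝ) ×ˢ (univ : Set ℝ)) = 1 := by simp
  linarith

namespace ScalingProfile

variable (S : ScalingProfile)

/-- The law of the pair of first explosion times behind an oriented edge. -/
noncomputable def minLaw : Measure (ℝ × ℝ) := (S.rho.prod S.rho).map minPair

instance : IsProbabilityMeasure S.minLaw :=
  Measure.isProbabilityMeasure_map measurable_minPair.aemeasurable

/-- The law of the pair of explosion times after one step of the recursion. -/
noncomputable def stepLaw : Measure (ℝ × ℝ) := (unif.prod S.minLaw).map chiPair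

instance : IsProbabilityMeasure S.stepLaw :=
  Measure.isProbabilityMeasure_map measurable_chiPair.aemeasurable

theorem minLaw_Ioi (a b : ℝ) :
    S.minLaw.real (Ioi a ×ˢ Ioi b) = S.rho.real (Ioi a ×ˢ Ioi b) ^ 2 := by
  have : minPair ⁻¹' (Ioi a ×ˢ Ioi b) = (Ioi a ×ˢ Ioi b) ×ˢ (Ioi a ×ˢ Ioi b) := by
    ext p
    simp only [minPair, mem_preimage, mem_prod, mem_Ioi, lt_min_iff]
    tauto
  rw [Measure.real, minLaw, Measure.map_apply measurable_minPair
    (measurableSet_Ioi.prod measurableSet_Ioi), this, Measure.prod_prod, ENNReal.toReal_mul]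
  simp only [Measure.real]
  ring

theorem map_swap_minLaw : S.minLaw.map Prod.swap = S.minLaw := by
  have h : Prod.swap ∘ minPair = minPair ∘ Prod.map Prod.swap Prod.swap := rfl
  rw [minLaw, Measure.map_map measurable_swap measurable_minPair, h,
    ← Measure.map_map measurable_minPair (measurable_swap.prodMap measurable_swap),
    ← Measure.map_prod_map _ _ measurable_swap measurable_swap, S.map_swap_rho]

theorem map_swap_stepLaw : S.stepLaw.map Prod.swap = S.stepLaw := by
  have h : Prod.swap ∘ chiPair = chiPair ∘ Prod.map id Prod.swap := rfl
  rw [stepLaw, Measure.map_map measurable_swap measurable_chiPair, h,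
    ← Measure.map_map measurable_chiPair (measurable_id.prodMap measurable_swap),
    ← Measure.map_prod_map _ _ measurable_id measurable_swap, S.map_swap_minLaw, Measure.map_id]

theorem prod_swap_apply {ν : Measure (ℝ × ℝ)} (h : ν.map Prod.swap = ν) {A B : Set ℝ}
    (hA : MeasurableSet A) (hB : MeasurableSet B) : ν (A ×ˢ B) = ν (B ×ˢ A) := by
  conv_lhs => rw [← h]
  rw [Measure.map_apply measurable_swap (hA.prod hB), preimage_swap_prod]

/-- The probability that the explosion times exceed `phi s` and `phi t`, for `s ≤ t`. -/
noncomputable def survival (s t : ℝ) : ℝ := 1 - s / 2 - t * S.b (s / t) / 2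

theorem rho_real_Iic_univ {s : ℝ} (hs : s ∈ Icc (0 : ℝ) 1) :
    S.rho.real (Iic (phi s) ×ˢ univ) = s / 2 := by
  rw [Measure.real, S.rho_Iic_univ hs, ENNReal.toReal_ofReal (by linarith [hs.1])]

theorem rho_real_univ_Iic {s : ℝ} (hs : s ∈ Icc (0 : ℝ) 1) :
    S.rho.real (univ ×ˢ Iic (phi s)) = s / 2 := by
  rw [← S.rho_real_Iic_univ hs, Measure.real, Measure.real,
    prod_swap_apply S.map_swap_rho MeasurableSet.univ measurableSet_Iic]

theorem b_le_one {r : ℝ} (hr : r ∈ Icc (0 : ℝ) 1) : S.b r ≤ 1 := by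
  have h := S.integral_theta hr.1 hr.2 one_pos
  have h2 : ∫ x in (0 : ℝ)..r, (1 / S.b₁ - S.θ (x / 1)) ≥
      ∫ x in (0 : ℝ)..r, (1 / S.b₁ - S.θ r) := by
    refine intervalIntegral.integral_mono_on hr.1 (by simp) ?_ ?_
    · have := S.continuous_θ
      exact Continuous.intervalIntegrable (by fun_prop) _ _
    · intro x hx
      have hx1 : x ∈ Icc (0 : ℝ) 1 := ⟨hx.1, hx.2.trans hr.2⟩
      rw [div_one]
      suffices S.θ x ≤ S.θ r by linarith
      by_contra hlt
      rw [not_le] at hlt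
      rcases (S.θ_nonneg r).eq_or_lt with h0 | h0
      · have e := S.θ_mul_b r hr
        rw [← h0, zero_mul] at e
        have : x = r := le_antisymm hx.2 (e ▸ hx.1)
        rw [this] at hlt
        exact lt_irrefl _ hlt
      · have hmem : S.θ r ∈ Ioc 0 (1 / S.b₁) := ⟨h0, S.θ_le r⟩
        have e1 := (S.le_ψ_iff _ hmem r hr).2 le_rfl
        exact absurd ((S.le_ψ_iff _ hmem x hx1).1 (hx.2.trans e1)) (not_le.2 hlt)
  rw [h, intervalIntegral.integral_const] at h2
  simp only [smul_eq_mul, sub_zero, div_one, one_mul] at h2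
  have hc := S.c_pos
  have h3 := S.θ_mul_b r hr
  have h4 : (S.b r - 1 + r) / S.c ≤ r * S.θ r := by
    have : r * (1 / S.b₁ - S.θ r) = r / S.b₁ - r * S.θ r := by ring
    linarith
  rw [div_le_iff₀ hc] at h4
  -- `b ≤ 1` follows from `b' = c θ - 1` together with `c θ ≤ (b₁ + 1) / 2 ≤ 1`
  have h5 : S.θ r * S.c ≤ 1 := by
    have := S.θ_le r
    have h6 := S.two_c
    have hb := S.b₁_pos
    calc S.θ r * S.c ≤ 1 / S.b₁ * S.c := by gcongr
      _ = (S.b₁ + 1) / 2 := by field_simp; linarith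
      _ ≤ 1 := by linarith [S.b₁_le]
  nlinarith [hr.1]

theorem rho_real_Iic_Iic {s t : ℝ} (hs : 0 ≤ s) (hst : s ≤ t) (ht : t ≤ 1) :
    S.rho.real (Iic (phi s) ×ˢ Iic (phi t)) = (t - t * S.b (s / t)) / 2 := by
  rw [Measure.real, S.rho_Iic_Iic hs hst ht, ENNReal.toReal_ofReal]
  have ht0 := hs.trans hst
  have := S.b_le_one (r := s / t) ⟨div_nonneg hs ht0, div_le_one_of_le₀ hst ht0⟩
  nlinarith

theorem rho_real_Ioi {s t : ℝ} (hs : 0 ≤ s) (hst : s ≤ t) (ht : t ≤ 1) :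
    S.rho.real (Ioi (phi s) ×ˢ Ioi (phi t)) = S.survival s t := by
  rw [measureReal_Ioi_prod_Ioi, S.rho_real_Iic_univ ⟨hs, hst.trans ht⟩,
    S.rho_real_univ_Iic ⟨hs.trans hst, ht⟩, S.rho_real_Iic_Iic hs hst ht, survival]
  ring

theorem rho_real_Ioi' {s t : ℝ} (hs : 0 ≤ s) (hst : s ≤ t) (ht : t ≤ 1) :
    S.rho.real (Ioi (phi t) ×ˢ Ioi (phi s)) = S.survival s t := by
  rw [← S.rho_real_Ioi hs hst ht, Measure.real, Measure.real,
    prod_swap_apply S.map_swap_rho measurableSet_Ioi measurableSet_Ioi]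

theorem minLaw_Iic_half_univ : S.minLaw (Iic (1 / 2) ×ˢ univ) = 0 := by
  rw [minLaw, Measure.map_apply measurable_minPair (measurableSet_Iic.prod MeasurableSet.univ)]
  have h0 : S.rho (Iic (1 / 2) ×ˢ univ) = 0 := by
    rw [← phi_zero, S.rho_Iic_univ (by simp)]; simp
  refine measure_mono_null (t := (Iic (1 / 2) ×ˢ univ) ×ˢ univ ∪ univ ×ˢ (Iic (1 / 2) ×ˢ univ))
    ?_ ?_
  · rintro p ⟨hp, -⟩
    simp only [minPair, mem_Iic, min_le_iff] at hp
    simpa using hp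
  · rw [measure_union_null_iff, Measure.prod_prod, Measure.prod_prod, h0]
    simp

theorem minLaw_of_le_half {u : ℝ} (hu : u ≤ 1 / 2) (a b : ℝ) :
    S.minLaw.real (Ioc u a ×ˢ Ioc u b) = S.minLaw.real (Ioc (1 / 2) a ×ˢ Ioc (1 / 2) b) := by
  have h1 := S.minLaw_Iic_half_univ
  have h2 : S.minLaw (univ ×ˢ Iic (1 / 2)) = 0 := by
    rw [prod_swap_apply S.map_swap_minLaw MeasurableSet.univ measurableSet_Iic, h1]
  simp only [Measure.real]
  congr 1
  refine measure_congr ?_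
  have h1' : ∀ᵐ p ∂S.minLaw, p ∉ (Iic (1 / 2) : Set ℝ) ×ˢ (univ : Set ℝ) :=
    measure_eq_zero_iff_ae_notMem.1 h1
  have h2' : ∀ᵐ p ∂S.minLaw, p ∉ (univ : Set ℝ) ×ˢ (Iic (1 / 2) : Set ℝ) :=
    measure_eq_zero_iff_ae_notMem.1 h2
  filter_upwards [h1', h2'] with p hp1 hp2
  simp only [mem_prod, mem_Iic, mem_univ, and_true, not_le, true_and] at hp1 hp2
  refine propext ?_
  change ((u < p.1 ∧ p.1 ≤ a) ∧ (u < p.2 ∧ p.2 ≤ b)) ↔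
    ((1 / 2 < p.1 ∧ p.1 ≤ a) ∧ (1 / 2 < p.2 ∧ p.2 ≤ b))
  have e1 : u < p.1 := by linarith
  have e2 : u < p.2 := by linarith
  simp only [e1, e2, hp1, hp2, true_and]

/-- The survival function in terms of the original time scale. -/
theorem survival_two_sub (w t : ℝ) :
    S.survival (2 - 1 / w) t = 1 / (2 * w) - t * S.b ((2 - 1 / w) / t) / 2 := by
  unfold survival
  have : 1 - (2 - 1 / w) / 2 = 1 / (2 * w) := by
    rw [one_div, one_div, mul_inv]; ring
  rw [this]

/-- The square has the explicit primitive `Q`: differentiating `w * B w ^ 2 / 4` produces the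
product of `θ` and `B w`, the only term that is not elementary, and `θ_mul_b` turns it into `2 - 1 /
w`. -/
theorem integral_survival_sq {s t : ℝ} (hs : 0 ≤ s) (hst : s ≤ t) (ht : t ≤ 1) :
    ∫ w in (1 / 2 : ℝ)..(phi s), S.survival (2 - 1 / w) t ^ 2 =
      (-1 / (4 * phi s) + phi s * (t * S.b (s / t)) ^ 2 / 4
        - S.c / 2 * (2 * Real.log (phi s) + 1 / phi s)) -
      (-1 / 2 + t ^ 2 / 8 - S.c / 2 * (2 * Real.log (1 / 2) + 2)) := by
  rcases (hs.trans hst).eq_or_lt with rfl | ht0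
  · have hs0 : s = 0 := le_antisymm hst hs
    subst hs0
    rw [phi_zero]
    simp
    norm_num
  have hphi := half_le_phi hs (hst.trans ht)
  set B : ℝ → ℝ := fun w => t * S.b ((2 - 1 / w) / t) with hB
  set Q : ℝ → ℝ := fun w => -1 / (4 * w) + w * B w ^ 2 / 4
    - S.c / 2 * (2 * Real.log w + 1 / w) with hQ
  have hpos : ∀ w ∈ Icc (1 / 2 : ℝ) (phi s), w ≠ 0 := fun w hw => by linarith [hw.1]
  have hinv : ContinuousOn (fun w : ℝ => 1 / w) (Icc (1 / 2) (phi s)) :=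
    continuousOn_const.div continuousOn_id hpos
  have hBc : ContinuousOn B (Icc (1 / 2) (phi s)) :=
    continuousOn_const.mul (S.continuous_b.comp_continuousOn
      ((continuousOn_const.sub hinv).div_const t))
  have hQc : ContinuousOn Q (Icc (1 / 2) (phi s)) := by
    refine ((continuousOn_const.div (continuousOn_const.mul continuousOn_id) ?_).add
      ((continuousOn_id.mul (hBc.pow 2)).div_const 4)).sub (continuousOn_const.mul
      ((continuousOn_const.mul (continuousOn_id.log hpos)).add hinv))
    intro w hw
    exact mul_ne_zero (by norm_num) (hpos w hw)
  have key := intervalIntegral.integral_eq_sub_of_hasDerivAt_of_le hphi hQc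
    (f' := fun w => S.survival (2 - 1 / w) t ^ 2) ?_ ?_
  · rw [key]
    have e1 : (2 - 1 / phi s) / t = s / t := by
      congr 1
      simp [phi]
    have e2 : (2 - 1 / (1 / 2 : ℝ)) / t = 0 := by norm_num
    simp only [hQ, hB]
    rw [e1, e2, S.b_zero]
    norm_num
    ring
  · intro w hw
    have hw0 : w ≠ 0 := hpos w (Ioo_subset_Icc_self hw)
    have hwpos : 0 < w := by linarith [hw.1]
    have hr : (2 - 1 / w) / t ∈ Ioo (0 : ℝ) 1 := by
      have h1 : 1 / w < 2 := by rw [div_lt_iff₀ hwpos]; linarith [hw.1]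
      have h2 : 2 - 1 / w < s := by
        have h3 := hw.2
        unfold phi at h3
        have h4 : (2 - s) < w⁻¹ := by
          rw [lt_inv_comm₀ (by linarith) hwpos]; exact h3
        rw [one_div]
        linarith
      exact ⟨div_pos (by linarith) ht0, (div_lt_one ht0).2 (h2.trans_le hst)⟩
    have hbm := S.θ_mul_b _ (Ioo_subset_Icc_self hr)
    have d0 : HasDerivAt (fun w : ℝ => 1 / w) (-(w ^ 2)⁻¹) w := by
      simpa using hasDerivAt_inv hw0
    have d1 : HasDerivAt B (t * ((S.c * S.θ ((2 - 1 / w) / t) - 1) * (-(-(w ^ 2)⁻¹) / t))) w :=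
      ((S.hasDerivAt_b _ hr).comp w ((d0.const_sub 2).div_const t)).const_mul t
    have d2 : HasDerivAt (fun w : ℝ => -1 / (4 * w)) (1 / (4 * w ^ 2)) w := by
      have := d0.const_mul (-1 / 4)
      refine (this.congr_of_eventuallyEq ?_).congr_deriv ?_
      · filter_upwards [eventually_ne_nhds hw0] with y hy
        field_simp
      · field_simp
    have d3 := (d2.add (((hasDerivAt_id w).mul (d1.pow 2)).div_const 4)).sub
      ((((Real.hasDerivAt_log hw0).const_mul 2).add d0).const_mul (S.c / 2))
    refine (d3.congr_of_eventuallyEq (Eventually.of_forall fun y => ?_)).congr_deriv ?_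
    · simp [hQ]
    · rw [S.survival_two_sub]
      simp only [hB, id, Pi.pow_apply]
      generalize S.θ ((2 - 1 / w) / t) = θ at *
      generalize S.b ((2 - 1 / w) / t) = β at *
      have hbm' : θ * β * t * w = 2 * w - 1 := by
        rw [hbm]; field_simp
      field_simp
      linear_combination (8 * S.c) * hbm'
  · refine ContinuousOn.intervalIntegrable ?_
    rw [uIcc_of_le hphi]
    simp only [S.survival_two_sub]
    refine ContinuousOn.pow (ContinuousOn.sub (continuousOn_const.div
      (continuousOn_const.mul continuousOn_id) ?_) (hBc.div_const 2)) 2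
    intro w hw
    exact mul_ne_zero (by norm_num) (hpos w hw)

end ScalingProfile
end FixedPoint
end FrozenPercolation

namespace FrozenPercolation

/-! ### The fixed point equation, and the disagreement of the two coordinates. -/

section FixedPoint

open Set

theorem phi_two_sub_one_div_mem {w s : ℝ} (hs : s ≤ 1) (hw : w ∈ Icc (1 / 2) (phi s)) :
    2 - 1 / w ∈ Icc 0 s := by
  have hwpos : 0 < w := by linarith [hw.1]
  have h1 : 1 / w ≤ 2 := by rw [div_le_iff₀ hwpos]; linarith [hw.1]
  have h4 : (2 - s) ≤ w⁻¹ := by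
    rw [le_inv_comm₀ (by linarith) hwpos]; exact hw.2
  rw [one_div] at h1 ⊢
  exact ⟨by linarith, by linarith⟩

theorem intervalIntegrable_measureReal_slice {ν : Measure (ℝ × ℝ)} [IsProbabilityMeasure ν]
    {A : Set (ℝ × (ℝ × ℝ))} (hA : MeasurableSet A) (a b : ℝ) :
    IntervalIntegrable (fun u => ν.real (Prod.mk u ⁻¹' A)) volume a b := by
  have hm : Measurable fun u => ν.real (Prod.mk u ⁻¹' A) :=
    (measurable_measure_prodMk_left hA).ennreal_toReal
  rw [intervalIntegrable_iff]
  have : IsFiniteMeasure (volume.restrict (uIoc a b)) := ⟨by simp [uIoc]⟩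
  refine Integrable.of_bound (C := 1) hm.aestronglyMeasurable (ae_of_all _ fun u => ?_)
  rw [Real.norm_of_nonneg measureReal_nonneg]
  exact measureReal_le_one

/-- An integral over `[0, 1]` of slices that are constant up to `1/2` and vanish after `a`. -/
theorem integral_slice {ν : Measure (ℝ × ℝ)} [IsProbabilityMeasure ν]
    {A : Set (ℝ × (ℝ × ℝ))} (hA : MeasurableSet A) {a : ℝ} (ha : 1 / 2 ≤ a) (ha' : a ≤ 1)
    (F : ℝ → ℝ) (h1 : ∀ u ≤ 1 / 2, ν.real (Prod.mk u ⁻¹' A) = F (1 / 2))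
    (h2 : ∀ u ∈ Icc (1 / 2) a, ν.real (Prod.mk u ⁻¹' A) = F u)
    (h3 : ∀ u > a, ν.real (Prod.mk u ⁻¹' A) = 0) :
    ∫ u in (0 : ℝ)..1, ν.real (Prod.mk u ⁻¹' A) = F (1 / 2) / 2 + ∫ u in (1 / 2)..a, F u := by
  have hI := intervalIntegrable_measureReal_slice (ν := ν) hA
  rw [← intervalIntegral.integral_add_adjacent_intervals (hI 0 a) (hI a 1),
    ← intervalIntegral.integral_add_adjacent_intervals (hI 0 (1 / 2)) (hI (1 / 2) a)]
  have e1 : ∫ u in (0 : ℝ)..(1 / 2), ν.real (Prod.mk u ⁻¹' A) =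
      ∫ u in (0 : ℝ)..(1 / 2), F (1 / 2) := by
    refine intervalIntegral.integral_congr fun u hu => ?_
    rw [uIcc_of_le (by norm_num)] at hu
    exact h1 u hu.2
  have e2 : ∫ u in (1 / 2)..a, ν.real (Prod.mk u ⁻¹' A) = ∫ u in (1 / 2)..a, F u := by
    refine intervalIntegral.integral_congr fun u hu => ?_
    rw [uIcc_of_le ha] at hu
    exact h2 u hu
  have e3 : ∫ u in a..1, ν.real (Prod.mk u ⁻¹' A) = 0 := by
    rw [intervalIntegral.integral_of_le ha', setIntegral_congr_fun measurableSet_Ioc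
      (g := fun _ => (0 : ℝ)) (fun u hu => h3 u hu.1)]
    simp
  rw [e1, e2, e3, intervalIntegral.integral_const]
  simp
  ring

namespace ScalingProfile

variable (S : ScalingProfile)

theorem stepLaw_real_apply {A : Set (ℝ × ℝ)} (hA : MeasurableSet A) :
    S.stepLaw.real A = ∫ u in (0 : ℝ)..1, S.minLaw.real (Prod.mk u ⁻¹' (chiPair ⁻¹' A)) := by
  rw [Measure.real, stepLaw, Measure.map_apply measurable_chiPair hA]
  exact measureReal_unif_prod (measurable_chiPair hA)

theorem survival_self {u : ℝ} : S.survival u u = 1 - u / 2 - u * S.b₁ / 2 := by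
  unfold survival
  by_cases h : u = 0
  · simp [h]
  · rw [div_self h, S.b_one]

theorem minLaw_real_Ioi {s t : ℝ} (hs : 0 ≤ s) (hst : s ≤ t) (ht : t ≤ 1) :
    S.minLaw.real (Ioi (phi s) ×ˢ Ioi (phi t)) = S.survival s t ^ 2 := by
  rw [S.minLaw_Ioi, S.rho_real_Ioi hs hst ht]

theorem minLaw_real_Ioi' {s t : ℝ} (hs : 0 ≤ s) (hst : s ≤ t) (ht : t ≤ 1) :
    S.minLaw.real (Ioi (phi t) ×ˢ Ioi (phi s)) = S.survival s t ^ 2 := by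
  rw [S.minLaw_Ioi, S.rho_real_Ioi' hs hst ht]

theorem minLaw_real_Ioc {s t w : ℝ} (hst : s ≤ t) (ht : t ≤ 1)
    (hw : w ∈ Icc (1 / 2) (phi s)) : S.minLaw.real (Ioc w (phi s) ×ˢ Ioc w (phi t)) =
      S.survival (2 - 1 / w) (2 - 1 / w) ^ 2 - S.survival (2 - 1 / w) s ^ 2
        - S.survival (2 - 1 / w) t ^ 2 + S.survival s t ^ 2 := by
  obtain ⟨hu0, hus⟩ := phi_two_sub_one_div_mem (hst.trans ht) hw
  have hs := hu0.trans hus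
  have hst' : phi s ≤ phi t :=
    (phi_le_phi_iff (by linarith) (by linarith)).2 hst
  rw [measureReal_Ioc_prod_Ioc hw.2 (hw.2.trans hst'), ← S.minLaw_real_Ioi hs hst ht]
  have e := phi_two_sub_inv (a := w)
  rw [← S.minLaw_real_Ioi hu0 le_rfl (hus.trans (hst.trans ht)),
    ← S.minLaw_real_Ioi' hu0 hus (hst.trans ht), ← S.minLaw_real_Ioi hu0 (hus.trans hst) ht, e]

theorem integral_survival_self {a : ℝ} (ha : 1 / 2 ≤ a) :
    ∫ w in (1 / 2 : ℝ)..a, S.survival (2 - 1 / w) (2 - 1 / w) ^ 2 =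
      (-(1 + S.b₁) ^ 2 / (4 * a) - (S.b₁ ^ 2 + S.b₁) * Real.log a + S.b₁ ^ 2 * a) -
      (-(1 + S.b₁) ^ 2 / 2 - (S.b₁ ^ 2 + S.b₁) * Real.log (1 / 2) + S.b₁ ^ 2 / 2) := by
  have hpos : ∀ w ∈ Icc (1 / 2 : ℝ) a, w ≠ 0 := fun w hw => by linarith [hw.1]
  have hinv : ContinuousOn (fun w : ℝ => 1 / w) (Icc (1 / 2) a) :=
    continuousOn_const.div continuousOn_id hpos
  have key := intervalIntegral.integral_eq_sub_of_hasDerivAt_of_le ha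
    (f := fun w => (-(1 + S.b₁) ^ 2 / 4) * (1 / w) - (S.b₁ ^ 2 + S.b₁) * Real.log w
      + S.b₁ ^ 2 * w)
    (f' := fun w => S.survival (2 - 1 / w) (2 - 1 / w) ^ 2) ?_ ?_ ?_
  · rw [key]
    have : a ≠ 0 := by linarith
    field_simp
    ring
  · exact ((continuousOn_const.mul hinv).sub (continuousOn_const.mul
      (continuousOn_id.log hpos))).add (continuousOn_const.mul continuousOn_id)
  · intro w hw
    have hw0 : w ≠ 0 := hpos w (Ioo_subset_Icc_self hw)
    have d0 : HasDerivAt (fun w : ℝ => 1 / w) (-(w ^ 2)⁻¹) w := by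
      simpa using hasDerivAt_inv hw0
    have d1 := ((d0.const_mul (-(1 + S.b₁) ^ 2 / 4)).sub ((Real.hasDerivAt_log hw0).const_mul
      (S.b₁ ^ 2 + S.b₁))).add ((hasDerivAt_id w).const_mul (S.b₁ ^ 2))
    refine d1.congr_deriv ?_
    rw [survival_self]
    field_simp
    ring
  · refine ContinuousOn.intervalIntegrable ?_
    rw [uIcc_of_le ha]
    simp only [survival_self]
    exact ((continuousOn_const.sub ((continuousOn_const.sub hinv).div_const 2)).sub
      (((continuousOn_const.sub hinv).mul continuousOn_const).div_const 2)).pow 2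

theorem intervalIntegrable_survival_sq {a t : ℝ} (ha : 1 / 2 ≤ a) :
    IntervalIntegrable (fun w => S.survival (2 - 1 / w) t ^ 2) volume (1 / 2) a := by
  have hpos : ∀ w ∈ Icc (1 / 2 : ℝ) a, w ≠ 0 := fun w hw => by linarith [hw.1]
  have hinv : ContinuousOn (fun w : ℝ => 1 / w) (Icc (1 / 2) a) :=
    continuousOn_const.div continuousOn_id hpos
  refine ContinuousOn.intervalIntegrable ?_
  rw [uIcc_of_le ha]
  unfold survival
  exact ((continuousOn_const.sub ((continuousOn_const.sub hinv).div_const 2)).sub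
      ((continuousOn_const.mul (S.continuous_b.comp_continuousOn
        ((continuousOn_const.sub hinv).div_const t))).div_const 2)).pow 2

theorem intervalIntegrable_survival_self {a : ℝ} (ha : 1 / 2 ≤ a) :
    IntervalIntegrable (fun w => S.survival (2 - 1 / w) (2 - 1 / w) ^ 2) volume (1 / 2) a := by
  have hpos : ∀ w ∈ Icc (1 / 2 : ℝ) a, w ≠ 0 := fun w hw => by linarith [hw.1]
  have hinv : ContinuousOn (fun w : ℝ => 1 / w) (Icc (1 / 2) a) :=
    continuousOn_const.div continuousOn_id hpos
  refine ContinuousOn.intervalIntegrable ?_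
  rw [uIcc_of_le ha]
  simp only [survival_self]
  exact ((continuousOn_const.sub ((continuousOn_const.sub hinv).div_const 2)).sub
      (((continuousOn_const.sub hinv).mul continuousOn_const).div_const 2)).pow 2

theorem chiPair_preimage_Iic_prod_Iic {a b : ℝ} (ha : a < 2) (hb : b < 2) (u : ℝ) :
    Prod.mk u ⁻¹' (chiPair ⁻¹' (Iic a ×ˢ Iic b)) = Ioc u a ×ˢ Ioc u b := by
  ext m
  change (chi u m.1 ≤ a ∧ chi u m.2 ≤ b) ↔ _
  rw [chi_le_iff ha, chi_le_iff hb]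
  rfl

theorem chiPair_preimage_Iic_prod_univ {a : ℝ} (ha : a < 2) (u : ℝ) :
    Prod.mk u ⁻¹' (chiPair ⁻¹' (Iic a ×ˢ univ)) = Ioc u a ×ˢ univ := by
  ext m
  change (chi u m.1 ≤ a ∧ True) ↔ (_ ∧ True)
  rw [chi_le_iff ha]

/-- Integrating the slices over the activation time leaves `integral_survival_self` and two
instances of `integral_survival_sq`. Their logarithms cancel exactly because `2 c = b₁ ^ 2 + b₁`,
the boundary condition on `b' 1`. -/
theorem stepLaw_real_Iic_Iic {s t : ℝ} (hs : 0 ≤ s) (hst : s ≤ t) (ht : t ≤ 1) :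
    S.stepLaw.real (Iic (phi s) ×ˢ Iic (phi t)) = (t - t * S.b (s / t)) / 2 := by
  have hs1 := hst.trans ht
  have hmA : MeasurableSet (Iic (phi s) ×ˢ Iic (phi t)) := measurableSet_Iic.prod measurableSet_Iic
  have hphi := half_le_phi hs hs1
  have h2s := phi_lt_two ⟨hs, hs1⟩
  have h2t := phi_lt_two ⟨hs.trans hst, ht⟩
  set F : ℝ → ℝ := fun w => S.survival (2 - 1 / w) (2 - 1 / w) ^ 2 - S.survival (2 - 1 / w) s ^ 2
        - S.survival (2 - 1 / w) t ^ 2 + S.survival s t ^ 2 with hF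
  rw [S.stepLaw_real_apply hmA, integral_slice (measurable_chiPair hmA) hphi (phi_le_one hs1) F]
  · have i1 := S.intervalIntegrable_survival_self hphi
    have i2 := S.intervalIntegrable_survival_sq (t := s) hphi
    have i3 := S.intervalIntegrable_survival_sq (t := t) hphi
    have e : (∫ w in (1 / 2)..(phi s), F w) =
        (∫ w in (1 / 2)..(phi s), S.survival (2 - 1 / w) (2 - 1 / w) ^ 2)
        - (∫ w in (1 / 2)..(phi s), S.survival (2 - 1 / w) s ^ 2)
        - (∫ w in (1 / 2)..(phi s), S.survival (2 - 1 / w) t ^ 2)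
        + (phi s - 1 / 2) * S.survival s t ^ 2 := by
      simp only [hF]
      rw [intervalIntegral.integral_add ((i1.sub i2).sub i3) (by simp),
        intervalIntegral.integral_sub (i1.sub i2) i3, intervalIntegral.integral_sub i1 i2,
        intervalIntegral.integral_const, smul_eq_mul]
    rw [e, S.integral_survival_self hphi, S.integral_survival_sq hs le_rfl hs1,
      S.integral_survival_sq hs hst ht]
    have e0 : (2 : ℝ) - 1 / (1 / 2) = 0 := by norm_num
    have hss : s * S.b (s / s) = s * S.b₁ := by
      by_cases h : s = 0
      · simp [h]
      · rw [div_self h, S.b_one]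
    simp only [hF]
    rw [e0, hss]
    have hsurv : ∀ x, S.survival 0 x = 1 - x / 2 := by
      intro x; simp [survival, S.b_zero]
    rw [hsurv, hsurv, hsurv]
    unfold survival
    -- The rest is algebra in which `b (s / t)` and the logarithms are arbitrary numbers.
    generalize S.b (s / t) = β
    have hc := S.two_c
    have hcc : S.c = (S.b₁ ^ 2 + S.b₁) / 2 := by linarith
    rw [hcc]
    have h2 : (2 - s) ≠ 0 := by linarith
    have hphi' : phi s = 1 / (2 - s) := by rw [phi, one_div]
    generalize Real.log (phi s) = l
    generalize Real.log (1 / 2) = l'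
    rw [hphi']
    field_simp
    ring
  · intro u hu
    rw [chiPair_preimage_Iic_prod_Iic h2s h2t, S.minLaw_of_le_half hu,
      S.minLaw_real_Ioc hst ht ⟨le_rfl, hphi⟩]
  · intro u hu
    rw [chiPair_preimage_Iic_prod_Iic h2s h2t, S.minLaw_real_Ioc hst ht hu]
  · intro u hu
    rw [chiPair_preimage_Iic_prod_Iic h2s h2t, Ioc_eq_empty (not_lt.2 hu.le)]
    simp

theorem minLaw_real_Ioi_univ {w : ℝ} (hw : w ∈ Icc (1 / 2 : ℝ) 1) :
    S.minLaw.real (Ioi w ×ˢ univ) = 1 / (4 * w ^ 2) := by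
  have hwpos : 0 < w := by linarith [hw.1]
  have hu : 2 - 1 / w ∈ Icc (0 : ℝ) 1 :=
    phi_two_sub_one_div_mem le_rfl (by rw [phi_one]; exact hw)
  have hz : S.minLaw (univ ×ˢ Iic (1 / 2)) = 0 := by
    rw [prod_swap_apply S.map_swap_minLaw MeasurableSet.univ measurableSet_Iic,
      S.minLaw_Iic_half_univ]
  have h1 : S.minLaw.real (Ioi w ×ˢ univ) = S.minLaw.real (Ioi w ×ˢ Ioi (phi 0)) := by
    simp only [Measure.real]
    congr 1
    refine measure_congr ?_
    have h2' : ∀ᵐ p ∂S.minLaw, p ∉ (univ : Set ℝ) ×ˢ (Iic (1 / 2) : Set ℝ) :=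
      measure_eq_zero_iff_ae_notMem.1 hz
    filter_upwards [h2'] with p hp
    simp only [mem_prod, mem_Iic, mem_univ, true_and, not_le] at hp
    refine propext ?_
    change (w < p.1 ∧ True) ↔ (w < p.1 ∧ phi 0 < p.2)
    rw [phi_zero]
    simp only [hp]
  have e := phi_two_sub_inv (a := w)
  have h2 := S.minLaw_real_Ioi' le_rfl hu.1 hu.2
  rw [e] at h2
  rw [h1, h2, survival]
  simp only [zero_div, S.b_zero]
  field_simp
  ring

theorem stepLaw_real_Iic_univ {s : ℝ} (hs : s ∈ Icc (0 : ℝ) 1) :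
    S.stepLaw.real (Iic (phi s) ×ˢ univ) = s / 2 := by
  have hmA : MeasurableSet (Iic (phi s) ×ˢ (univ : Set ℝ)) := measurableSet_Iic.prod .univ
  have hphi := half_le_phi hs.1 hs.2
  have hphi1 := phi_le_one hs.2
  have h2s := phi_lt_two hs
  have hIoc : ∀ w ∈ Icc (1 / 2) (phi s), S.minLaw.real (Ioc w (phi s) ×ˢ univ) =
      1 / (4 * w ^ 2) - 1 / (4 * phi s ^ 2) := by
    intro w hw
    rw [← S.minLaw_real_Ioi_univ ⟨hw.1, hw.2.trans hphi1⟩, ← S.minLaw_real_Ioi_univ ⟨hphi, hphi1⟩,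
      ← Ioc_union_Ioi_eq_Ioi hw.2, union_prod, measureReal_union]
    · ring
    · exact Disjoint.set_prod_left (Ioc_disjoint_Ioi le_rfl) _ _
    · exact measurableSet_Ioi.prod .univ
  rw [S.stepLaw_real_apply hmA, integral_slice (measurable_chiPair hmA) hphi hphi1
    (fun w => 1 / (4 * w ^ 2) - 1 / (4 * phi s ^ 2))]
  · have hpos : ∀ w ∈ Icc (1 / 2 : ℝ) (phi s), w ≠ 0 := fun w hw => by linarith [hw.1]
    have hinv : ContinuousOn (fun w : ℝ => 1 / w) (Icc (1 / 2) (phi s)) :=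
      continuousOn_const.div continuousOn_id hpos
    have key := intervalIntegral.integral_eq_sub_of_hasDerivAt_of_le hphi
      (f := fun w => -1 / 4 * (1 / w) - w / (4 * phi s ^ 2))
      (f' := fun w => 1 / (4 * w ^ 2) - 1 / (4 * phi s ^ 2)) ?_ ?_ ?_
    · rw [key]
      have h2 : (2 - s) ≠ 0 := by linarith [hs.2]
      have hphi' : phi s = 1 / (2 - s) := by rw [phi, one_div]
      rw [hphi']
      field_simp
      ring
    · exact (continuousOn_const.mul hinv).sub (continuousOn_id.div_const _)
    · intro w hw
      have hw0 : w ≠ 0 := hpos w (Ioo_subset_Icc_self hw)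
      have d0 : HasDerivAt (fun w : ℝ => 1 / w) (-(w ^ 2)⁻¹) w := by
        simpa using hasDerivAt_inv hw0
      refine ((d0.const_mul (-1 / 4)).sub ((hasDerivAt_id w).div_const _)).congr_deriv ?_
      field_simp
    · refine ContinuousOn.intervalIntegrable ?_
      rw [uIcc_of_le hphi]
      refine (continuousOn_const.div (continuousOn_const.mul (continuousOn_id.pow 2))
        fun w hw => ?_).sub continuousOn_const
      exact mul_ne_zero (by norm_num) (pow_ne_zero 2 (hpos w hw))
  · intro u hu
    rw [chiPair_preimage_Iic_prod_univ h2s, ← hIoc _ ⟨le_rfl, hphi⟩]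
    have hd : ∀ v ≤ (1 / 2 : ℝ), S.minLaw.real (Ioc v (phi s) ×ˢ univ) =
        S.minLaw.real (Iic (phi s) ×ˢ univ) := by
      intro v hv
      simp only [Measure.real]
      congr 1
      refine measure_congr ?_
      have h1' : ∀ᵐ p ∂S.minLaw, p ∉ (Iic (1 / 2) : Set ℝ) ×ˢ (univ : Set ℝ) :=
        measure_eq_zero_iff_ae_notMem.1 S.minLaw_Iic_half_univ
      filter_upwards [h1'] with p hp
      simp only [mem_prod, mem_Iic, mem_univ, and_true, not_le] at hp
      have : v < p.1 := hv.trans_lt hp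
      refine propext ?_
      change ((v < p.1 ∧ p.1 ≤ phi s) ∧ True) ↔ (p.1 ≤ phi s ∧ True)
      simp only [this, true_and]
    rw [hd u hu, hd _ le_rfl]
  · intro u hu
    rw [chiPair_preimage_Iic_prod_univ h2s, hIoc u hu]
  · intro u hu
    rw [chiPair_preimage_Iic_prod_univ h2s, Ioc_eq_empty (not_lt.2 hu.le)]
    simp

theorem stepLaw_compl_timeSet : S.stepLaw (timeSet ×ˢ timeSet)ᶜ = 0 := by
  have hm := (measurableSet_timeSet.prod measurableSet_timeSet)
  have h1 : ∀ᵐ p ∂S.minLaw, p ∈ timeSet ×ˢ timeSet := by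
    refine (ae_map_iff measurable_minPair.aemeasurable hm).2 ?_
    have h0 : ∀ᵐ p ∂S.rho, p ∈ timeSet ×ˢ timeSet := S.rho_compl_timeSet
    have h2 : ∀ᵐ p ∂(S.rho.prod S.rho), p.1 ∈ timeSet ×ˢ timeSet :=
      Measure.quasiMeasurePreserving_fst.ae h0
    have h3 : ∀ᵐ p ∂(S.rho.prod S.rho), p.2 ∈ timeSet ×ˢ timeSet :=
      Measure.quasiMeasurePreserving_snd.ae h0
    filter_upwards [h2, h3] with p hp2 hp3
    constructor
    · rcases min_choice p.1.1 p.2.1 with h | h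
      · simp only [minPair, h]; exact hp2.1
      · simp only [minPair, h]; exact hp3.1
    · rcases min_choice p.1.2 p.2.2 with h | h
      · simp only [minPair, h]; exact hp2.2
      · simp only [minPair, h]; exact hp3.2
  change ∀ᵐ p ∂S.stepLaw, p ∈ timeSet ×ˢ timeSet
  refine (ae_map_iff measurable_chiPair.aemeasurable hm).2 ?_
  have h2 : ∀ᵐ p ∂(unif.prod S.minLaw), p.2 ∈ timeSet ×ˢ timeSet :=
    Measure.quasiMeasurePreserving_snd.ae h1
  filter_upwards [h2] with p hp
  have hchi : ∀ m ∈ timeSet, chi p.1 m ∈ timeSet := by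
    intro m hm
    unfold chi
    split_ifs
    · exact hm
    · exact Or.inr rfl
  exact ⟨hchi _ hp.1, hchi _ hp.2⟩

/-- `S.rho` solves the bivariate recursive distributional equation. -/
theorem stepLaw_eq_rho : S.stepLaw = S.rho := by
  have hle : ∀ s t : ℝ, 0 ≤ s → s ≤ t → t ≤ 1 →
      S.stepLaw (Iic (phi s) ×ˢ Iic (phi t)) = S.rho (Iic (phi s) ×ˢ Iic (phi t)) := by
    intro s t hs hst ht
    rw [← ENNReal.toReal_eq_toReal_iff' (measure_ne_top _ _) (measure_ne_top _ _)]
    exact (S.stepLaw_real_Iic_Iic hs hst ht).trans (S.rho_real_Iic_Iic hs hst ht).symm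
  have hu : ∀ s ∈ Icc (0 : ℝ) 1, S.stepLaw (Iic (phi s) ×ˢ univ) = S.rho (Iic (phi s) ×ˢ univ) := by
    intro s hs
    rw [← ENNReal.toReal_eq_toReal_iff' (measure_ne_top _ _) (measure_ne_top _ _)]
    exact (S.stepLaw_real_Iic_univ hs).trans (S.rho_real_Iic_univ hs).symm
  refine ext_of_timeSet S.stepLaw_compl_timeSet S.rho_compl_timeSet ?_ hu ?_
  · intro s hs t ht
    rcases le_total s t with h | h
    · exact hle s t hs.1 h ht.2
    · rw [prod_swap_apply S.map_swap_stepLaw measurableSet_Iic measurableSet_Iic,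
        prod_swap_apply S.map_swap_rho measurableSet_Iic measurableSet_Iic]
      exact hle t s ht.1 h hs.2
  · intro s hs
    rw [prod_swap_apply S.map_swap_stepLaw MeasurableSet.univ measurableSet_Iic,
      prod_swap_apply S.map_swap_rho MeasurableSet.univ measurableSet_Iic, hu s hs]

/-- The univariate law of explosion times. -/
noncomputable def nu : Measure ℝ := S.rho.map Prod.fst

instance : IsProbabilityMeasure S.nu :=
  Measure.isProbabilityMeasure_map measurable_fst.aemeasurable

theorem map_snd_rho : S.rho.map Prod.snd = S.nu := by
  have : (Prod.snd : ℝ × ℝ → ℝ) = Prod.fst ∘ Prod.swap := rfl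
  rw [this, ← Measure.map_map measurable_fst measurable_swap, S.map_swap_rho, nu]

theorem nu_Iic_phi {s : ℝ} (hs : s ∈ Icc (0 : ℝ) 1) :
    S.nu (Iic (phi s)) = ENNReal.ofReal (s / 2) := by
  rw [nu, Measure.map_apply measurable_fst measurableSet_Iic, ← S.rho_Iic_univ hs]
  congr 1
  ext; simp

theorem nu_compl_timeSet : S.nu timeSetᶜ = 0 := by
  rw [nu, Measure.map_apply measurable_fst measurableSet_timeSet.compl]
  refine measure_mono_null ?_ S.rho_compl_timeSet
  intro p hp h
  exact hp h.1

/-- The two coupled processes freeze differently at a given oriented edge with positive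
probability. -/
theorem disagreement_pos :
    0 < (unif.prod S.minLaw) {p | p.2.1 ≤ p.1 ∧ p.1 < p.2.2} := by
  have hm : MeasurableSet {p : ℝ × (ℝ × ℝ) | p.2.1 ≤ p.1 ∧ p.1 < p.2.2} :=
    (measurableSet_le (by fun_prop) measurable_fst).inter
      (measurableSet_lt measurable_fst (by fun_prop))
  rw [Measure.prod_apply hm]
  have hpos : ∀ w ∈ Ioc (1 / 2 : ℝ) 1, S.minLaw
      (Prod.mk w ⁻¹' {p : ℝ × (ℝ × ℝ) | p.2.1 ≤ p.1 ∧ p.1 < p.2.2}) ≠ 0 := by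
    intro w hw h0
    have hset : Prod.mk w ⁻¹' {p : ℝ × (ℝ × ℝ) | p.2.1 ≤ p.1 ∧ p.1 < p.2.2} = Iic w ×ˢ Ioi w := rfl
    rw [hset] at h0
    have hwpos : 0 < w := by linarith [hw.1]
    have hu : 2 - 1 / w ∈ Icc (0 : ℝ) 1 :=
      phi_two_sub_one_div_mem le_rfl (by rw [phi_one]; exact ⟨hw.1.le, hw.2⟩)
    -- If the set were null, "the second time exceeds `w`" and "both times exceed `w`" would be
    -- equally likely. With `u = 2 - 1 / w` their probabilities are `(1 - u / 2) ^ 2` and `(1 - u /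
    -- 2 - u b₁ / 2) ^ 2`, which differ because `b₁ > 0`.
    have h1 : S.minLaw.real (univ ×ˢ Ioi w) = S.minLaw.real (Ioi w ×ˢ Ioi w) := by
      rw [← Iic_union_Ioi (a := w), union_prod, measureReal_union]
      · simp [Measure.real, h0]
      · exact Disjoint.set_prod_left (Iic_disjoint_Ioi le_rfl) _ _
      · exact measurableSet_Ioi.prod measurableSet_Ioi
    have h2 : S.minLaw.real (univ ×ˢ Ioi w) = 1 / (4 * w ^ 2) := by
      rw [← S.minLaw_real_Ioi_univ ⟨hw.1.le, hw.2⟩, Measure.real, Measure.real,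
        prod_swap_apply S.map_swap_minLaw MeasurableSet.univ measurableSet_Ioi]
    have h3 := S.minLaw_real_Ioi hu.1 le_rfl hu.2
    rw [phi_two_sub_inv] at h3
    rw [h2, h3, S.survival_self] at h1
    have h4 := S.rho_real_Ioi hu.1 le_rfl hu.2
    have h5 : 0 ≤ S.survival (2 - 1 / w) (2 - 1 / w) := h4 ▸ measureReal_nonneg
    rw [S.survival_self] at h5
    have hb := S.b₁_pos
    have hu' : 0 < 2 - 1 / w := by
      have : 1 / w < 2 := by rw [div_lt_iff₀ hwpos]; linarith [hw.1]
      linarith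
    have h6 : 1 / (4 * w ^ 2) = (1 - (2 - 1 / w) / 2) ^ 2 := by
      field_simp
      ring
    rw [h6] at h1
    have := mul_pos hu' hb
    nlinarith
  have hmm : Measurable fun w => S.minLaw
      (Prod.mk w ⁻¹' {p : ℝ × (ℝ × ℝ) | p.2.1 ≤ p.1 ∧ p.1 < p.2.2}) :=
    measurable_measure_prodMk_left hm
  rw [lintegral_pos_iff_support hmm]
  refine lt_of_lt_of_le ?_ (measure_mono (show Ioc (1 / 2 : ℝ) 1 ⊆ _ from fun w hw => hpos w hw))
  rw [unif, Measure.restrict_apply measurableSet_Ioc, inter_eq_left.2]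
  · simp
    norm_num
  · exact fun w hw => ⟨by linarith [hw.1], hw.2⟩

end ScalingProfile
end FixedPoint
end FrozenPercolation

namespace FrozenPercolation

/-! ### Branch σ-algebras, independence behind an edge, and the recursion almost surely. -/

section Algebras

variable {V : Type*} {T : SimpleGraph V} {Ω : Type*}
  {U : Ω → T.edgeSet → ℝ} {Fo : Ω → Set T.Dart} {ch : Bool → T.Dart → T.Dart}

variable (U Fo) in
/-- The σ-algebra generated by the process restricted to the branch that starts with `d`. -/
@[reducible] def branchAlgebra (d : T.Dart) : MeasurableSpace Ω :=
  MeasurableSpace.comap (fun ω => ((fun e : edgesFrom T d => U ω e), Fo ω ∩ dartsFrom T d))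
    inferInstance

variable (U) in
/-- The σ-algebra generated by the activation times in the branch that starts with `d`. -/
@[reducible] def timeAlgebra (d : T.Dart) : MeasurableSpace Ω :=
  MeasurableSpace.comap (fun ω (e : edgesFrom T d) => U ω e) inferInstance

/-- The explosion time of an oriented edge, as a random variable. -/
noncomputable def explosion (ch : Bool → T.Dart → T.Dart) (U : Ω → T.edgeSet → ℝ)
    (A : Ω → Set T.Dart) (d : T.Dart) (ω : Ω) : ℝ :=
  explosionTime ch (fun d => U ω (toEdge T d)) (A ω) d

/-- The time at which there is an open path of length `n + 1`, as a random variable. -/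
noncomputable def reach (ch : Bool → T.Dart → T.Dart) (U : Ω → T.edgeSet → ℝ)
    (A : Ω → Set T.Dart) (n : ℕ) (d : T.Dart) (ω : Ω) : ℝ :=
  reachTime ch (fun d => U ω (toEdge T d)) (A ω) n d

theorem timeAlgebra_le_branchAlgebra (d : T.Dart) : timeAlgebra U d ≤ branchAlgebra U Fo d := by
  let := branchAlgebra U Fo d
  rw [timeAlgebra, ← measurable_iff_comap_le]
  exact measurable_fst.comp (comap_measurable _)

theorem measurable_timeAlgebra {d : T.Dart} {e : T.edgeSet} (he : e ∈ edgesFrom T d) :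
    Measurable[timeAlgebra U d] fun ω => U ω e := by
  let := timeAlgebra U d
  have h : Measurable fun ω (e : edgesFrom T d) => U ω e := comap_measurable _
  exact (measurable_pi_apply (⟨e, he⟩ : edgesFrom T d)).comp h

theorem measurableSet_branchAlgebra {d d' : T.Dart} (hd : d' ∈ dartsFrom T d) :
    MeasurableSet[branchAlgebra U Fo d] {ω | d' ∈ Fo ω} := by
  let := branchAlgebra U Fo d
  have h : Measurable fun ω => Fo ω ∩ dartsFrom T d :=
    measurable_snd.comp (comap_measurable _)
  have h2 := measurable_set_mem d' |>.comp h
  have h3 : {ω | d' ∈ Fo ω} = {ω | d' ∈ Fo ω ∩ dartsFrom T d} := by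
    ext ω; simp [hd]
  rw [h3]
  exact measurableSet_setOfPred.2 h2

theorem branchAlgebra_child_le (hch : IsChildMap T ch) (b : Bool) (d : T.Dart) :
    branchAlgebra U Fo (ch b d) ≤ branchAlgebra U Fo d := by
  let := branchAlgebra U Fo d
  rw [branchAlgebra, ← measurable_iff_comap_le]
  refine Measurable.prodMk ?_ ?_
  · refine measurable_pi_lambda _ fun e => ?_
    exact (measurable_timeAlgebra (hch.edgesFrom_child_subset b d e.2)).mono
      (timeAlgebra_le_branchAlgebra d) le_rfl
  · refine measurable_set_iff.2 fun d' => ?_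
    by_cases hd' : d' ∈ dartsFrom T (ch b d)
    · simp only [Set.mem_inter_iff, hd', and_true]
      exact measurableSet_setOfPred.1
        (measurableSet_branchAlgebra (hch.dartsFrom_child_subset b d hd'))
    · simp only [Set.mem_inter_iff, hd', and_false]
      exact measurable_const

theorem timeAlgebra_child_le (hch : IsChildMap T ch) (b : Bool) (d : T.Dart) :
    timeAlgebra U (ch b d) ≤ timeAlgebra U d := by
  let := timeAlgebra U d
  rw [timeAlgebra, ← measurable_iff_comap_le]
  refine measurable_pi_lambda _ fun e => ?_
  exact measurable_timeAlgebra (hch.edgesFrom_child_subset b d e.2)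

theorem measurable_time_timeAlgebra (hch : IsChildMap T ch) (d : T.Dart) :
    Measurable[timeAlgebra U d] (fun ω => U ω (toEdge T d)) :=
  measurable_timeAlgebra ⟨d, hch.self_mem_dartsFrom d, rfl⟩

theorem measurable_time_branchAlgebra (hch : IsChildMap T ch) (d : T.Dart) :
    Measurable[branchAlgebra U Fo d] (fun ω => U ω (toEdge T d)) :=
  (measurable_time_timeAlgebra hch d).mono (timeAlgebra_le_branchAlgebra d) le_rfl

theorem measurable_reach_branchAlgebra (hch : IsChildMap T ch) (n : ℕ) (d : T.Dart) :
    Measurable[branchAlgebra U Fo d] (reach ch U Fo n d) := by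
  let := branchAlgebra U Fo d
  exact hch.measurable_reachTime (u := fun ω d => U ω (toEdge T d)) d
    (fun d' hd' => (measurable_timeAlgebra ⟨d', hd', rfl⟩).mono
      (timeAlgebra_le_branchAlgebra d) le_rfl)
    (fun _ hd' => measurableSet_branchAlgebra hd') n

theorem measurable_explosion_branchAlgebra (hch : IsChildMap T ch) (d : T.Dart) :
    Measurable[branchAlgebra U Fo d] (explosion ch U Fo d) := by
  let := branchAlgebra U Fo d
  exact hch.measurable_explosionTime (u := fun ω d => U ω (toEdge T d)) d
    (fun d' hd' => (measurable_timeAlgebra ⟨d', hd', rfl⟩).mono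
      (timeAlgebra_le_branchAlgebra d) le_rfl)
    (fun _ hd' => measurableSet_branchAlgebra hd')

end Algebras

section Law

variable {V : Type*} {T : SimpleGraph V} {Ω : Type*} [mΩ : MeasurableSpace Ω] {P : Measure Ω}
  {U : Ω → T.edgeSet → ℝ} {Fo : Ω → Set T.Dart} {ch : Bool → T.Dart → T.Dart}

theorem IsOrientedFrozenPercolation.branchAlgebra_le (hF : IsOrientedFrozenPercolation T P U Fo)
    (d : T.Dart) : branchAlgebra U Fo d ≤ mΩ := by
  rw [branchAlgebra, ← measurable_iff_comap_le]
  refine Measurable.prodMk ?_ ?_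
  · exact measurable_pi_lambda _ fun e => (measurable_pi_apply _).comp hF.activation.measurable
  · refine measurable_set_iff.2 fun d' => ?_
    by_cases hd' : d' ∈ dartsFrom T d
    · simp only [Set.mem_inter_iff, hd', and_true]
      exact (measurable_set_mem d').comp hF.measurable
    · simp only [Set.mem_inter_iff, hd', and_false]
      exact measurable_const

theorem IsOrientedFrozenPercolation.iIndep_branchAlgebra
    (hF : IsOrientedFrozenPercolation T P U Fo) {S : Set V} (hS : S.Finite)
    (hS' : (T.induce S).IsTree) :
    iIndep (fun d : outBoundary T S => branchAlgebra U Fo (d : T.Dart)) P := by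
  exact hF.indep_branches S hS hS'

theorem child_mem_outBoundary (hch : IsChildMap T ch) (b : Bool) (d : T.Dart) :
    ch b d ∈ outBoundary T {d.fst, d.snd} := by
  have h := hch.fst_eq b d
  refine ⟨by simp [h], ?_⟩
  rintro (h1 | h1)
  · exact hch.snd_ne b d h1
  · exact (ch b d).adj.ne (h.trans h1.symm)

theorem IsOrientedFrozenPercolation.indep_children (hF : IsOrientedFrozenPercolation T P U Fo)
    (hT : T.IsTree) (hch : IsChildMap T ch) (d : T.Dart) :
    Indep (branchAlgebra U Fo (ch false d)) (branchAlgebra U Fo (ch true d)) P := by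
  have h := hF.iIndep_branchAlgebra (S := {d.fst, d.snd}) (by simp) (isTree_induce_pair hT d)
  refine h.indep (i := ⟨_, child_mem_outBoundary hch false d⟩)
    (j := ⟨_, child_mem_outBoundary hch true d⟩) ?_
  intro h'
  exact hch.ne d (congrArg Subtype.val h')

theorem IsOrientedFrozenPercolation.indep_time_children
    (hF : IsOrientedFrozenPercolation T P U Fo)
    (hT : T.IsTree) (hch : IsChildMap T ch) (d : T.Dart) :
    Indep (MeasurableSpace.comap (fun ω => U ω (toEdge T d)) inferInstance)
      (branchAlgebra U Fo (ch false d) ⊔ branchAlgebra U Fo (ch true d)) P := by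
  have h := (hF.indep_inside {d.fst, d.snd} (by simp) (isTree_induce_pair hT d)).symm
  refine indep_of_indep_of_le_left (indep_of_indep_of_le_right h ?_) ?_
  · have key : ∀ b, branchAlgebra U Fo (ch b d) ≤ MeasurableSpace.comap
        (fun ω (d : outBoundary T {d.fst, d.snd}) =>
          ((fun e : edgesFrom T d => U ω e), Fo ω ∩ dartsFrom T d)) inferInstance := by
      intro b
      let : MeasurableSpace Ω := MeasurableSpace.comap
        (fun ω (d : outBoundary T {d.fst, d.snd}) =>
          ((fun e : edgesFrom T d => U ω e), Fo ω ∩ dartsFrom T d)) inferInstance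
      rw [branchAlgebra, ← measurable_iff_comap_le]
      have h1 : Measurable (fun ω (d : outBoundary T {d.fst, d.snd}) =>
          ((fun e : edgesFrom T d => U ω e), Fo ω ∩ dartsFrom T d)) := comap_measurable _
      exact (measurable_pi_apply
        (⟨_, child_mem_outBoundary hch b d⟩ : outBoundary T {d.fst, d.snd})).comp h1
    exact sup_le (key false) (key true)
  · have hd : toEdge T d ∈ inducedEdges T {d.fst, d.snd} := by
      intro v hv
      have : v = d.fst ∨ v = d.snd := by
        simpa [toEdge, SimpleGraph.Dart.edge, SimpleGraph.dart_edge_eq_mk'_iff'] using hv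
      simpa using this
    let : MeasurableSpace Ω := MeasurableSpace.comap
        (fun ω (e : inducedEdges T {d.fst, d.snd}) => U ω e) inferInstance
    rw [← measurable_iff_comap_le]
    have h1 : Measurable (fun ω (e : inducedEdges T {d.fst, d.snd}) => U ω e) :=
      comap_measurable _
    exact (measurable_pi_apply (⟨_, hd⟩ : inducedEdges T {d.fst, d.snd})).comp h1

/-- This is the form of independence that is iterated over generations in `map_branchTree`. -/
theorem IsOrientedFrozenPercolation.map_children [IsProbabilityMeasure P]
    (hF : IsOrientedFrozenPercolation T P U Fo)
    (hT : T.IsTree) (hch : IsChildMap T ch) (d : T.Dart) {α β : Type*} [MeasurableSpace α]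
    [MeasurableSpace β] {f : Ω → α} {g : Ω → β}
    (hf : Measurable[branchAlgebra U Fo (ch false d)] f)
    (hg : Measurable[branchAlgebra U Fo (ch true d)] g) :
    P.map (fun ω => (U ω (toEdge T d), f ω, g ω)) = unif.prod ((P.map f).prod (P.map g)) := by
  have hf' : Measurable f := hf.mono (hF.branchAlgebra_le _) le_rfl
  have hg' : Measurable g := hg.mono (hF.branchAlgebra_le _) le_rfl
  have hU : Measurable fun ω => U ω (toEdge T d) :=
    (measurable_pi_apply _).comp hF.activation.measurable
  have h1 : IndepFun f g P := indep_of_indep_of_le_left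
    (indep_of_indep_of_le_right (hF.indep_children hT hch d) hg.comap_le) hf.comap_le
  have h2 : IndepFun (fun ω => U ω (toEdge T d)) (fun ω => (f ω, g ω)) P := by
    refine indep_of_indep_of_le_right (hF.indep_time_children hT hch d) ?_
    let m : MeasurableSpace Ω := branchAlgebra U Fo (ch false d) ⊔ branchAlgebra U Fo (ch true d)
    rw [← measurable_iff_comap_le]
    exact (hf.mono le_sup_left le_rfl).prodMk (hg.mono le_sup_right le_rfl)
  have e1 := (indepFun_iff_map_prod_eq_prod_map_map hU.aemeasurable
    (hf'.prodMk hg').aemeasurable).1 h2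
  have e2 := (indepFun_iff_map_prod_eq_prod_map_map hf'.aemeasurable hg'.aemeasurable).1 h1
  rw [e1, e2, hF.activation.uniform]
  rfl

theorem IsOrientedFrozenPercolation.measurable_reach
    (hF : IsOrientedFrozenPercolation T P U Fo) (hch : IsChildMap T ch) (n : ℕ) (d : T.Dart) :
    Measurable (reach ch U Fo n d) :=
  (measurable_reach_branchAlgebra hch n d).mono (hF.branchAlgebra_le d) le_rfl

theorem IsOrientedFrozenPercolation.measurable_explosion
    (hF : IsOrientedFrozenPercolation T P U Fo) (hch : IsChildMap T ch) (d : T.Dart) :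
    Measurable (explosion ch U Fo d) :=
  (measurable_explosion_branchAlgebra hch d).mono (hF.branchAlgebra_le d) le_rfl

/-- Invariance is used only here: some automorphism maps `d` to `d'`, and it commutes with the
formation of explosion times. -/
theorem IsOrientedFrozenPercolation.map_reach_explosion_eq
    (hF : IsOrientedFrozenPercolation T P U Fo) (hT : T.IsTree) (hch : IsChildMap T ch) (n : ℕ)
    (d d' : T.Dart) :
    P.map (fun ω => (reach ch U Fo n d ω, explosion ch U Fo d ω)) =
      P.map (fun ω => (reach ch U Fo n d' ω, explosion ch U Fo d' ω)) := by
  obtain ⟨φ, rfl⟩ := hch.exists_iso hT d d'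
  have hm : Measurable fun p : (T.edgeSet → ℝ) × Set T.Dart =>
      (reachTime ch (fun d => p.1 (toEdge T d)) p.2 n d,
        explosionTime ch (fun d => p.1 (toEdge T d)) p.2 d) := by
    have h1 : ∀ d' ∈ dartsFrom T d, Measurable fun p : (T.edgeSet → ℝ) × Set T.Dart =>
      p.1 (toEdge T d') := fun d' _ => (measurable_pi_apply _).comp measurable_fst
    have h2 : ∀ d' ∈ dartsFrom T d, MeasurableSet {p : (T.edgeSet → ℝ) × Set T.Dart | d' ∈ p.2} :=
      fun d' _ => measurableSet_setOfPred.2 ((measurable_set_mem d').comp measurable_snd)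
    exact (hch.measurable_reachTime d h1 h2 n).prodMk (hch.measurable_explosionTime d h1 h2)
  have h := ((hF.invariant φ).comp hm).map_eq
  refine h.symm.trans ?_
  congr 1
  funext ω
  have e1 := hch.reachTime_map (u := fun d => U ω (toEdge T d)) (A := Fo ω) φ n d
  have e2 := hch.explosionTime_map (u := fun d => U ω (toEdge T d)) (A := Fo ω) φ d
  exact Prod.ext e1 e2

theorem IsOrientedFrozenPercolation.ae_mem_Icc
    (hF : IsOrientedFrozenPercolation T P U Fo) (e : T.edgeSet) :
    ∀ᵐ ω ∂P, U ω e ∈ Set.Icc (0 : ℝ) 1 := by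
  have h : ∀ᵐ x ∂(P.map fun ω => U ω e), x ∈ Set.Icc (0 : ℝ) 1 := by
    rw [hF.activation.uniform]
    exact ae_restrict_mem measurableSet_Icc
  exact ae_of_ae_map ((measurable_pi_apply e).comp hF.activation.measurable).aemeasurable h

theorem IsOrientedFrozenPercolation.ae_freezingRule
    (hF : IsOrientedFrozenPercolation T P U Fo) (hch : IsChildMap T ch) (d : T.Dart) :
    ∀ᵐ ω ∂P, FreezingRule ch (fun d => U ω (toEdge T d)) (Fo ω) d := by
  filter_upwards [hF.freezing, hF.ae_mem_Icc (toEdge T d)] with ω h1 h2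
  exact (hch.freezingRule_iff (by linarith [h2.2])).2 (h1 d)

theorem IsOrientedFrozenPercolation.ae_explosion_eq
    (hF : IsOrientedFrozenPercolation T P U Fo) (hch : IsChildMap T ch) (d : T.Dart) :
    ∀ᵐ ω ∂P, explosion ch U Fo d ω = chi (U ω (toEdge T d))
      (min (explosion ch U Fo (ch false d) ω) (explosion ch U Fo (ch true d) ω)) := by
  filter_upwards [hF.ae_freezingRule hch d] with ω h
  exact h.explosionTime_eq

end Law
end FrozenPercolation

/-! ### The law of an explosion time is determined. -/

namespace FrozenPercolation

/-- A decreasing function `K` with `2 s K s ≤ 1`, whose decrements over `[s, t]` are at most `t`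
times those of `K ^ 2`, is equal to `min 1 (1 / (2 s))`. -/
theorem eq_of_mul_le_of_decrement_le {K : ℝ → ℝ} (hK : Antitone K)
    (h1 : ∀ s ∈ Set.Ioc (0 : ℝ) 1, 2 * s * K s ≤ 1)
    (h2 : ∀ s t, 0 < s → s < t → t ≤ 1 → K s - K t ≤ t * (K s ^ 2 - K t ^ 2))
    (h3 : ∀ s, 0 ≤ s → 1 - s ≤ K s) (h4 : ∀ s, K s ≤ 1) {t : ℝ} (ht : t ∈ Set.Ioc (0 : ℝ) 1) :
    K t = min 1 (1 / (2 * t)) := by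
  obtain ⟨ht0, ht1⟩ := ht
  have hle : K t ≤ min 1 (1 / (2 * t)) := by
    refine le_min (h4 t) ?_
    rw [le_div_iff₀ (by linarith)]
    linarith [h1 t ⟨ht0, ht1⟩]
  refine le_antisymm hle (not_lt.1 fun hlt => ?_)
  obtain ⟨hk1, hk2⟩ := lt_min_iff.1 hlt
  set k := K t with hk
  rw [lt_div_iff₀ (by linarith)] at hk2
  have hk0 : 0 ≤ k := by linarith [h3 t ht0.le]
  have htk : 2 * (t * k) < 1 := by linarith
  have htk0 : 0 ≤ t * k := by positivity
  -- This is the midpoint of 1 and `2 (1 - t k) > 1`. If `K (s / ρ) > k = K s`, dividing the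
  -- decrement bound by the difference gives `1 ≤ s (K (s / ρ) + k)`, while `h1` bounds the right
  -- side by `ρ / 2 + t k < 1`. So `K` equals `k` along `t / ρ ^ n`, against `1 - s ≤ K s` for small
  -- `s`.
  set ρ : ℝ := (1 + 2 * (1 - t * k)) / 2 with hρ
  have hρ1 : 1 < ρ := by rw [hρ]; linarith
  have step : ∀ s, 0 < s → s ≤ t → K s = k → K (s / ρ) = k := by
    intro s hs0 hst hs
    have hd : s / ρ < s := div_lt_self hs0 hρ1
    have hd0 : 0 < s / ρ := by positivity
    by_contra hne
    have hgt : k < K (s / ρ) := lt_of_le_of_ne (hs ▸ hK hd.le) (Ne.symm hne)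
    have e1 := h2 (s / ρ) s hd0 hd (hst.trans ht1)
    rw [hs] at e1
    have e2 : 1 ≤ s * (K (s / ρ) + k) := by
      by_contra hc
      nlinarith
    have e3 := h1 (s / ρ) ⟨hd0, by linarith⟩
    have e4 : 2 * s * K (s / ρ) ≤ ρ := by
      have : 2 * (s / ρ) * K (s / ρ) = 2 * s * K (s / ρ) / ρ := by ring
      rw [this, div_le_one (by linarith)] at e3
      exact e3
    have e5 : s * k ≤ t * k := mul_le_mul_of_nonneg_right hst hk0
    nlinarith
  have iter : ∀ n : ℕ, 0 < t / ρ ^ n ∧ t / ρ ^ n ≤ t ∧ K (t / ρ ^ n) = k := by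
    intro n
    induction n with
    | zero => simp [ht0, ← hk]
    | succ n ih =>
      have e : t / ρ ^ (n + 1) = t / ρ ^ n / ρ := by rw [pow_succ, div_div]
      have hlt := div_lt_self ih.1 hρ1
      rw [e]
      exact ⟨div_pos ih.1 (by linarith), hlt.le.trans ih.2.1, step _ ih.1 ih.2.1 ih.2.2⟩
  obtain ⟨n, hn⟩ := pow_unbounded_of_one_lt (t / (1 - k)) hρ1
  have e1 := (iter n).2.2
  have e2 := h3 _ (iter n).1.le
  rw [div_lt_iff₀ (by linarith)] at hn
  have hp : 0 < ρ ^ n := by positivity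
  have : t / ρ ^ n < 1 - k := by rw [div_lt_iff₀ hp]; linarith
  linarith

section Algebras

variable {V : Type*} {T : SimpleGraph V} {Ω : Type*}
  {U : Ω → T.edgeSet → ℝ} {Fo : Ω → Set T.Dart} {ch : Bool → T.Dart → T.Dart}

theorem measurableSet_lt_min_children {f : T.Dart → Ω → ℝ}
    (hf : ∀ d, Measurable[branchAlgebra U Fo d] (f d)) (d : T.Dart) (t : ℝ) :
    MeasurableSet[branchAlgebra U Fo (ch false d) ⊔ branchAlgebra U Fo (ch true d)]
      {ω | t < min (f (ch false d) ω) (f (ch true d) ω)} := by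
  have e : {ω | t < min (f (ch false d) ω) (f (ch true d) ω)} =
      {ω | t < f (ch false d) ω} ∩ {ω | t < f (ch true d) ω} := by
    ext ω; simp
  rw [e]
  exact MeasurableSet.inter
    ((le_sup_left : _ ≤ branchAlgebra U Fo (ch false d) ⊔ branchAlgebra U Fo (ch true d)) _
      (hf _ measurableSet_Ioi))
    ((le_sup_right : _ ≤ branchAlgebra U Fo (ch false d) ⊔ branchAlgebra U Fo (ch true d)) _
      (hf _ measurableSet_Ioi))

theorem reach_le_explosion (n : ℕ) (d : T.Dart) (ω : Ω) :
    reach ch U Fo n d ω ≤ explosion ch U Fo d ω := reachTime_le_explosionTime n d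

end Algebras

section Law

variable {V : Type*} {T : SimpleGraph V} {Ω : Type*} [mΩ : MeasurableSpace Ω] {P : Measure Ω}
  {U : Ω → T.edgeSet → ℝ} {Fo : Ω → Set T.Dart} {ch : Bool → T.Dart → T.Dart}

theorem IsOrientedFrozenPercolation.real_time_le
    (hF : IsOrientedFrozenPercolation T P U Fo) (e : T.edgeSet) {t : ℝ}
    (ht : t ∈ Set.Icc (0 : ℝ) 1) : P.real {ω | U ω e ≤ t} = t := by
  have h : P.map (fun ω => U ω e) (Set.Iic t) = P {ω | U ω e ≤ t} :=
    Measure.map_apply ((measurable_pi_apply e).comp hF.activation.measurable) measurableSet_Iic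
  rw [Measure.real, ← h, hF.activation.uniform, Measure.restrict_apply measurableSet_Iic]
  have : Set.Iic t ∩ Set.Icc (0 : ℝ) 1 = Set.Icc 0 t := by
    ext x; simp only [Set.mem_inter_iff, Set.mem_Iic, Set.mem_Icc]
    constructor
    · rintro ⟨a, b, c⟩; exact ⟨b, a⟩
    · rintro ⟨a, b⟩; exact ⟨b, a, b.trans ht.2⟩
  rw [this, Real.volume_Icc, sub_zero, ENNReal.toReal_ofReal ht.1]

theorem IsOrientedFrozenPercolation.real_inter_inter
    (hF : IsOrientedFrozenPercolation T P U Fo) (hT : T.IsTree) (hch : IsChildMap T ch)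
    (d : T.Dart) {t : ℝ} (ht : t ∈ Set.Icc (0 : ℝ) 1) {A : Set Ω}
    (hA : MeasurableSet[branchAlgebra U Fo (ch false d) ⊔ branchAlgebra U Fo (ch true d)] A) :
    P.real ({ω | U ω (toEdge T d) ≤ t} ∩ A) = t * P.real A := by
  have h := (Indep_iff _ _ _).1 (hF.indep_time_children hT hch d) {ω | U ω (toEdge T d) ≤ t}
    A ⟨Set.Iic t, measurableSet_Iic, rfl⟩ hA
  rw [Measure.real, h, ENNReal.toReal_mul]
  exact congrArg (· * P.real A) (hF.real_time_le (toEdge T d) ht)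

theorem IsOrientedFrozenPercolation.real_lt_explosion_eq
    (hF : IsOrientedFrozenPercolation T P U Fo) (hT : T.IsTree) (hch : IsChildMap T ch)
    (d d' : T.Dart) (t : ℝ) :
    P.real {ω | t < explosion ch U Fo d ω} = P.real {ω | t < explosion ch U Fo d' ω} := by
  have h := hF.map_reach_explosion_eq hT hch 0 d d'
  have h1 := congrArg (fun μ => μ.real {p : ℝ × ℝ | t < p.2}) h
  have hm : MeasurableSet {p : ℝ × ℝ | t < p.2} := measurableSet_lt measurable_const measurable_snd
  rwa [map_measureReal_apply ((hF.measurable_reach hch 0 d).prodMk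
    (hF.measurable_explosion hch d)) hm, map_measureReal_apply ((hF.measurable_reach hch 0 d').prodMk
    (hF.measurable_explosion hch d')) hm] at h1

theorem IsOrientedFrozenPercolation.real_lt_reach_eq
    (hF : IsOrientedFrozenPercolation T P U Fo) (hT : T.IsTree) (hch : IsChildMap T ch) (n : ℕ)
    (d d' : T.Dart) (t : ℝ) :
    P.real {ω | t < reach ch U Fo n d ω} = P.real {ω | t < reach ch U Fo n d' ω} := by
  have h := hF.map_reach_explosion_eq hT hch n d d'
  have h1 := congrArg (fun μ => μ.real {p : ℝ × ℝ | t < p.1}) h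
  have hm : MeasurableSet {p : ℝ × ℝ | t < p.1} := measurableSet_lt measurable_const measurable_fst
  rwa [map_measureReal_apply ((hF.measurable_reach hch n d).prodMk
    (hF.measurable_explosion hch d)) hm, map_measureReal_apply ((hF.measurable_reach hch n d').prodMk
    (hF.measurable_explosion hch d')) hm] at h1

theorem IsOrientedFrozenPercolation.real_inter_children
    (hF : IsOrientedFrozenPercolation T P U Fo) (hT : T.IsTree) (hch : IsChildMap T ch)
    (d : T.Dart) {f : T.Dart → Ω → ℝ} (hf : ∀ d, Measurable[branchAlgebra U Fo d] (f d))
    {t : ℝ} (heq : ∀ d d', P.real {ω | t < f d ω} = P.real {ω | t < f d' ω}) :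
    P.real {ω | t < min (f (ch false d) ω) (f (ch true d) ω)} = P.real {ω | t < f d ω} ^ 2 := by
  have h := (Indep_iff _ _ _).1 (hF.indep_children hT hch d) {ω | t < f (ch false d) ω}
    {ω | t < f (ch true d) ω} (hf _ measurableSet_Ioi) (hf _ measurableSet_Ioi)
  have e : {ω | t < min (f (ch false d) ω) (f (ch true d) ω)} =
      {ω | t < f (ch false d) ω} ∩ {ω | t < f (ch true d) ω} := by
    ext ω; simp
  rw [e, Measure.real, h, ENNReal.toReal_mul, sq]
  exact congrArg₂ (· * ·) (heq _ _) (heq _ _)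

variable [IsProbabilityMeasure P]

/-- The probability that explosion occurs after time `s`, but that there is an open path of length
`n + 1` at that time, converges to zero. -/
theorem IsOrientedFrozenPercolation.tendsto_real_reach_le
    (hF : IsOrientedFrozenPercolation T P U Fo) (hch : IsChildMap T ch) (d : T.Dart) (s : ℝ) :
    Tendsto (fun n => P.real {ω | reach ch U Fo n d ω ≤ s ∧ s < explosion ch U Fo d ω})
      atTop (nhds 0) := by
  have h0 : (⋂ n, {ω | reach ch U Fo n d ω ≤ s ∧ s < explosion ch U Fo d ω}) = ∅ := by
    refine Set.eq_empty_of_forall_notMem fun ω hω => ?_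
    have h := Set.mem_iInter.1 hω
    have h1 : explosion ch U Fo d ω ≤ s := ciSup_le fun n => (h n).1
    exact not_lt.2 h1 (h 0).2
  have hm : ∀ n, MeasurableSet {ω | reach ch U Fo n d ω ≤ s ∧ s < explosion ch U Fo d ω} :=
    fun n => (measurableSet_le (hF.measurable_reach hch n d) measurable_const).inter
      (measurableSet_lt measurable_const (hF.measurable_explosion hch d))
  have h := tendsto_measure_iInter_atTop (μ := P)
    (s := fun n => {ω | reach ch U Fo n d ω ≤ s ∧ s < explosion ch U Fo d ω})
    (fun n => (hm n).nullMeasurableSet)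
    (antitone_nat_of_succ_le fun n ω hω => ⟨(reachTime_le_succ n d).trans hω.1, hω.2⟩)
    ⟨0, measure_ne_top _ _⟩
  rw [h0, measure_empty] at h
  exact (ENNReal.tendsto_toReal ENNReal.zero_ne_top).comp h

/-- Among edges that have not exploded by time `s`, the open cluster behaves like a branching
process with mean offspring `2 s K`, and it cannot survive forever. Quantitatively, `q (n + 1) ≥ q n
(2 s K - s q n)`. If `2 s K > 1`, then `q n` is positive and stops decreasing once it is small,
contrary to `q n → 0`. -/
theorem IsOrientedFrozenPercolation.two_mul_real_lt_explosion_le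
    (hF : IsOrientedFrozenPercolation T P U Fo) (hT : T.IsTree) (hch : IsChildMap T ch)
    (d : T.Dart) {s : ℝ} (hs : s ∈ Set.Ioc (0 : ℝ) 1) :
    2 * s * P.real {ω | s < explosion ch U Fo d ω} ≤ 1 := by
  obtain ⟨hs0, hs1⟩ := hs
  set K := P.real {ω | s < explosion ch U Fo d ω} with hK
  set q : ℕ → ℝ := fun n => P.real {ω | reach ch U Fo n d ω ≤ s ∧ s < explosion ch U Fo d ω}
    with hq
  have hX := hF.real_inter_children hT hch d (f := fun d => explosion ch U Fo d) (t := s)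
    (fun d => measurable_explosion_branchAlgebra hch d)
    (fun d d' => hF.real_lt_explosion_eq hT hch d d' s)
  have hXn := fun n => hF.real_inter_children hT hch d (f := fun d => reach ch U Fo n d) (t := s)
    (fun d => measurable_reach_branchAlgebra hch n d)
    (fun d d' => hF.real_lt_reach_eq hT hch n d d' s)
  have mX := measurableSet_lt_min_children (U := U) (Fo := Fo) (ch := ch)
    (f := fun d => explosion ch U Fo d)
    (fun d => measurable_explosion_branchAlgebra hch d) d s
  have mXn := fun n => measurableSet_lt_min_children (U := U) (Fo := Fo) (ch := ch)
    (f := fun d => reach ch U Fo n d)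
    (fun d => measurable_reach_branchAlgebra hch n d) d s
  have hsup : branchAlgebra U Fo (ch false d) ⊔ branchAlgebra U Fo (ch true d) ≤ mΩ :=
    sup_le (hF.branchAlgebra_le _) (hF.branchAlgebra_le _)
  have hKn : ∀ n, P.real {ω | s < reach ch U Fo n d ω} = K - q n := by
    intro n
    have e : {ω | reach ch U Fo n d ω ≤ s ∧ s < explosion ch U Fo d ω} =
        {ω | s < explosion ch U Fo d ω} \ {ω | s < reach ch U Fo n d ω} := by
      ext ω; simp [and_comm]
    have : q n = K - P.real {ω | s < reach ch U Fo n d ω} := by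
      rw [hq]
      simp only
      rw [e, measureReal_sdiff (show {ω | s < reach ch U Fo n d ω} ⊆ {ω | s < explosion ch U Fo d ω}
          from fun ω hω => lt_of_lt_of_le hω (reach_le_explosion n d ω))
        (measurableSet_lt measurable_const (hF.measurable_reach hch n d))]
    linarith
  have hq0 : ∀ n, 0 ≤ q n := fun n => measureReal_nonneg
  have hqK : ∀ n, q n ≤ K := fun n => by
    have : 0 ≤ P.real {ω | s < reach ch U Fo n d ω} := measureReal_nonneg
    linarith [hKn n]
  have hrule := hF.ae_freezingRule hch d
  have h0 : s * K ^ 2 ≤ q 0 := by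
    rw [← hX, ← hF.real_inter_inter hT hch d ⟨hs0.le, hs1⟩ mX]
    refine ENNReal.toReal_mono (measure_ne_top _ _) (measure_mono_ae ?_)
    filter_upwards [hrule] with ω h hω
    obtain ⟨hω1, hω2⟩ := hω
    simp only [Set.mem_ofPred_eq] at hω1 hω2
    have hnot : d ∉ Fo ω := fun hd => by
      have := h.1 hd
      simp only [explosion] at hω2
      linarith
    have e := h.explosionTime_eq
    refine ⟨?_, ?_⟩
    · have : reach ch U Fo 0 d ω = min 2 (U ω (toEdge T d)) := by
        simp [reach, reachTime, hnot]
      rw [this]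
      exact (min_le_right _ _).trans hω1
    · change s < explosionTime _ _ _ _
      rw [e, chi]
      split_ifs
      · exact hω2
      · linarith
  have hsucc : ∀ n, s * (K ^ 2 - (K - q n) ^ 2) ≤ q (n + 1) := by
    intro n
    have e1 : P.real ({ω | s < min (explosion ch U Fo (ch false d) ω)
          (explosion ch U Fo (ch true d) ω)} \ {ω | s < min (reach ch U Fo n (ch false d) ω)
          (reach ch U Fo n (ch true d) ω)}) = K ^ 2 - (K - q n) ^ 2 := by
      rw [measureReal_sdiff (show {ω | s < min (reach ch U Fo n (ch false d) ω)
          (reach ch U Fo n (ch true d) ω)} ⊆ {ω | s < min (explosion ch U Fo (ch false d) ω)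
          (explosion ch U Fo (ch true d) ω)} from fun ω hω => lt_of_lt_of_le hω
        (min_le_min (reach_le_explosion n _ ω) (reach_le_explosion n _ ω)))
        (hsup _ (mXn n)), hX, hXn, hKn]
    rw [← e1, ← hF.real_inter_inter hT hch d ⟨hs0.le, hs1⟩
      (@MeasurableSet.diff _ (_) _ _ mX (mXn n))]
    refine ENNReal.toReal_mono (measure_ne_top _ _) (measure_mono_ae ?_)
    filter_upwards [hrule] with ω h hω
    obtain ⟨hω1, hω2, hω3⟩ := hω
    simp only [Set.mem_ofPred_eq, not_lt] at hω1 hω2 hω3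
    have hnot : d ∉ Fo ω := fun hd => by
      have := h.1 hd
      simp only [explosion] at hω2
      linarith
    have e := h.explosionTime_eq
    refine ⟨?_, ?_⟩
    · have : reach ch U Fo (n + 1) d ω = max (min 2 (U ω (toEdge T d)))
          (min (reach ch U Fo n (ch false d) ω) (reach ch U Fo n (ch true d) ω)) := by
        simp [reach, reachTime, hnot]
      rw [this]
      exact max_le ((min_le_right _ _).trans hω1) hω3
    · change s < explosionTime _ _ _ _
      rw [e, chi]
      split_ifs
      · exact hω2
      · linarith
  by_contra hc
  have hK0 : 0 < K := by
    by_contra hK0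
    have : s * K ≤ 0 := mul_nonpos_of_nonneg_of_nonpos hs0.le (not_lt.1 hK0)
    linarith
  have hpos : ∀ n, 0 < q n := by
    intro n
    induction n with
    | zero => exact lt_of_lt_of_le (by positivity) h0
    | succ n ih =>
      refine lt_of_lt_of_le ?_ (hsucc n)
      have : K ^ 2 - (K - q n) ^ 2 = q n * (2 * K - q n) := by ring
      rw [this]
      have : 0 < 2 * K - q n := by linarith [hqK n]
      positivity
  have ht := hF.tendsto_real_reach_le hch d s
  have hev : ∀ᶠ n in atTop, q n < 2 * s * K - 1 := ht.eventually_lt_const (by linarith)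
  obtain ⟨N, hN⟩ := eventually_atTop.1 hev
  have hmono : ∀ n ≥ N, q n ≤ q (n + 1) := by
    intro n hn
    refine le_trans ?_ (hsucc n)
    have h1 := hN n hn
    have h2 := hpos n
    have : s * (K ^ 2 - (K - q n) ^ 2) = q n * (2 * s * K - s * q n) := by ring
    rw [this]
    have : s * q n ≤ q n := by nlinarith
    nlinarith
  have hge : ∀ n ≥ N, q N ≤ q n := fun n hn =>
    Nat.le_induction le_rfl (fun m hm ih => ih.trans (hmono m hm)) n hn
  have := ge_of_tendsto ht (eventually_atTop.2 ⟨N, hge⟩)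
  linarith [hpos N]

/-- An explosion time in `(s, t]` is below 2, so it equals the minimum behind the edge, and the edge
has activated before it, hence by time `r`. Independence of the activation time gives the factor
`r`. -/
theorem IsOrientedFrozenPercolation.real_explosion_sub_le
    (hF : IsOrientedFrozenPercolation T P U Fo) (hT : T.IsTree) (hch : IsChildMap T ch)
    (d : T.Dart) {s t r : ℝ} (hst : s < t) (ht : t < 2) (hr : r ∈ Set.Icc (0 : ℝ) 1)
    (htr : t ≤ r ∨ r = 1) :
    P.real {ω | s < explosion ch U Fo d ω} - P.real {ω | t < explosion ch U Fo d ω} ≤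
      r * (P.real {ω | s < explosion ch U Fo d ω} ^ 2 -
        P.real {ω | t < explosion ch U Fo d ω} ^ 2) := by
  have hX := fun t => hF.real_inter_children hT hch d (f := fun d => explosion ch U Fo d) (t := t)
    (fun d => measurable_explosion_branchAlgebra hch d)
    (fun d d' => hF.real_lt_explosion_eq hT hch d d' t)
  have mX := measurableSet_lt_min_children (U := U) (Fo := Fo) (ch := ch)
    (f := fun d => explosion ch U Fo d)
    (fun d => measurable_explosion_branchAlgebra hch d) d
  have hsup : branchAlgebra U Fo (ch false d) ⊔ branchAlgebra U Fo (ch true d) ≤ mΩ :=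
    sup_le (hF.branchAlgebra_le _) (hF.branchAlgebra_le _)
  rw [← hX, ← hX, ← measureReal_sdiff (show {ω | t < explosion ch U Fo d ω} ⊆
      {ω | s < explosion ch U Fo d ω} from fun ω hω => hst.trans hω)
    (measurableSet_lt measurable_const (hF.measurable_explosion hch d)),
    ← measureReal_sdiff (show {ω | t < min (explosion ch U Fo (ch false d) ω)
      (explosion ch U Fo (ch true d) ω)} ⊆ {ω | s < min (explosion ch U Fo (ch false d) ω)
      (explosion ch U Fo (ch true d) ω)} from fun ω hω => hst.trans hω) (hsup _ (mX t)),
    ← hF.real_inter_inter hT hch d hr (@MeasurableSet.diff _ (_) _ _ (mX s) (mX t))]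
  refine ENNReal.toReal_mono (measure_ne_top _ _) (measure_mono_ae ?_)
  filter_upwards [hF.ae_explosion_eq hch d, hF.ae_mem_Icc (toEdge T d)] with ω h hU hω
  obtain ⟨hω1, hω2⟩ := hω
  simp only [Set.mem_ofPred_eq, not_lt] at hω1 hω2
  rw [h, chi] at hω1 hω2
  split_ifs at hω1 hω2 with hc
  · refine ⟨?_, hω1, not_lt.2 hω2⟩
    rcases htr with htr | rfl
    · exact (hc.le.trans hω2).trans htr
    · exact hU.2
  · linarith

/-- Explosion cannot precede activation; this gives the lower bound `1 - s` on the tail, which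
excludes the other functions that satisfy the two inequalities. -/
theorem IsOrientedFrozenPercolation.real_lt_explosion
    (hF : IsOrientedFrozenPercolation T P U Fo) (hT : T.IsTree) (hch : IsChildMap T ch)
    (d : T.Dart) {t : ℝ} (ht : t ∈ Set.Ioc (0 : ℝ) 1) :
    P.real {ω | t < explosion ch U Fo d ω} = min 1 (1 / (2 * t)) := by
  refine eq_of_mul_le_of_decrement_le (K := fun t => P.real {ω | t < explosion ch U Fo d ω})
    (fun s t hst => measureReal_mono fun ω hω => lt_of_le_of_lt hst hω)
    (fun s hs => hF.two_mul_real_lt_explosion_le hT hch d hs)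
    (fun s t hs hst ht => hF.real_explosion_sub_le hT hch d hst (by linarith)
      ⟨(hs.trans hst).le, ht⟩ (Or.inl le_rfl)) (fun s hs => ?_) (fun s => measureReal_le_one) ht
  rcases le_total s 1 with hs1 | hs1
  · have h1 := hF.real_time_le (toEdge T d) ⟨hs, hs1⟩
    have hm : MeasurableSet {ω | U ω (toEdge T d) ≤ s} :=
      measurableSet_le ((measurable_pi_apply _).comp hF.activation.measurable) measurable_const
    refine le_trans (b := P.real {ω | U ω (toEdge T d) ≤ s}ᶜ)
      (by rw [probReal_compl_eq_one_sub hm, h1]) ?_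
    refine ENNReal.toReal_mono (measure_ne_top _ _) (measure_mono_ae ?_)
    filter_upwards [hF.ae_explosion_eq hch d] with ω h hω
    have hω1 : s < U ω (toEdge T d) := not_le.1 hω
    change s < _
    rw [h, chi]
    split_ifs with hc
    · exact hω1.trans hc
    · linarith
  · exact le_trans (by linarith) measureReal_nonneg

theorem IsOrientedFrozenPercolation.map_explosion
    (hF : IsOrientedFrozenPercolation T P U Fo) (hT : T.IsTree) (hch : IsChildMap T ch)
    (S : ScalingProfile) (d : T.Dart) : P.map (explosion ch U Fo d) = S.nu := by
  have hmX := hF.measurable_explosion hch d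
  have : IsProbabilityMeasure (P.map (explosion ch U Fo d)) :=
    Measure.isProbabilityMeasure_map hmX.aemeasurable
  have hIic : ∀ t ∈ Set.Icc (1 / 2 : ℝ) 1,
      (P.map (explosion ch U Fo d)).real (Set.Iic t) = 1 - 1 / (2 * t) := by
    intro t ht
    have h1 := hF.real_lt_explosion hT hch d (t := t) ⟨by linarith [ht.1], ht.2⟩
    have h2 : (1 : ℝ) / (2 * t) ≤ 1 := by
      rw [div_le_one (by linarith [ht.1])]; linarith [ht.1]
    rw [min_eq_right h2] at h1
    rw [map_measureReal_apply hmX measurableSet_Iic, ← h1, ← probReal_compl_eq_one_sub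
      (measurableSet_lt measurable_const hmX)]
    congr 1
    ext ω; simp
  -- There is no mass in `(1, 2)`: with `r = 1` and tail `1/2` at time 1, a mass `x` in `(1, t]`
  -- satisfies `x ≤ x (1 - x)`.
  have hle : ∀ᵐ ω ∂P, 1 < explosion ch U Fo d ω → explosion ch U Fo d ω = 2 := by
    have hn : ∀ n : ℕ, ∀ᵐ ω ∂P, ¬ (1 < explosion ch U Fo d ω ∧
        explosion ch U Fo d ω ≤ 2 - 1 / (n + 2)) := by
      intro n
      set t : ℝ := 2 - 1 / (n + 2) with ht
      have hn0 : (0 : ℝ) ≤ n := n.cast_nonneg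
      have h0 : (0 : ℝ) < 1 / (n + 2) := by positivity
      have h1 : 1 / ((n : ℝ) + 2) < 1 := by rw [div_lt_one (by linarith)]; linarith
      have e1 := hF.real_lt_explosion hT hch d (t := 1) (by norm_num)
      have e2 := hF.real_explosion_sub_le hT hch d (s := 1) (t := t) (r := 1) (by linarith)
        (by linarith) (by norm_num) (Or.inr rfl)
      have hsub : {ω | t < explosion ch U Fo d ω} ⊆ {ω | 1 < explosion ch U Fo d ω} :=
        fun ω hω =>
          lt_trans (show 1 < t by linarith) hω
      have e3 := measureReal_sdiff (μ := P) hsub (measurableSet_lt measurable_const hmX)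
      have e4 : P.real ({ω | 1 < explosion ch U Fo d ω} \ {ω | t < explosion ch U Fo d ω}) = 0 := by
        have h5 : P.real {ω | t < explosion ch U Fo d ω} ≤ P.real {ω | 1 < explosion ch U Fo d ω} :=
          measureReal_mono hsub
        have h6 : (min 1 (1 / (2 * 1)) : ℝ) = 1 / 2 := by norm_num
        rw [e1, h6] at e2 h5 e3
        rw [e3]
        nlinarith
      have e5 := (measureReal_eq_zero_iff).1 e4
      refine (measure_eq_zero_iff_ae_notMem.1 e5).mono fun ω h hω => h ⟨hω.1, not_lt.2 hω.2⟩
    filter_upwards [ae_all_iff.2 hn] with ω h h1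
    have h2 : explosion ch U Fo d ω ≤ 2 := explosionTime_le_two d
    refine le_antisymm h2 (not_lt.1 fun h3 => ?_)
    obtain ⟨n, hn⟩ := exists_nat_one_div_lt (sub_pos.2 h3)
    refine h n ⟨h1, ?_⟩
    have : (1 : ℝ) / (n + 2) ≤ 1 / (n + 1) := by
      apply one_div_le_one_div_of_le <;> linarith [(n.cast_nonneg : (0 : ℝ) ≤ n)]
    linarith
  have hge : ∀ᵐ ω ∂P, 1 / 2 ≤ explosion ch U Fo d ω := by
    have h1 := hIic (1 / 2) (by norm_num)
    rw [map_measureReal_apply hmX measurableSet_Iic] at h1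
    have h2 := (measureReal_eq_zero_iff).1 (h1.trans (by norm_num))
    exact (measure_eq_zero_iff_ae_notMem.1 h2).mono fun ω h => (not_le.1 h).le
  have hmem : ∀ᵐ x ∂P.map (explosion ch U Fo d), x ∈ timeSet := by
    refine (ae_map_iff hmX.aemeasurable measurableSet_timeSet).2 ?_
    filter_upwards [hle, hge] with ω h1 h2
    rcases le_or_gt (explosion ch U Fo d ω) 1 with h3 | h3
    · exact Or.inl ⟨h2, h3⟩
    · exact Or.inr (h1 h3)
  have hnu : ∀ᵐ x ∂S.nu, x ∈ timeSet := S.nu_compl_timeSet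
  have : IsProbabilityMeasure S.nu := inferInstance
  refine Measure.ext_of_Iic _ _ fun a => ?_
  obtain ⟨C, hC, hC'⟩ := exists_inter_timeSet a
  have key : ∀ μ : Measure ℝ, (∀ᵐ x ∂μ, x ∈ timeSet) → μ (Set.Iic a) = μ C := by
    intro μ hμ
    refine measure_congr ?_
    filter_upwards [hμ] with x hx
    have h := Set.ext_iff.1 hC x
    simp only [Set.mem_inter_iff, hx, and_true] at h
    exact propext h
  rw [key _ hmem, key _ hnu]
  rcases hC' with rfl | rfl | ⟨s, hs, rfl⟩
  · simp
  · simp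
  · rw [S.nu_Iic_phi hs]
    have h := hIic (phi s) ⟨half_le_phi hs.1 hs.2, phi_le_one hs.2⟩
    have h2 : 1 - 1 / (2 * phi s) = s / 2 := by
      have : (2 - s) ≠ 0 := by linarith [hs.2]
      rw [phi]; field_simp; ring
    rw [h2] at h
    rw [← h, ofReal_measureReal]

end Law
end FrozenPercolation

/-! ### Finite trees with shared activation times and paired explosion times at the leaves. -/

namespace FrozenPercolation

/-- Binary trees of depth `n` whose inner nodes carry real numbers and whose leaves carry elements
of `α`. -/
def DecoratedTree (α : Type) : ℕ → Type
  | 0 => α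
  | n + 1 => ℝ × (DecoratedTree α n × DecoratedTree α n)

namespace DecoratedTree

instance instMeasurableSpace (α : Type) [m : MeasurableSpace α] :
    ∀ n, MeasurableSpace (DecoratedTree α n)
  | 0 => m
  | n + 1 => @Prod.instMeasurableSpace _ _ _ (@Prod.instMeasurableSpace _ _
      (instMeasurableSpace α n) (instMeasurableSpace α n))

/-- The law of a tree with i.i.d. uniform inner nodes and i.i.d. leaves with law `μ`. -/
noncomputable def law {α : Type} [MeasurableSpace α] (μ : Measure α) :
    ∀ n, Measure (DecoratedTree α n)
  | 0 => μ
  | n + 1 => unif.prod ((law μ n).prod (law μ n))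

instance isProbabilityMeasure_law {α : Type} [MeasurableSpace α] (μ : Measure α)
    [hμ : IsProbabilityMeasure μ] : ∀ n, IsProbabilityMeasure (law μ n)
  | 0 => hμ
  | n + 1 => by
    have := isProbabilityMeasure_law μ n
    exact inferInstanceAs (IsProbabilityMeasure (unif.prod ((law μ n).prod (law μ n))))

/-- Relabelling of the leaves. -/
def map {α β : Type} (f : α → β) : ∀ n, DecoratedTree α n → DecoratedTree β n
  | 0, x => f x
  | n + 1, p => (p.1, map f n p.2.1, map f n p.2.2)

theorem measurable_map {α β : Type} [MeasurableSpace α] [MeasurableSpace β] {f : α → β}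
    (hf : Measurable f) (n : ℕ) : Measurable (map f n) := by
  induction n with
  | zero => exact hf
  | succ n ih =>
    exact measurable_fst.prodMk ((ih.comp (measurable_fst.comp measurable_snd)).prodMk
      (ih.comp (measurable_snd.comp measurable_snd)))

theorem map_map {α β γ : Type} (f : α → β) (g : β → γ) (n : ℕ) (w : DecoratedTree α n) :
    map g n (map f n w) = map (fun x => g (f x)) n w := by
  induction n with
  | zero => rfl
  | succ n ih => exact Prod.ext rfl (Prod.ext (ih _) (ih _))

theorem law_map {α β : Type} [MeasurableSpace α] [MeasurableSpace β] {f : α → β}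
    (hf : Measurable f) (μ : Measure α) [IsProbabilityMeasure μ] (n : ℕ) :
    (law μ n).map (map f n) = law (μ.map f) n := by
  have : IsProbabilityMeasure (μ.map f) := Measure.isProbabilityMeasure_map hf.aemeasurable
  induction n with
  | zero => rfl
  | succ n ih =>
    have h := measurable_map hf n
    have e : (unif.prod ((law μ n).prod (law μ n))).map
        (Prod.map id (Prod.map (map f n) (map f n))) =
        unif.prod ((law (μ.map f) n).prod (law (μ.map f) n)) := by
      rw [← ih, Measure.map_prod_map _ _ h h,
        ← Measure.map_prod_map _ _ measurable_id (h.prodMap h), Measure.map_id]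
    exact e

/-- The value at the root of a tree whose leaves carry explosion times. -/
noncomputable def root : ∀ n, DecoratedTree ℝ n → ℝ
  | 0, x => x
  | n + 1, p => chi p.1 (min (root n p.2.1) (root n p.2.2))

theorem measurable_root (n : ℕ) : Measurable (root n) := by
  induction n with
  | zero => exact measurable_id
  | succ n ih =>
    exact measurable_chi.comp (measurable_fst.prodMk
      ((ih.comp (measurable_fst.comp measurable_snd)).min
        (ih.comp (measurable_snd.comp measurable_snd))))

/-- Both values at the root of a tree whose leaves carry pairs of explosion times. -/
noncomputable def rootPair (n : ℕ) (w : DecoratedTree (ℝ × ℝ) n) : ℝ × ℝ :=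
  (root n (map Prod.fst n w), root n (map Prod.snd n w))

theorem measurable_rootPair (n : ℕ) : Measurable (rootPair n) :=
  ((measurable_root n).comp (measurable_map measurable_fst n)).prodMk
    ((measurable_root n).comp (measurable_map measurable_snd n))

/-- The activation time at the root and both explosion times behind it. -/
noncomputable def behindRoot (n : ℕ) (w : DecoratedTree (ℝ × ℝ) (n + 1)) : ℝ × (ℝ × ℝ) :=
  (w.1, minPair (rootPair n w.2.1, rootPair n w.2.2))

theorem measurable_behindRoot (n : ℕ) : Measurable (behindRoot n) :=
  measurable_id.prodMap
    (measurable_minPair.comp ((measurable_rootPair n).prodMap (measurable_rootPair n)))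

theorem map_behindRoot_of_map_rootPair (S : ScalingProfile) (n : ℕ)
    (ih : (law S.rho n).map (rootPair n) = S.rho) :
    (law S.rho (n + 1)).map (behindRoot n) = unif.prod S.minLaw := by
  have h := measurable_rootPair n
  have e : (unif.prod ((law S.rho n).prod (law S.rho n))).map
      (Prod.map id (minPair ∘ Prod.map (rootPair n) (rootPair n))) = unif.prod S.minLaw := by
    rw [← Measure.map_prod_map _ _ measurable_id (measurable_minPair.comp (h.prodMap h)),
      ← Measure.map_map measurable_minPair (h.prodMap h), ← Measure.map_prod_map _ _ h h, ih,
      Measure.map_id]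
    rfl
  exact e

/-- Each level applies the bivariate recursion once, and `rho` is a fixed point, so the joint law at
the root is the same at every depth. -/
theorem map_rootPair (S : ScalingProfile) (n : ℕ) :
    (law S.rho n).map (rootPair n) = S.rho := by
  induction n with
  | zero => exact Measure.map_id
  | succ n ih =>
    have e : (law S.rho (n + 1)).map (chiPair ∘ behindRoot n) = S.rho := by
      rw [← Measure.map_map measurable_chiPair (measurable_behindRoot n),
        map_behindRoot_of_map_rootPair S n ih]
      exact S.stepLaw_eq_rho
    exact e

/-- The trees at whose root freezing occurs. -/
def frozen (n : ℕ) : Set (DecoratedTree ℝ (n + 1)) :=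
  {p : ℝ × (DecoratedTree ℝ n × DecoratedTree ℝ n) | min (root n p.2.1) (root n p.2.2) ≤ p.1}

theorem measurableSet_frozen (n : ℕ) : MeasurableSet (frozen n) :=
  measurableSet_le (((measurable_root n).comp (measurable_fst.comp measurable_snd)).min
        ((measurable_root n).comp (measurable_snd.comp measurable_snd))) measurable_fst

/-- Freezing at the root cannot be predicted from the activation times at the inner nodes. -/
theorem le_lintegral_frozen_sub_sq (S : ScalingProfile) (n : ℕ)
    {h : DecoratedTree Unit (n + 1) → ℝ} (hh : Measurable h) :
    (unif.prod S.minLaw) {p | p.2.1 ≤ p.1 ∧ p.1 < p.2.2} ≤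
      4 * ∫⁻ w, ENNReal.ofReal (((frozen n).indicator 1 w - h (map (fun _ => ()) (n + 1) w)) ^ 2)
        ∂(law S.nu (n + 1)) := by
  set D : Set (ℝ × (ℝ × ℝ)) := {p | p.2.1 ≤ p.1 ∧ p.1 < p.2.2} with hD
  have hDm : MeasurableSet D := (measurableSet_le (by fun_prop) measurable_fst).inter
      (measurableSet_lt measurable_fst (by fun_prop))
  set ξ : DecoratedTree ℝ (n + 1) → ENNReal := fun w =>
    ENNReal.ofReal (((frozen n).indicator 1 w - h (map (fun _ => ()) (n + 1) w)) ^ 2) with hξ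
  have hξm : Measurable ξ := by
    refine ENNReal.measurable_ofReal.comp (Measurable.pow_const (Measurable.sub ?_ ?_) 2)
    · exact measurable_const.indicator (measurableSet_frozen n)
    · exact hh.comp (measurable_map measurable_const _)
  have e1 : ∫⁻ w, ξ w ∂(law S.nu (n + 1)) =
      ∫⁻ w, ξ (map Prod.fst (n + 1) w) ∂(law S.rho (n + 1)) := by
    rw [ScalingProfile.nu, ← law_map measurable_fst, lintegral_map hξm
      (measurable_map measurable_fst _)]
  have e2 : ∫⁻ w, ξ w ∂(law S.nu (n + 1)) =
      ∫⁻ w, ξ (map Prod.snd (n + 1) w) ∂(law S.rho (n + 1)) := by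
    rw [← S.map_snd_rho, ← law_map measurable_snd, lintegral_map hξm
      (measurable_map measurable_snd _)]
  have e3 : (unif.prod S.minLaw) D =
      ∫⁻ w, (behindRoot n ⁻¹' D).indicator 1 w ∂(law S.rho (n + 1)) := by
    rw [lintegral_indicator_one (measurable_behindRoot n hDm),
      ← Measure.map_apply (measurable_behindRoot n) hDm,
      map_behindRoot_of_map_rootPair S n (map_rootPair S n)]
  have e4 : (4 : ENNReal) * ∫⁻ w, ξ w ∂(law S.nu (n + 1)) =
      ∫⁻ w, 2 * (ξ (map Prod.fst (n + 1) w) + ξ (map Prod.snd (n + 1) w)) ∂(law S.rho (n + 1)) := by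
    have m1 : Measurable fun w : DecoratedTree (ℝ × ℝ) (n + 1) => ξ (map Prod.fst (n + 1) w) :=
      hξm.comp (measurable_map measurable_fst (n + 1))
    have m2 : Measurable fun w : DecoratedTree (ℝ × ℝ) (n + 1) => ξ (map Prod.snd (n + 1) w) :=
      hξm.comp (measurable_map measurable_snd (n + 1))
    have m3 : Measurable fun w : DecoratedTree (ℝ × ℝ) (n + 1) =>
      ξ (map Prod.fst (n + 1) w) + ξ (map Prod.snd (n + 1) w) := m1.add m2
    rw [lintegral_const_mul _ m3, lintegral_add_left m1, ← e1, ← e2]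
    ring
  rw [e3, e4]
  refine lintegral_mono fun w => ?_
  by_cases hw : w ∈ behindRoot n ⁻¹' D
  · rw [Set.indicator_of_mem hw]
    have h1 : map Prod.fst (n + 1) w ∈ frozen n := hw.1
    have h2 : map Prod.snd (n + 1) w ∉ frozen n := not_le.2 hw.2
    -- The two versions share their activation times, so the predictor `h` takes the same value `y`
    -- on both. Only one of them freezes, and `(1 - y) ^ 2 + y ^ 2 ≥ 1 / 2`; this factor 2 and the
    -- sum over two equal marginals account for the constant 4.
    have h3 : map (fun _ => ()) (n + 1) (map Prod.fst (n + 1) w) =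
      map (fun _ => ()) (n + 1) (map Prod.snd (n + 1) w) := by rw [map_map, map_map]
    simp only [hξ, Set.indicator_of_mem h1, Set.indicator_of_notMem h2, h3, Pi.one_apply]
    set y := h (map (fun _ => ()) (n + 1) (map Prod.snd (n + 1) w))
    rw [← ENNReal.ofReal_add (sq_nonneg _) (sq_nonneg _), ← ENNReal.ofReal_ofNat 2,
      ← ENNReal.ofReal_mul (by norm_num), ← ENNReal.ofReal_one]
    refine ENNReal.ofReal_le_ofReal ?_
    nlinarith [sq_nonneg (2 * y - 1)]
  · rw [Set.indicator_of_notMem hw]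
    exact zero_le

end DecoratedTree
end FrozenPercolation

namespace FrozenPercolation

/-! ### Freezing is not determined by the activation times of the branch. -/

section Tree

variable {V : Type*} {T : SimpleGraph V} {Ω : Type*}
  {U : Ω → T.edgeSet → ℝ} {Fo : Ω → Set T.Dart} {ch : Bool → T.Dart → T.Dart}

/-- The first `n` generations of the branch that starts with `d`: inner nodes carry activation
times, and leaves carry the values of `x`. -/
def branchTree {α : Type} (ch : Bool → T.Dart → T.Dart) (U : Ω → T.edgeSet → ℝ)
    (x : T.Dart → Ω → α) : ∀ n, T.Dart → Ω → DecoratedTree α n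
  | 0, d, ω => x d ω
  | n + 1, d, ω => (U ω (toEdge T d), branchTree ch U x n (ch false d) ω,
      branchTree ch U x n (ch true d) ω)

theorem map_branchTree {α β : Type} (f : α → β) (x : T.Dart → Ω → α) (n : ℕ) (d : T.Dart) (ω : Ω) :
    DecoratedTree.map f n (branchTree ch U x n d ω) =
      branchTree ch U (fun d ω => f (x d ω)) n d ω := by
  induction n generalizing d with
  | zero => rfl
  | succ n ih => exact Prod.ext rfl (Prod.ext (ih _) (ih _))

theorem measurable_branchTree {α : Type} [MeasurableSpace α] (hch : IsChildMap T ch)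
    {x : T.Dart → Ω → α} (hx : ∀ d, Measurable[branchAlgebra U Fo d] (x d)) (n : ℕ) (d : T.Dart) :
    Measurable[branchAlgebra U Fo d] (branchTree ch U x n d) := by
  induction n generalizing d with
  | zero => exact hx d
  | succ n ih =>
    have h := fun b => (ih (ch b d)).mono (branchAlgebra_child_le (U := U) (Fo := Fo) hch b d) le_rfl
    let := branchAlgebra U Fo d
    exact (measurable_time_branchAlgebra hch d).prodMk ((h false).prodMk (h true))

/-- The σ-algebra generated by the activation times in the first `n` generations of the branch that
starts with `d`. -/
@[reducible] def generationAlgebra (ch : Bool → T.Dart → T.Dart) (U : Ω → T.edgeSet → ℝ) (n : ℕ)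
    (d : T.Dart) : MeasurableSpace Ω :=
  MeasurableSpace.comap (branchTree ch U (fun _ _ => ()) n d) inferInstance

theorem generationAlgebra_succ (n : ℕ) (d : T.Dart) : generationAlgebra ch U (n + 1) d =
    MeasurableSpace.comap (fun ω => U ω (toEdge T d)) inferInstance ⊔
      (generationAlgebra ch U n (ch false d) ⊔ generationAlgebra ch U n (ch true d)) := by
  unfold generationAlgebra
  rw [← MeasurableSpace.comap_prodMk, ← MeasurableSpace.comap_prodMk]
  rfl

theorem generationAlgebra_le_succ (n : ℕ) (d : T.Dart) :
    generationAlgebra ch U n d ≤ generationAlgebra ch U (n + 1) d := by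
  induction n generalizing d with
  | zero =>
    have : Measurable[generationAlgebra ch U 1 d] fun _ : Ω => () := measurable_const
    exact this.comap_le
  | succ n ih =>
    rw [generationAlgebra_succ n, generationAlgebra_succ (n + 1)]
    exact sup_le_sup_left (sup_le_sup (ih _) (ih _)) _

theorem generationAlgebra_le (hch : IsChildMap T ch) (n : ℕ) (d : T.Dart) :
    generationAlgebra ch U n d ≤ timeAlgebra U d := by
  induction n generalizing d with
  | zero =>
    have : Measurable[timeAlgebra U d] fun _ : Ω => () := measurable_const
    exact this.comap_le
  | succ n ih =>
    rw [generationAlgebra_succ]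
    exact sup_le (measurable_time_timeAlgebra hch d).comap_le
      (sup_le ((ih _).trans (timeAlgebra_child_le hch _ d))
        ((ih _).trans (timeAlgebra_child_le hch _ d)))

theorem measurable_time_addr_generationAlgebra (d : T.Dart) (l : List Bool) :
    Measurable[generationAlgebra ch U (l.length + 1) d] fun ω => U ω (toEdge T (addr ch d l)) := by
  rw [measurable_iff_comap_le]
  induction l generalizing d with
  | nil =>
    rw [generationAlgebra_succ]
    exact le_sup_left
  | cons b l ih =>
    rw [List.length_cons, generationAlgebra_succ, addr_cons]
    refine (ih (ch b d)).trans (le_trans ?_ le_sup_right)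
    cases b
    · exact le_sup_left
    · exact le_sup_right

/-- Every edge of the branch occurs in some generation; this lets Lévy's upward theorem reach the
whole branch. -/
theorem iSup_generationAlgebra (hch : IsChildMap T ch) (d : T.Dart) :
    ⨆ n, generationAlgebra ch U (n + 1) d = timeAlgebra U d := by
  refine le_antisymm (iSup_le fun n => generationAlgebra_le hch (n + 1) d) ?_
  let := ⨆ n, generationAlgebra ch U (n + 1) d
  rw [← measurable_iff_comap_le]
  refine measurable_pi_lambda _ fun e => ?_
  obtain ⟨e, d', hd', rfl⟩ := e
  rw [hch.dartsFrom_eq] at hd'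
  obtain ⟨l, rfl⟩ := hd'
  exact (measurable_time_addr_generationAlgebra (U := U) d l).mono
    (le_iSup (fun n => generationAlgebra ch U (n + 1) d) l.length) le_rfl

end Tree

section CondExp

variable {Ω : Type*} {mΩ : MeasurableSpace Ω} {P : Measure Ω} [IsProbabilityMeasure P]

theorem condExp_indicator_mem_Icc {m : MeasurableSpace Ω} (hm : m ≤ mΩ) {s : Set Ω}
    (hs : MeasurableSet[mΩ] s) : ∀ᵐ ω ∂P, (P⟦s | m⟧) ω ∈ Set.Icc (0 : ℝ) 1 := by
  have hi : Integrable (s.indicator fun _ => (1 : ℝ)) P := (integrable_const 1).indicator hs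
  have h0 := condExp_mono (m := m) (integrable_zero Ω ℝ P) hi
    (ae_of_all _ fun ω => Set.indicator_nonneg (fun _ _ => zero_le_one) ω)
  have h1 := condExp_mono (m := m) hi (integrable_const (1 : ℝ))
    (ae_of_all _ fun ω => Set.indicator_le_self' (fun _ _ => zero_le_one) ω)
  rw [condExp_zero] at h0
  rw [condExp_const hm] at h1
  filter_upwards [h0, h1] with ω h0 h1
  exact ⟨h0, h1⟩

end CondExp

section Law

variable {V : Type*} {T : SimpleGraph V} {Ω : Type*} [mΩ : MeasurableSpace Ω] {P : Measure Ω}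
  {U : Ω → T.edgeSet → ℝ} {Fo : Ω → Set T.Dart} {ch : Bool → T.Dart → T.Dart}

theorem IsOrientedFrozenPercolation.ae_root_branchTree
    (hF : IsOrientedFrozenPercolation T P U Fo) (hch : IsChildMap T ch) (n : ℕ) (d : T.Dart) :
    ∀ᵐ ω ∂P, DecoratedTree.root n (branchTree ch U (explosion ch U Fo) n d ω) =
      explosion ch U Fo d ω := by
  induction n generalizing d with
  | zero => exact ae_of_all _ fun ω => rfl
  | succ n ih =>
    filter_upwards [hF.ae_explosion_eq hch d, ih (ch false d), ih (ch true d)] with ω h h0 h1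
    rw [h, ← h0, ← h1]
    rfl

theorem IsOrientedFrozenPercolation.ae_branchTree_mem_frozen
    (hF : IsOrientedFrozenPercolation T P U Fo) (hch : IsChildMap T ch) (n : ℕ) (d : T.Dart) :
    ∀ᵐ ω ∂P, branchTree ch U (explosion ch U Fo) (n + 1) d ω ∈ DecoratedTree.frozen n ↔
      d ∈ Fo ω := by
  filter_upwards [hF.ae_freezingRule hch d, hF.ae_root_branchTree hch n (ch false d),
    hF.ae_root_branchTree hch n (ch true d)] with ω h h0 h1
  refine Iff.trans ?_ h.symm
  simp only [explosion] at h0 h1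
  rw [← h0, ← h1]
  rfl

theorem IsOrientedFrozenPercolation.timeAlgebra_le
    (hF : IsOrientedFrozenPercolation T P U Fo) (d : T.Dart) : timeAlgebra U d ≤ mΩ :=
  (timeAlgebra_le_branchAlgebra d).trans (hF.branchAlgebra_le d)

theorem IsOrientedFrozenPercolation.measurableSet_mem
    (hF : IsOrientedFrozenPercolation T P U Fo) (d : T.Dart) : MeasurableSet {ω | d ∈ Fo ω} :=
  measurableSet_setOfPred.2 ((measurable_set_mem d).comp hF.measurable)

variable [IsProbabilityMeasure P]

/-- The given process is identified with the i.i.d. model. Since `nu` is each marginal of `rho`,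
bounds obtained from the coupled pairs apply to it without a second process on `Ω`. -/
theorem IsOrientedFrozenPercolation.map_branchTree
    (hF : IsOrientedFrozenPercolation T P U Fo) (hT : T.IsTree) (hch : IsChildMap T ch)
    (S : ScalingProfile) (n : ℕ) (d : T.Dart) :
    P.map (branchTree ch U (explosion ch U Fo) n d) = DecoratedTree.law S.nu n := by
  induction n generalizing d with
  | zero => exact hF.map_explosion hT hch S d
  | succ n ih =>
    have h := hF.map_children hT hch d
      (measurable_branchTree hch (measurable_explosion_branchAlgebra hch) n (ch false d))
      (measurable_branchTree hch (measurable_explosion_branchAlgebra hch) n (ch true d))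
    rw [ih, ih] at h
    exact h

/-- Freezing of an oriented edge cannot be predicted from finitely many generations of activation
times. -/
theorem IsOrientedFrozenPercolation.le_lintegral_sub_condExp_generation
    (hF : IsOrientedFrozenPercolation T P U Fo) (hT : T.IsTree) (hch : IsChildMap T ch)
    (S : ScalingProfile) (n : ℕ) (d : T.Dart) :
    (unif.prod S.minLaw) {p | p.2.1 ≤ p.1 ∧ p.1 < p.2.2} ≤
      4 * ∫⁻ ω, ENNReal.ofReal (({ω | d ∈ Fo ω}.indicator (fun _ => (1 : ℝ)) ω -
        (P⟦{ω | d ∈ Fo ω} | generationAlgebra ch U (n + 1) d⟧) ω) ^ 2) ∂P := by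
  obtain ⟨h, hh, heq⟩ := (stronglyMeasurable_condExp (μ := P)
    (m := generationAlgebra ch U (n + 1) d)
    (f := {ω | d ∈ Fo ω}.indicator (fun _ => (1 : ℝ)))).exists_eq_measurable_comp
  refine (DecoratedTree.le_lintegral_frozen_sub_sq S n hh.measurable).trans (le_of_eq ?_)
  have hm : Measurable (branchTree ch U (explosion ch U Fo) (n + 1) d) :=
    (measurable_branchTree hch (measurable_explosion_branchAlgebra hch) (n + 1) d).mono
      (hF.branchAlgebra_le d) le_rfl
  rw [← hF.map_branchTree hT hch S (n + 1) d, lintegral_map _ hm]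
  · congr 1
    refine lintegral_congr_ae ?_
    filter_upwards [hF.ae_branchTree_mem_frozen hch n d] with ω hω
    rw [heq, FrozenPercolation.map_branchTree]
    have : (DecoratedTree.frozen n).indicator (1 : DecoratedTree ℝ (n + 1) → ℝ)
        (branchTree ch U (explosion ch U Fo) (n + 1) d ω) =
        {ω | d ∈ Fo ω}.indicator (fun _ => (1 : ℝ)) ω := by
      by_cases hd : d ∈ Fo ω
      · rw [Set.indicator_of_mem (hω.2 hd), Set.indicator_of_mem (by exact hd)]; rfl
      · rw [Set.indicator_of_notMem (mt hω.1 hd), Set.indicator_of_notMem (by exact hd)]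
    rw [this]
    rfl
  · refine ENNReal.measurable_ofReal.comp (Measurable.pow_const (Measurable.sub ?_ ?_) 2)
    · exact measurable_const.indicator (DecoratedTree.measurableSet_frozen n)
    · exact hh.measurable.comp (DecoratedTree.measurable_map measurable_const _)

/-- Freezing of an oriented edge cannot be predicted from the activation times in its branch. -/
theorem IsOrientedFrozenPercolation.exists_le_integral_sub_condExp
    (hF : IsOrientedFrozenPercolation T P U Fo) (hT : T.IsTree) (hch : IsChildMap T ch) :
    ∃ δ > 0, ∀ d, δ ≤ ∫ ω, ({ω | d ∈ Fo ω}.indicator (fun _ => (1 : ℝ)) ω -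
        (P⟦{ω | d ∈ Fo ω} | timeAlgebra U d⟧) ω) ^ 2 ∂P := by
  obtain ⟨S⟩ := nonempty_scalingProfile
  set D := (unif.prod S.minLaw).real {p | p.2.1 ≤ p.1 ∧ p.1 < p.2.2} with hD
  have hD0 : 0 < D := ENNReal.toReal_pos S.disagreement_pos.ne' (measure_ne_top _ _)
  refine ⟨D / 4, by positivity, fun d => ?_⟩
  set f : Ω → ℝ := {ω | d ∈ Fo ω}.indicator fun _ => (1 : ℝ) with hf
  have hgen : ∀ n, generationAlgebra ch U (n + 1) d ≤ mΩ :=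
    fun n => (generationAlgebra_le hch (n + 1) d).trans (hF.timeAlgebra_le d)
  let ℱ : Filtration ℕ mΩ :=
    { seq := fun n => generationAlgebra ch U (n + 1) d
      mono' := monotone_nat_of_le_succ fun n => generationAlgebra_le_succ (n + 1) d
      le' := hgen }
  -- Lévy's upward theorem: the squared errors are at most 1, so their lower bound, which is uniform
  -- in the generation, passes to the limit.
  have hlim := tendsto_ae_condExp (μ := P) (ℱ := ℱ) f
  have hsup : ⨆ n, ℱ n = timeAlgebra U d := iSup_generationAlgebra hch d
  rw [hsup] at hlim
  have hfI : ∀ ω, f ω ∈ Set.Icc (0 : ℝ) 1 := fun ω => by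
    by_cases h : d ∈ Fo ω <;> simp [hf, h]
  have hfm : Measurable f := measurable_const.indicator (hF.measurableSet_mem d)
  have hbd : ∀ n, ∀ᵐ ω ∂P, ‖(f ω - (P[f | ℱ n]) ω) ^ 2‖ ≤ 1 := fun n => by
    filter_upwards [condExp_indicator_mem_Icc (P := P) (hgen n) (hF.measurableSet_mem d)] with ω h
    rw [Real.norm_eq_abs, abs_of_nonneg (sq_nonneg _)]
    have h1 := hfI ω
    exact (sq_le_one_iff_abs_le_one _).2 (abs_le.2 ⟨by linarith [h1.1, h.2], by linarith [h1.2, h.1]⟩)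
  have hms : ∀ n, AEStronglyMeasurable (fun ω => (f ω - (P[f | ℱ n]) ω) ^ 2) P := fun n =>
    (hfm.aestronglyMeasurable.sub
      (stronglyMeasurable_condExp.mono (hgen n)).aestronglyMeasurable).pow 2
  have ht := tendsto_integral_of_dominated_convergence (μ := P)
    (F := fun n ω => (f ω - (P[f | ℱ n]) ω) ^ 2)
    (f := fun ω => (f ω - (P[f | timeAlgebra U d]) ω) ^ 2) (fun _ => 1) hms
    (integrable_const 1) hbd
    (hlim.mono fun ω h => (tendsto_const_nhds.sub h).pow 2)
  refine ge_of_tendsto' ht fun n => ?_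
  have h1 := hF.le_lintegral_sub_condExp_generation hT hch S n d
  have hint : Integrable (fun ω => (f ω - (P[f | ℱ n]) ω) ^ 2) P :=
    (integrable_const (1 : ℝ)).mono' (hms n) (hbd n)
  have h2 := ofReal_integral_eq_lintegral_ofReal hint (ae_of_all _ fun ω => sq_nonneg _)
  have h3 := h1.trans_eq (congrArg (4 * ·) h2.symm)
  have h4 := ENNReal.toReal_mono (by finiteness) h3
  rw [ENNReal.toReal_mul, ENNReal.toReal_ofReal (integral_nonneg fun ω => sq_nonneg _)] at h4
  have h5 : D ≤ 4 * ∫ ω, (f ω - (P[f | ℱ n]) ω) ^ 2 ∂P := by simpa [hD, Measure.real] using h4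
  linarith

end Law
end FrozenPercolation

namespace FrozenPercolation

/-! ### Conditional probabilities, independent σ-algebras and conditionally independent copies. -/

section CondExp

variable {Ω : Type*} {mΩ : MeasurableSpace Ω} {P : Measure Ω}

/-- Integrals over events that are measurable with respect to a pair of random variables are
determined by those over rectangular events. -/
theorem setIntegral_eq_of_rectangles {α β : Type*} {mα : MeasurableSpace α} {mβ : MeasurableSpace β}
    {X : Ω → α} {Y : Ω → β} (hX : Measurable X) (hY : Measurable Y) {f g : Ω → ℝ}
    (hf : Integrable f P) (hg : Integrable g P)
    (h : ∀ s t, MeasurableSet s → MeasurableSet t →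
      ∫ ω in X ⁻¹' s ∩ Y ⁻¹' t, f ω ∂P = ∫ ω in X ⁻¹' s ∩ Y ⁻¹' t, g ω ∂P)
    {A : Set (α × β)} (hA : MeasurableSet A) :
    ∫ ω in (fun ω => (X ω, Y ω)) ⁻¹' A, f ω ∂P = ∫ ω in (fun ω => (X ω, Y ω)) ⁻¹' A, g ω ∂P := by
  have hXY : Measurable fun ω => (X ω, Y ω) := hX.prodMk hY
  induction A, hA using MeasurableSpace.induction_on_inter generateFrom_prod.symm isPiSystem_prod with
  | empty => simp
  | basic A hA =>
    obtain ⟨s, hs, t, ht, rfl⟩ := hA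
    exact h s t hs ht
  | compl A hA ih =>
    have h0 := h Set.univ Set.univ MeasurableSet.univ MeasurableSet.univ
    simp only [Set.preimage_univ, Set.inter_univ, Measure.restrict_univ] at h0
    have h1 := integral_add_compl (hXY hA) hf
    have h2 := integral_add_compl (hXY hA) hg
    rw [Set.preimage_compl]
    linarith
  | iUnion A hd hA ih =>
    have hd' : Pairwise (Function.onFun Disjoint fun n => (fun ω => (X ω, Y ω)) ⁻¹' A n) :=
      fun i j hij => (hd hij).preimage _
    rw [Set.preimage_iUnion, integral_iUnion (fun n => hXY (hA n)) hd' hf.integrableOn,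
      integral_iUnion (fun n => hXY (hA n)) hd' hg.integrableOn]
    exact tsum_congr ih

theorem setIntegral_indicator_one {s t : Set Ω} (hs : MeasurableSet s) :
    ∫ ω in t, s.indicator (fun _ => (1 : ℝ)) ω ∂P = P.real (t ∩ s) := by
  rw [setIntegral_indicator hs, setIntegral_const, smul_eq_mul, mul_one]

variable [IsProbabilityMeasure P]

theorem integrable_indicator_one {s : Set Ω} (hs : MeasurableSet s) :
    Integrable (s.indicator fun _ => (1 : ℝ)) P :=
  (integrable_const 1).indicator hs

theorem setIntegral_condExp_indicator {m : MeasurableSpace Ω} (hm : m ≤ mΩ) {s t : Set Ω}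
    (hs : MeasurableSet[mΩ] s) (ht : MeasurableSet[m] t) :
    ∫ ω in t, (P⟦s | m⟧) ω ∂P = P.real (t ∩ s) := by
  rw [setIntegral_condExp hm (integrable_indicator_one hs) ht, setIntegral_indicator_one hs]

theorem integrable_mul_condExp_indicator {m : MeasurableSpace Ω} (hm : m ≤ mΩ) {s : Set Ω}
    (hs : MeasurableSet[mΩ] s) {f : Ω → ℝ} (hf : Integrable f P) :
    Integrable (fun ω => f ω * (P⟦s | m⟧) ω) P := by
  refine hf.mul_bdd (c := 1) (stronglyMeasurable_condExp.mono hm).aestronglyMeasurable ?_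
  filter_upwards [condExp_indicator_mem_Icc hm hs] with ω h
  rw [Real.norm_eq_abs, abs_of_nonneg h.1]
  exact h.2

theorem setIntegral_inter_condExp {m : MeasurableSpace Ω} (hm : m ≤ mΩ) {s s' t : Set Ω}
    (hs : MeasurableSet[mΩ] s) (hs' : MeasurableSet[mΩ] s') (ht : MeasurableSet[m] t) :
    ∫ ω in t ∩ s, (P⟦s' | m⟧) ω ∂P = ∫ ω in t, (P⟦s | m⟧) ω * (P⟦s' | m⟧) ω ∂P := by
  have hi : Integrable ((s.indicator fun _ => (1 : ℝ)) * P⟦s' | m⟧) P :=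
    integrable_mul_condExp_indicator hm hs' (integrable_indicator_one hs)
  have h1 := condExp_mul_of_stronglyMeasurable_right (m := m) stronglyMeasurable_condExp hi
    (integrable_indicator_one hs)
  have h2 := setIntegral_congr_ae (hm t ht) (h1.mono fun ω h _ => h)
  rw [setIntegral_condExp hm hi ht] at h2
  refine Eq.trans ?_ h2
  rw [← setIntegral_indicator hs]
  congr 1
  funext ω
  by_cases h : ω ∈ s <;> simp [h]

/-- Conditioning on a join of sub-σ-algebras of independent σ-algebras. -/
theorem condExp_inter_sup {m₁ m₂ a₁ a₂ : MeasurableSpace Ω} (h₁ : m₁ ≤ mΩ) (h₂ : m₂ ≤ mΩ)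
    (ha₁ : a₁ ≤ m₁) (ha₂ : a₂ ≤ m₂) (hind : Indep m₁ m₂ P) {s₁ s₂ : Set Ω}
    (hs₁ : MeasurableSet[m₁] s₁) (hs₂ : MeasurableSet[m₂] s₂) :
    P⟦s₁ ∩ s₂ | a₁ ⊔ a₂⟧ =ᵐ[P] fun ω => (P⟦s₁ | a₁⟧) ω * (P⟦s₂ | a₂⟧) ω := by
  have hs : MeasurableSet[mΩ] (s₁ ∩ s₂) := (h₁ _ hs₁).inter (h₂ _ hs₂)
  have hsup : a₁ ⊔ a₂ ≤ mΩ := sup_le (ha₁.trans h₁) (ha₂.trans h₂)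
  have hint : Integrable (fun ω => (P⟦s₁ | a₁⟧) ω * (P⟦s₂ | a₂⟧) ω) P :=
    integrable_mul_condExp_indicator (ha₂.trans h₂) (h₂ _ hs₂) integrable_condExp
  refine (ae_eq_condExp_of_forall_setIntegral_eq hsup (integrable_indicator_one hs)
    (fun _ _ _ => hint.integrableOn) ?_ ?_).symm
  · intro t ht _
    -- The join is the pullback of the product σ-algebra under the diagonal map, so testing on
    -- intersections of an event of `a₁` with an event of `a₂` is enough.
    have hsup' : a₁ ⊔ a₂ = MeasurableSpace.comap (fun ω : Ω => (ω, ω)) (a₁.prod a₂) := by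
      refine (MeasurableSpace.comap_prodMk (fun ω : Ω => ω) (fun ω : Ω => ω)).symm ▸ ?_
      exact congrArg₂ (· ⊔ ·) MeasurableSpace.comap_id.symm MeasurableSpace.comap_id.symm
    rw [hsup'] at ht
    obtain ⟨A, hA, rfl⟩ := ht
    refine setIntegral_eq_of_rectangles (mα := a₁) (mβ := a₂) (X := fun ω => ω) (Y := fun ω => ω)
      (measurable_id'' (ha₁.trans h₁)) (measurable_id'' (ha₂.trans h₂)) hint
      (integrable_indicator_one hs) ?_ hA
    intro t₁ t₂ ht₁ ht₂
    simp only [Set.preimage_id']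
    have m1 := h₁ _ (ha₁ _ ht₁)
    have m2 := h₂ _ (ha₂ _ ht₂)
    have hm1 : Measurable[m₁] (t₁.indicator (P⟦s₁ | a₁⟧)) :=
      (stronglyMeasurable_condExp.measurable.mono ha₁ le_rfl).indicator (ha₁ _ ht₁)
    have hm2 : Measurable[m₂] (t₂.indicator (P⟦s₂ | a₂⟧)) :=
      (stronglyMeasurable_condExp.measurable.mono ha₂ le_rfl).indicator (ha₂ _ ht₂)
    have hi : IndepFun (t₁.indicator (P⟦s₁ | a₁⟧)) (t₂.indicator (P⟦s₂ | a₂⟧)) P :=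
      indep_of_indep_of_le_left (indep_of_indep_of_le_right hind hm2.comap_le) hm1.comap_le
    have e := hi.integral_fun_mul_eq_mul_integral
      (hm1.mono h₁ le_rfl).aestronglyMeasurable (hm2.mono h₂ le_rfl).aestronglyMeasurable
    rw [integral_indicator m1, integral_indicator m2,
      setIntegral_condExp_indicator (ha₁.trans h₁) (h₁ _ hs₁) ht₁,
      setIntegral_condExp_indicator (ha₂.trans h₂) (h₂ _ hs₂) ht₂] at e
    rw [setIntegral_indicator_one hs, Set.inter_inter_inter_comm, Measure.real,
      (Indep_iff _ _ _).1 hind _ _ (@MeasurableSet.inter _ m₁ _ _ (ha₁ _ ht₁) hs₁)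
      (@MeasurableSet.inter _ m₂ _ _ (ha₂ _ ht₂) hs₂), ENNReal.toReal_mul]
    refine Eq.trans ?_ e
    rw [← integral_indicator (m1.inter m2)]
    congr 1
    funext ω
    by_cases h1 : ω ∈ t₁ <;> by_cases h2 : ω ∈ t₂ <;> simp [h1, h2]
  · exact ((stronglyMeasurable_condExp.mono le_sup_left).mul
      (stronglyMeasurable_condExp.mono le_sup_right)).aestronglyMeasurable

theorem condExp_sup_of_indep {m₁ m₂ a₁ a₂ : MeasurableSpace Ω} (h₁ : m₁ ≤ mΩ) (h₂ : m₂ ≤ mΩ)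
    (ha₁ : a₁ ≤ m₁) (ha₂ : a₂ ≤ m₂) (hind : Indep m₁ m₂ P) {s : Set Ω}
    (hs : MeasurableSet[m₁] s) : P⟦s | a₁ ⊔ a₂⟧ =ᵐ[P] P⟦s | a₁⟧ := by
  have h := condExp_inter_sup h₁ h₂ ha₁ ha₂ hind hs (@MeasurableSet.univ _ m₂)
  rw [Set.inter_univ] at h
  refine h.trans (ae_of_all _ fun ω => ?_)
  have : (Set.univ : Set Ω).indicator (fun _ => (1 : ℝ)) = fun _ => 1 := by simp
  simp only [this, condExp_const (ha₂.trans h₂), mul_one]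

/-- A conditionally independent copy remains one when both variables are paired with the variable
on which one conditions. -/
theorem IsCondIndepCopy.measureReal_inter {α β : Type*} [mα : MeasurableSpace α]
    [MeasurableSpace β] {Z : Ω → α} {X Y : Ω → β} (h : IsCondIndepCopy P Z X Y)
    (hZ : Measurable Z) (hX : Measurable X) {A : Set (α × β)} (hA : MeasurableSet A) :
    P.real ((fun ω => (Z ω, X ω)) ⁻¹' A ∩ (fun ω => (Z ω, Y ω)) ⁻¹' A) =
      ∫ ω, (P⟦(fun ω => (Z ω, X ω)) ⁻¹' A | MeasurableSpace.comap Z inferInstance⟧) ω ^ 2 ∂P := by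
  have hY := h.measurable
  have hci := h.condIndep
  have hidm := fun {s} hs => h.identDistrib.measure_mem_eq (s := s) hs
  have hZX : Measurable fun ω => (Z ω, X ω) := hZ.prodMk hX
  have hZY : Measurable fun ω => (Z ω, Y ω) := hZ.prodMk hY
  set m : MeasurableSpace Ω := MeasurableSpace.comap Z inferInstance with hm_def
  have hm : m ≤ mΩ := hZ.comap_le
  -- The conditional independence of `X` and `Y` is extended one variable at a time: here from
  -- events of `X` to events of `(Z, X)`, and in `step2` from events of `Y` to events of `(Z, Y)`.
  -- Equality of the joint laws then identifies the two conditional probabilities.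
  have step1 : ∀ B : Set β, MeasurableSet B → ∀ A : Set (α × β), MeasurableSet A →
      P.real ((fun ω => (Z ω, X ω)) ⁻¹' A ∩ Y ⁻¹' B) =
        ∫ ω in (fun ω => (Z ω, X ω)) ⁻¹' A, (P⟦Y ⁻¹' B | m⟧) ω ∂P := by
    intro B hB A hA
    rw [← setIntegral_indicator_one (hY hB)]
    refine setIntegral_eq_of_rectangles hZ hX (integrable_indicator_one (hY hB))
      integrable_condExp ?_ hA
    intro C B' hC hB'
    have hC' : MeasurableSet[m] (Z ⁻¹' C) := ⟨C, hC, rfl⟩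
    rw [setIntegral_inter_condExp hm (hX hB') (hY hB) hC', setIntegral_indicator_one (hY hB),
      Set.inter_assoc, ← setIntegral_condExp_indicator hm ((hX hB').inter (hY hB)) hC']
    exact setIntegral_congr_ae (hm _ hC') ((hci B' B hB' hB).mono fun ω hω _ => hω)
  have step2 : ∀ A A' : Set (α × β), MeasurableSet A → MeasurableSet A' →
      P.real ((fun ω => (Z ω, Y ω)) ⁻¹' A' ∩ (fun ω => (Z ω, X ω)) ⁻¹' A) =
        ∫ ω in (fun ω => (Z ω, Y ω)) ⁻¹' A', (P⟦(fun ω => (Z ω, X ω)) ⁻¹' A | m⟧) ω ∂P := by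
    intro A A' hA hA'
    rw [← setIntegral_indicator_one (hZX hA)]
    refine setIntegral_eq_of_rectangles hZ hY (integrable_indicator_one (hZX hA))
      integrable_condExp ?_ hA'
    intro C B hC hB
    have hC' : MeasurableSet[m] (Z ⁻¹' C) := ⟨C, hC, rfl⟩
    have e := step1 B hB ((C ×ˢ Set.univ) ∩ A) ((hC.prod MeasurableSet.univ).inter hA)
    have e1 : (fun ω => (Z ω, X ω)) ⁻¹' ((C ×ˢ Set.univ) ∩ A) =
        Z ⁻¹' C ∩ (fun ω => (Z ω, X ω)) ⁻¹' A := by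
      ext ω; simp
    rw [e1, setIntegral_inter_condExp hm (hZX hA) (hY hB) hC'] at e
    rw [setIntegral_indicator_one (hZX hA), setIntegral_inter_condExp hm (hY hB) (hZX hA) hC',
      Set.inter_right_comm, e]
    congr 1
    funext ω
    exact mul_comm _ _
  have step3 : P⟦(fun ω => (Z ω, X ω)) ⁻¹' A | m⟧ =ᵐ[P] P⟦(fun ω => (Z ω, Y ω)) ⁻¹' A | m⟧ := by
    refine ae_eq_condExp_of_forall_setIntegral_eq hm (integrable_indicator_one (hZY hA))
      (fun _ _ _ => integrable_condExp.integrableOn) ?_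
      stronglyMeasurable_condExp.aestronglyMeasurable
    rintro _ ⟨C, hC, rfl⟩ _
    rw [setIntegral_condExp_indicator hm (hZX hA) ⟨C, hC, rfl⟩, setIntegral_indicator_one (hZY hA)]
    have e := hidm ((hC.prod MeasurableSet.univ).inter hA)
    have e1 : ∀ X : Ω → β, (fun ω => (Z ω, X ω)) ⁻¹' ((C ×ˢ Set.univ) ∩ A) =
        Z ⁻¹' C ∩ (fun ω => (Z ω, X ω)) ⁻¹' A := fun X => by
      ext ω; simp
    rw [e1, e1] at e
    exact congrArg ENNReal.toReal e
  rw [Set.inter_comm, step2 A A hA hA]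
  have e := setIntegral_inter_condExp (P := P) hm (hZY hA) (hZX hA) (@MeasurableSet.univ _ m)
  rw [Set.univ_inter, Measure.restrict_univ] at e
  rw [e]
  refine integral_congr_ae (step3.mono fun ω hω => ?_)
  simp only [← hω, sq]

end CondExp
end FrozenPercolation

namespace FrozenPercolation

/-! ### Collision probabilities and the reconstruction of oriented edges. -/

section Collision

variable {Ω : Type*} {mΩ : MeasurableSpace Ω}

theorem indicator_preimage_congr {Ω β : Type*} {X Y : Ω → β} {A : Set β} {ω : Ω} (h : X ω = Y ω) :
    (X ⁻¹' A).indicator (fun _ => (1 : ℝ)) ω = (Y ⁻¹' A).indicator (fun _ => (1 : ℝ)) ω := by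
  have e : ω ∈ X ⁻¹' A ↔ ω ∈ Y ⁻¹' A := by rw [Set.mem_preimage, h, Set.mem_preimage]
  by_cases hω : ω ∈ Y ⁻¹' A
  · rw [Set.indicator_of_mem hω, Set.indicator_of_mem (e.2 hω)]
  · rw [Set.indicator_of_notMem hω, Set.indicator_of_notMem (mt e.1 hω)]

/-- The probability that two conditionally independent copies of `ψ` given `m` agree. -/
noncomputable def collision {ι : Type*} [Fintype ι] (P : Measure Ω) (m : MeasurableSpace Ω)
    (ψ : Ω → ι) : ℝ :=
  ∑ i, ∫ ω, (P⟦ψ ⁻¹' {i} | m⟧) ω ^ 2 ∂P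

theorem collision_nonneg {ι : Type*} [Fintype ι] (P : Measure Ω) (m : MeasurableSpace Ω)
    (ψ : Ω → ι) : 0 ≤ collision P m ψ :=
  Finset.sum_nonneg fun _ _ => integral_nonneg fun _ => sq_nonneg _

theorem collision_congr {ι : Type*} [Fintype ι] {P : Measure Ω} {m : MeasurableSpace Ω}
    {ψ ψ' : Ω → ι} (h : ψ =ᵐ[P] ψ') : collision P m ψ = collision P m ψ' := by
  refine Finset.sum_congr rfl fun i _ => integral_congr_ae ?_
  have h1 : (ψ ⁻¹' {i}).indicator (fun _ => (1 : ℝ)) =ᵐ[P]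
      (ψ' ⁻¹' {i}).indicator (fun _ => (1 : ℝ)) := by
    filter_upwards [h] with ω hω
    exact indicator_preimage_congr hω
  filter_upwards [condExp_congr_ae (m := m) h1] with ω hω
  rw [hω]

variable {P : Measure Ω} [IsProbabilityMeasure P] {m₁ m₂ a₁ a₂ : MeasurableSpace Ω}

/-- Conditional probabilities factor over independent branches; their factors are independent, so
the integrals of the squares factor too. -/
theorem collision_prod {ι κ : Type*} [Fintype ι] [Fintype κ] (h₁ : m₁ ≤ mΩ) (h₂ : m₂ ≤ mΩ)
    (ha₁ : a₁ ≤ m₁) (ha₂ : a₂ ≤ m₂) (hind : Indep m₁ m₂ P) {ψ₁ : Ω → ι} {ψ₂ : Ω → κ}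
    (hψ₁ : ∀ i, MeasurableSet[m₁] (ψ₁ ⁻¹' {i})) (hψ₂ : ∀ j, MeasurableSet[m₂] (ψ₂ ⁻¹' {j})) :
    collision P (a₁ ⊔ a₂) (fun ω => (ψ₁ ω, ψ₂ ω)) = collision P a₁ ψ₁ * collision P a₂ ψ₂ := by
  unfold collision
  rw [Finset.sum_mul_sum, Fintype.sum_prod_type]
  refine Finset.sum_congr rfl fun i _ => Finset.sum_congr rfl fun j _ => ?_
  have e : (fun ω => (ψ₁ ω, ψ₂ ω)) ⁻¹' {(i, j)} = ψ₁ ⁻¹' {i} ∩ ψ₂ ⁻¹' {j} := by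
    ext ω; simp
  have hm1 : Measurable[m₁] (fun ω => (P⟦ψ₁ ⁻¹' {i} | a₁⟧) ω ^ 2) :=
    (stronglyMeasurable_condExp.measurable.mono ha₁ le_rfl).pow_const 2
  have hm2 : Measurable[m₂] (fun ω => (P⟦ψ₂ ⁻¹' {j} | a₂⟧) ω ^ 2) :=
    (stronglyMeasurable_condExp.measurable.mono ha₂ le_rfl).pow_const 2
  have hi : IndepFun (fun ω => (P⟦ψ₁ ⁻¹' {i} | a₁⟧) ω ^ 2) (fun ω => (P⟦ψ₂ ⁻¹' {j} | a₂⟧) ω ^ 2) P :=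
    indep_of_indep_of_le_left (indep_of_indep_of_le_right hind hm2.comap_le) hm1.comap_le
  rw [e, ← hi.integral_fun_mul_eq_mul_integral
    (hm1.mono h₁ le_rfl).aestronglyMeasurable (hm2.mono h₂ le_rfl).aestronglyMeasurable]
  refine integral_congr_ae ?_
  filter_upwards [condExp_inter_sup h₁ h₂ ha₁ ha₂ hind (hψ₁ i) (hψ₂ j)] with ω hω
  rw [hω, mul_pow]

theorem collision_sup_of_indep {ι : Type*} [Fintype ι] (h₁ : m₁ ≤ mΩ) (h₂ : m₂ ≤ mΩ)
    (ha₁ : a₁ ≤ m₁) (ha₂ : a₂ ≤ m₂) (hind : Indep m₁ m₂ P) {ψ : Ω → ι}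
    (hψ : ∀ i, MeasurableSet[m₁] (ψ ⁻¹' {i})) :
    collision P (a₁ ⊔ a₂) ψ = collision P a₁ ψ := by
  refine Finset.sum_congr rfl fun i _ => integral_congr_ae ?_
  filter_upwards [condExp_sup_of_indep h₁ h₂ ha₁ ha₂ hind (hψ i)] with ω hω
  rw [hω]

-- With two values the conditional collision probability is `p ^ 2 + (1 - p) ^ 2 = 1 - 2 p (1 - p)`,
-- and the mean of `p (1 - p)` is the mean squared prediction error.
open Classical in
theorem collision_decide_mem {m : MeasurableSpace Ω} (hm : m ≤ mΩ) {s : Set Ω}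
    (hs : MeasurableSet[mΩ] s) : collision P m (fun ω => decide (ω ∈ s)) =
      1 - 2 * ∫ ω, (s.indicator (fun _ => (1 : ℝ)) ω - (P⟦s | m⟧) ω) ^ 2 ∂P := by
  have e1 : (fun ω => decide (ω ∈ s)) ⁻¹' {true} = s := by ext ω; simp
  have e2 : (fun ω => decide (ω ∈ s)) ⁻¹' {false} = sᶜ := by ext ω; simp
  have hi := integrable_indicator_one (P := P) hs
  have hc : P⟦sᶜ | m⟧ =ᵐ[P] fun ω => 1 - (P⟦s | m⟧) ω := by
    have h1 : sᶜ.indicator (fun _ => (1 : ℝ)) = (fun _ => 1) - s.indicator (fun _ => (1 : ℝ)) := by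
      funext ω; by_cases h : ω ∈ s <;> simp [h]
    have h2 := condExp_sub (m := m) (integrable_const (μ := P) (1 : ℝ)) hi
    rw [condExp_const hm] at h2
    rw [h1]
    exact h2
  set p := P⟦s | m⟧ with hp
  have hip : Integrable p P := integrable_condExp
  have hpp : Integrable (fun ω => p ω * p ω) P := integrable_mul_condExp_indicator hm hs hip
  have hsp : Integrable (fun ω => s.indicator (fun _ => (1 : ℝ)) ω * p ω) P :=
    integrable_mul_condExp_indicator hm hs hi
  have i1 : ∫ ω, s.indicator (fun _ => (1 : ℝ)) ω * p ω ∂P = ∫ ω, p ω * p ω ∂P := by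
    have h := setIntegral_inter_condExp (P := P) hm hs hs (@MeasurableSet.univ _ m)
    rw [Set.univ_inter, Measure.restrict_univ] at h
    rw [← h, ← integral_indicator hs]
    congr 1
    funext ω
    by_cases h : ω ∈ s <;> simp [h, hp]
  have i2 : ∫ ω, s.indicator (fun _ => (1 : ℝ)) ω ∂P = ∫ ω, p ω ∂P := (integral_condExp hm).symm
  have i3 : ∫ ω, (s.indicator (fun _ => (1 : ℝ)) ω - p ω) ^ 2 ∂P =
      ∫ ω, p ω ∂P - ∫ ω, p ω * p ω ∂P := by
    have : ∀ ω, (s.indicator (fun _ => (1 : ℝ)) ω - p ω) ^ 2 = s.indicator (fun _ => (1 : ℝ)) ω -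
        2 * (s.indicator (fun _ => (1 : ℝ)) ω * p ω) + p ω * p ω := fun ω => by
      by_cases h : ω ∈ s <;> simp [h] <;> ring
    simp only [this]
    have hd : Integrable (fun ω => s.indicator (fun _ => (1 : ℝ)) ω -
        2 * (s.indicator (fun _ => (1 : ℝ)) ω * p ω)) P := hi.sub (hsp.const_mul 2)
    rw [integral_add hd hpp, integral_sub hi (hsp.const_mul 2),
      integral_const_mul, i1, i2]
    ring
  have i4 : ∫ ω, (P⟦sᶜ | m⟧) ω ^ 2 ∂P = 1 - 2 * ∫ ω, p ω ∂P + ∫ ω, p ω * p ω ∂P := by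
    have : ∫ ω, (P⟦sᶜ | m⟧) ω ^ 2 ∂P = ∫ ω, (1 - 2 * p ω + p ω * p ω) ∂P := by
      refine integral_congr_ae (hc.mono fun ω hω => ?_)
      simp only [hω]
      ring
    have hd : Integrable (fun ω => 1 - 2 * p ω) P := (integrable_const 1).sub (hip.const_mul 2)
    rw [this, integral_add hd hpp,
      integral_sub (integrable_const 1) (hip.const_mul 2), integral_const_mul]
    simp
  have i5 : ∫ ω, p ω ^ 2 ∂P = ∫ ω, p ω * p ω ∂P := by simp only [sq]
  rw [collision, Fintype.sum_bool, e1, e2, i3, i4, i5]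
  ring

end Collision

section Tree

variable {V : Type*} {T : SimpleGraph V} {Ω : Type*}
  {U : Ω → T.edgeSet → ℝ} {Fo : Ω → Set T.Dart} {ch : Bool → T.Dart → T.Dart}

theorem timeAlgebra_eq_sup (hch : IsChildMap T ch) (d : T.Dart) :
    timeAlgebra U d = (timeAlgebra U (ch false d) ⊔ timeAlgebra U (ch true d)) ⊔
      MeasurableSpace.comap (fun ω => U ω (toEdge T d)) inferInstance := by
  refine le_antisymm ?_ (sup_le (sup_le (timeAlgebra_child_le hch _ d)
    (timeAlgebra_child_le hch _ d)) (measurable_time_timeAlgebra hch d).comap_le)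
  let m : MeasurableSpace Ω := (timeAlgebra U (ch false d) ⊔ timeAlgebra U (ch true d)) ⊔
      MeasurableSpace.comap (fun ω => U ω (toEdge T d)) inferInstance
  rw [← measurable_iff_comap_le]
  refine measurable_pi_lambda _ fun e => ?_
  obtain ⟨e, d', hd', rfl⟩ := e
  rw [hch.dartsFrom_eq] at hd'
  obtain ⟨l, rfl⟩ := hd'
  cases l with
  | nil => exact (comap_measurable _).mono le_sup_right le_rfl
  | cons b l =>
    have h1 : toEdge T (addr ch d (b :: l)) ∈ edgesFrom T (ch b d) :=
      ⟨_, by rw [hch.dartsFrom_eq]; exact ⟨l, rfl⟩, rfl⟩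
    have h2 : timeAlgebra U (ch b d) ≤ m := by
      refine le_trans ?_ le_sup_left
      cases b
      · exact le_sup_left
      · exact le_sup_right
    exact (measurable_timeAlgebra h1).mono h2 le_rfl

/-- The frozen oriented edges as a function of the activation times and the frozen edges. -/
noncomputable def frozenDarts (ch : Bool → T.Dart → T.Dart)
    (p : (T.edgeSet → ℝ) × Set T.edgeSet) : Set T.Dart :=
  {d | min (explosionTime ch (fun d => p.1 (toEdge T d)) {d | toEdge T d ∈ p.2} (ch false d))
    (explosionTime ch (fun d => p.1 (toEdge T d)) {d | toEdge T d ∈ p.2} (ch true d)) ≤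
      p.1 (toEdge T d)}

theorem measurable_frozenDarts (hch : IsChildMap T ch) : Measurable (frozenDarts ch) := by
  have h1 : ∀ d : T.Dart, Measurable fun p : (T.edgeSet → ℝ) × Set T.edgeSet => p.1 (toEdge T d) :=
    fun d => (measurable_pi_apply _).comp measurable_fst
  have h2 : ∀ d, Measurable fun p : (T.edgeSet → ℝ) × Set T.edgeSet =>
      explosionTime ch (fun d => p.1 (toEdge T d)) {d | toEdge T d ∈ p.2} d := fun d =>
    hch.measurable_explosionTime d (fun d' _ => h1 d')
      (fun d' _ => measurableSet_setOfPred.2 ((measurable_set_mem (toEdge T d')).comp measurable_snd))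
  refine measurable_set_iff.2 fun d => measurableSet_setOfPred.1 ?_
  exact measurableSet_le ((h2 _).min (h2 _)) (h1 d)

theorem toEdge_mem_unorient_iff {A : Set T.Dart} {d : T.Dart} :
    toEdge T d ∈ unorient T A ↔ d ∈ A ∨ d.symm ∈ A := by
  constructor
  · rintro ⟨d', hd', h⟩
    rcases SimpleGraph.dart_edge_eq_iff d' d |>.1 (congrArg Subtype.val h) with rfl | rfl
    · exact Or.inl hd'
    · exact Or.inr hd'
  · rintro (h | h)
    · exact ⟨d, h, rfl⟩
    · exact ⟨d.symm, h, toEdge_symm d⟩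

theorem exists_toEdge_eq (e : T.edgeSet) : ∃ d, toEdge T d = e := by
  obtain ⟨e, he⟩ := e
  induction e using Sym2.ind with
  | _ v w => exact ⟨⟨(v, w), he⟩, rfl⟩

theorem measurable_unorient : Measurable (unorient T) := by
  refine measurable_set_iff.2 fun e => ?_
  obtain ⟨d, rfl⟩ := exists_toEdge_eq e
  simp only [toEdge_mem_unorient_iff]
  exact (measurable_set_mem d).or (measurable_set_mem d.symm)

end Tree

/-! ### Almost sure disagreement of conditionally independent copies. -/

section Law

variable {V : Type*} {T : SimpleGraph V} {Ω : Type*} [mΩ : MeasurableSpace Ω] {P : Measure Ω}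
  {U : Ω → T.edgeSet → ℝ} {Fo : Ω → Set T.Dart} {ch : Bool → T.Dart → T.Dart}

/-- This is `mem_iff_of_freezingRule` for almost every realization; the coordinates show that the
tree is countable, so one null set serves all edges. -/
theorem IsOrientedFrozenPercolation.ae_eq_frozenDarts
    (hF : IsOrientedFrozenPercolation T P U Fo) (hT : T.IsTree) (hch : IsChildMap T ch)
    (d : T.Dart) : ∀ᵐ ω ∂P, Fo ω = frozenDarts ch (U ω, unorient T (Fo ω)) := by
  have : Countable V := (hch.coordVertex_surjective hT d).countable
  have hE : Countable T.edgeSet := inferInstance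
  filter_upwards [hF.freezing, ae_all_iff.2 hF.ae_mem_Icc] with ω h1 h2
  have hu : ∀ d : T.Dart, U ω (toEdge T d) < 2 := fun d => by linarith [(h2 (toEdge T d)).2]
  ext d
  rw [hch.mem_iff_of_freezingRule (u := fun d => U ω (toEdge T d))
    (fun d => (hch.freezingRule_iff (hu d)).2 (h1 d)) hu (fun d => by rw [toEdge_symm]) d]
  simp only [frozenDarts, toEdge_mem_unorient_iff]
  rfl

variable [IsProbabilityMeasure P]

/-- The other branches at `d.fst` are independent of the branch of `d`, so their activation times
add no information about it. -/
theorem IsOrientedFrozenPercolation.collision_comap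
    (hF : IsOrientedFrozenPercolation T P U Fo) (hT : T.IsTree) (hch : IsChildMap T ch)
    (d : T.Dart) {ι : Type*} [Fintype ι] {ψ : Ω → ι}
    (hψ : ∀ i, MeasurableSet[branchAlgebra U Fo d] (ψ ⁻¹' {i})) :
    collision P (MeasurableSpace.comap U inferInstance) ψ = collision P (timeAlgebra U d) ψ := by
  have hd : d ∈ outBoundary T {d.fst} := ⟨rfl, fun h => d.adj.ne h.symm⟩
  let i : outBoundary T {d.fst} := ⟨d, hd⟩
  have hind := indep_iSup_of_disjoint
    (m := fun i : outBoundary T {d.fst} => branchAlgebra U Fo (i : T.Dart)) (fun i => hF.branchAlgebra_le (i : T.Dart))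
    (hF.iIndep_branchAlgebra (Set.finite_singleton d.fst) (isTree_induce_singleton d.fst))
    (S := {i}) (T := {i}ᶜ) disjoint_compl_right
  have e1 : ⨆ j ∈ ({i} : Set (outBoundary T {d.fst})), branchAlgebra U Fo (j : T.Dart) =
      branchAlgebra U Fo d := by simp [i]
  rw [e1] at hind
  have e2 : MeasurableSpace.comap U inferInstance = timeAlgebra U d ⊔
      ⨆ j ∈ ({i}ᶜ : Set (outBoundary T {d.fst})), timeAlgebra U (j : T.Dart) := by
    refine le_antisymm ?_ ?_
    · let m : MeasurableSpace Ω := timeAlgebra U d ⊔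
        ⨆ j ∈ ({i}ᶜ : Set (outBoundary T {d.fst})), timeAlgebra U (j : T.Dart)
      rw [← measurable_iff_comap_le]
      refine measurable_pi_lambda _ fun e => ?_
      obtain ⟨d', hd', he⟩ := hch.exists_mem_edgesFrom hT.connected d.fst e
      refine (measurable_timeAlgebra he).mono ?_ le_rfl
      by_cases h : d' = d
      · rw [h]; exact le_sup_left
      · have hd'' : d' ∈ outBoundary T {d.fst} :=
          ⟨hd', fun h => d'.adj.ne (hd'.trans h.symm)⟩
        refine le_trans ?_ le_sup_right
        exact le_iSup₂_of_le (f := fun (j : outBoundary T {d.fst}) _ => timeAlgebra U (j : T.Dart))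
          ⟨d', hd''⟩ (fun h' => h (congrArg Subtype.val h')) le_rfl
    · have : ∀ d, timeAlgebra U d ≤ MeasurableSpace.comap U inferInstance := fun d => by
        let m : MeasurableSpace Ω := MeasurableSpace.comap U inferInstance
        rw [← measurable_iff_comap_le]
        have hU : Measurable U := comap_measurable U
        exact measurable_pi_lambda _ fun e => (measurable_pi_apply _).comp hU
      exact sup_le (this d) (iSup₂_le fun j _ => this j)
  rw [e2]
  have h1 : ⨆ j ∈ ({i}ᶜ : Set (outBoundary T {d.fst})), branchAlgebra U Fo (j : T.Dart) ≤ mΩ :=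
    iSup₂_le fun j _ => hF.branchAlgebra_le (j : T.Dart)
  have h2 : ⨆ j ∈ ({i}ᶜ : Set (outBoundary T {d.fst})), timeAlgebra U (j : T.Dart) ≤
      ⨆ j ∈ ({i}ᶜ : Set (outBoundary T {d.fst})), branchAlgebra U Fo (j : T.Dart) :=
    iSup₂_mono fun j _ => timeAlgebra_le_branchAlgebra (j : T.Dart)
  exact collision_sup_of_indep (hF.branchAlgebra_le d) h1 (timeAlgebra_le_branchAlgebra d) h2
    hind hψ

/-- Two conditionally independent copies of the frozen oriented edges have small probability to
agree on finitely many oriented edges that are chosen suitably. -/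
theorem IsOrientedFrozenPercolation.exists_collision_le
    (hF : IsOrientedFrozenPercolation T P U Fo) (hT : T.IsTree) (hch : IsChildMap T ch) {c : ℝ}
    (hc : ∀ d, collision P (timeAlgebra U d)
      (fun ω => (open Classical in decide (ω ∈ {ω | d ∈ Fo ω}))) ≤ c) (n : ℕ) (d : T.Dart) :
    ∃ (ι : Type) (_ : Fintype ι) (ψ : Set T.Dart → ι), (∀ i, MeasurableSet (ψ ⁻¹' {i})) ∧
      (∀ i, MeasurableSet[branchAlgebra U Fo d] ((fun ω => ψ (Fo ω)) ⁻¹' {i})) ∧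
      collision P (timeAlgebra U d) (fun ω => ψ (Fo ω)) ≤ c ^ n := by
  classical
  induction n generalizing d with
  | zero =>
    refine ⟨Unit, inferInstance, fun _ => (), fun i => ?_, fun i => ?_, ?_⟩
    · simp
    · have : (fun ω => (fun _ : Set T.Dart => ()) (Fo ω)) ⁻¹' {i} = Set.univ := by ext; simp
      rw [this]
      exact @MeasurableSet.univ _ (branchAlgebra U Fo d)
    · have h1 : (fun _ : Ω => ()) ⁻¹' {()} = Set.univ := by ext; simp
      have h2 : (Set.univ : Set Ω).indicator (fun _ => (1 : ℝ)) = fun _ => 1 := by simp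
      simp [collision, h1, h2, condExp_const (hF.timeAlgebra_le d)]
  | succ n ih =>
    obtain ⟨ι, _, ψ, hψ, hψm, hle⟩ := ih (ch false d)
    have hm2 : ∀ b, MeasurableSet[branchAlgebra U Fo (ch true d)]
        ((fun ω => decide (ω ∈ {ω | ch true d ∈ Fo ω})) ⁻¹' {b}) := by
      have hs : MeasurableSet[branchAlgebra U Fo (ch true d)] {ω | ch true d ∈ Fo ω} :=
        measurableSet_branchAlgebra (hch.self_mem_dartsFrom _)
      intro b
      cases b
      · have : (fun ω => decide (ω ∈ {ω | ch true d ∈ Fo ω})) ⁻¹' {false} =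
          {ω | ch true d ∈ Fo ω}ᶜ := by ext; simp
        rw [this]
        exact @MeasurableSet.compl _ _ (branchAlgebra U Fo (ch true d)) hs
      · have : (fun ω => decide (ω ∈ {ω | ch true d ∈ Fo ω})) ⁻¹' {true} =
          {ω | ch true d ∈ Fo ω} := by ext; simp
        rw [this]
        exact hs
    have hpair : ∀ p : ι × Bool, MeasurableSet[branchAlgebra U Fo (ch false d) ⊔
        branchAlgebra U Fo (ch true d)]
        ((fun ω => (ψ (Fo ω), decide (ω ∈ {ω | ch true d ∈ Fo ω}))) ⁻¹' {p}) := by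
      rintro ⟨i, b⟩
      have : (fun ω => (ψ (Fo ω), decide (ω ∈ {ω | ch true d ∈ Fo ω}))) ⁻¹' {(i, b)} =
          (fun ω => ψ (Fo ω)) ⁻¹' {i} ∩
            (fun ω => decide (ω ∈ {ω | ch true d ∈ Fo ω})) ⁻¹' {b} := by
        ext ω; simp
      rw [this]
      exact MeasurableSet.inter
        ((le_sup_left : _ ≤ branchAlgebra U Fo (ch false d) ⊔ branchAlgebra U Fo (ch true d)) _
          (hψm i))
        ((le_sup_right : _ ≤ branchAlgebra U Fo (ch false d) ⊔ branchAlgebra U Fo (ch true d)) _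
          (hm2 b))
    have hsup : branchAlgebra U Fo (ch false d) ⊔ branchAlgebra U Fo (ch true d) ≤ mΩ :=
      sup_le (hF.branchAlgebra_le _) (hF.branchAlgebra_le _)
    -- The new coordinate is the state of `ch true d`, while the old ones live in the branch of `ch
    -- false d`. The recorded edges thus hang off the ray that always turns `false`, and each
    -- contributes a factor `c`.
    refine ⟨ι × Bool, inferInstance, fun B => (ψ B, decide (ch true d ∈ B)), ?_, fun p => ?_, ?_⟩
    · rintro ⟨i, b⟩
      have : (fun B => (ψ B, decide (ch true d ∈ B))) ⁻¹' {(i, b)} =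
          ψ ⁻¹' {i} ∩ (fun B : Set T.Dart => decide (ch true d ∈ B)) ⁻¹' {b} := by
        ext ω; simp
      rw [this]
      refine (hψ i).inter ?_
      have hs : MeasurableSet {B : Set T.Dart | ch true d ∈ B} :=
        measurableSet_setOfPred.2 (measurable_set_mem _)
      cases b
      · convert hs.compl using 1
        ext; simp
      · convert hs using 1
        ext; simp
    · exact sup_le (branchAlgebra_child_le hch _ d) (branchAlgebra_child_le hch _ d) _ (hpair p)
    · have e1 := collision_sup_of_indep hsup
        ((measurable_pi_apply (toEdge T d)).comp hF.activation.measurable).comap_le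
        (sup_le_sup (timeAlgebra_le_branchAlgebra (ch false d))
          (timeAlgebra_le_branchAlgebra (ch true d))) le_rfl
        (hF.indep_time_children hT hch d).symm hpair
      have e2 := collision_prod (hF.branchAlgebra_le _) (hF.branchAlgebra_le _)
        (timeAlgebra_le_branchAlgebra (U := U) (Fo := Fo) (ch false d))
        (timeAlgebra_le_branchAlgebra (ch true d)) (hF.indep_children hT hch d) hψm hm2
      rw [timeAlgebra_eq_sup hch d]
      refine (e1.trans e2).trans_le ?_
      rw [pow_succ]
      refine mul_le_mul hle (hc _) (collision_nonneg _ _ _) ?_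
      exact (collision_nonneg _ _ _).trans hle

/-- Conditionally independent copies of the frozen edges given the activation times differ. -/
theorem IsOrientedFrozenPercolation.ae_ne_of_isCondIndepCopy
    (hF : IsOrientedFrozenPercolation T P U Fo) (hT : T.IsTree) (hch : IsChildMap T ch)
    (d : T.Dart) {F' : Ω → Set T.edgeSet}
    (h : IsCondIndepCopy P U (fun ω => unorient T (Fo ω)) F') :
    ∀ᵐ ω ∂P, unorient T (Fo ω) ≠ F' ω := by
  classical
  obtain ⟨δ, hδ, hle⟩ := hF.exists_le_integral_sub_condExp hT hch
  have hc : ∀ d, collision P (timeAlgebra U d)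
      (fun ω => decide (ω ∈ {ω | d ∈ Fo ω})) ≤ 1 - 2 * δ := fun d => by
    rw [collision_decide_mem (hF.timeAlgebra_le d) (hF.measurableSet_mem d)]
    linarith [hle d]
  have hFm : Measurable fun ω => unorient T (Fo ω) := measurable_unorient.comp hF.measurable
  have hbound : ∀ n : ℕ, P.real {ω | unorient T (Fo ω) = F' ω} ≤ (1 - 2 * δ) ^ n := by
    intro n
    obtain ⟨ι, _, ψ, hψ, hψm, hcol⟩ := hF.exists_collision_le hT hch
      (fun d => by convert hc d) n d
    set A : ι → Set ((T.edgeSet → ℝ) × Set T.edgeSet) := fun i => frozenDarts ch ⁻¹' (ψ ⁻¹' {i})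
      with hA
    have hAm : ∀ i, MeasurableSet (A i) := fun i => measurable_frozenDarts hch (hψ i)
    -- If the unoriented sets agree, so do the oriented sets that `frozenDarts` reconstructs from
    -- them with the same `U`, and hence their values under `ψ`.
    have hsub : {ω | unorient T (Fo ω) = F' ω} ⊆ ⋃ i,
        ((fun ω => (U ω, unorient T (Fo ω))) ⁻¹' A i ∩ (fun ω => (U ω, F' ω)) ⁻¹' A i) := by
      intro ω (hω : unorient T (Fo ω) = F' ω)
      refine Set.mem_iUnion.2 ⟨ψ (frozenDarts ch (U ω, unorient T (Fo ω))), rfl, ?_⟩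
      change ψ (frozenDarts ch (U ω, F' ω)) = ψ (frozenDarts ch (U ω, unorient T (Fo ω)))
      rw [hω]
    calc P.real {ω | unorient T (Fo ω) = F' ω}
        ≤ ∑ i, P.real ((fun ω => (U ω, unorient T (Fo ω))) ⁻¹' A i ∩
            (fun ω => (U ω, F' ω)) ⁻¹' A i) :=
          (measureReal_mono hsub).trans (measureReal_iUnion_fintype_le _)
      _ = collision P (MeasurableSpace.comap U inferInstance)
            (fun ω => ψ (frozenDarts ch (U ω, unorient T (Fo ω)))) :=
          Finset.sum_congr rfl fun i _ =>
            h.measureReal_inter hF.activation.measurable hFm (hAm i)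
      _ = collision P (MeasurableSpace.comap U inferInstance) (fun ω => ψ (Fo ω)) := by
          refine collision_congr ?_
          filter_upwards [hF.ae_eq_frozenDarts hT hch d] with ω hω
          rw [← hω]
      _ ≤ (1 - 2 * δ) ^ n := by
          rw [hF.collision_comap hT hch d hψm]
          exact hcol
  have h0 : 0 ≤ 1 - 2 * δ := (collision_nonneg _ _ _).trans (hc d)
  have hlim := tendsto_pow_atTop_nhds_zero_of_lt_one h0 (by linarith)
  have hz : P.real {ω | unorient T (Fo ω) = F' ω} = 0 :=
    le_antisymm (ge_of_tendsto' hlim hbound) measureReal_nonneg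
  exact measure_eq_zero_iff_ae_notMem.1 ((measureReal_eq_zero_iff).1 hz)

/-- A function of `Z` is deterministic given `Z`, hence conditionally independent of itself: its
conditional probabilities are indicators. This turns (a) into (b). -/
theorem isCondIndepCopy_self_of_ae_eq {α β : Type*} [MeasurableSpace α] [MeasurableSpace β]
    {Z : Ω → α} {X G : Ω → β} (hZ : Measurable Z) (hX : Measurable X)
    (hG : Measurable[MeasurableSpace.comap Z inferInstance] G) (h : X =ᵐ[P] G) :
    IsCondIndepCopy P Z X X := by
  refine ⟨hX, IdentDistrib.refl (hZ.prodMk hX).aemeasurable, fun A B hA hB => ?_⟩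
  have key : ∀ A : Set β, MeasurableSet A →
      P⟦X ⁻¹' A | MeasurableSpace.comap Z inferInstance⟧ =ᵐ[P]
        (X ⁻¹' A).indicator fun _ => (1 : ℝ) := by
    intro A hA
    have h1 : (X ⁻¹' A).indicator (fun _ => (1 : ℝ)) =ᵐ[P]
        (G ⁻¹' A).indicator fun _ => (1 : ℝ) := by
      filter_upwards [h] with ω hω
      exact indicator_preimage_congr hω
    have hGA : MeasurableSet[MeasurableSpace.comap Z inferInstance] (G ⁻¹' A) := hG hA
    have h2 := condExp_of_stronglyMeasurable hZ.comap_le (μ := P)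
      (f := (G ⁻¹' A).indicator fun _ => (1 : ℝ)) (stronglyMeasurable_const.indicator hGA)
      (integrable_indicator_one (hZ.comap_le _ hGA))
    refine (condExp_congr_ae h1).trans ?_
    rw [h2]
    exact h1.symm
  rw [← Set.preimage_inter]
  filter_upwards [key _ (hA.inter hB), key A hA, key B hB] with ω h1 h2 h3
  rw [h1, h2, h3]
  by_cases ha : X ω ∈ A <;> by_cases hb : X ω ∈ B <;> simp [Set.indicator, ha, hb]

end Law
end FrozenPercolation

open FrozenPercolation in
theorem theoremT {V : Type*} (T : SimpleGraph V) [T.LocallyFinite]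
    (hT : T.IsTree) (hreg : T.IsRegularOfDegree 3)
    {Ω : Type*} [MeasurableSpace Ω] (P : Measure Ω) [IsProbabilityMeasure P]
    (U : Ω → T.edgeSet → ℝ) (Fo : Ω → Set T.Dart)
    (hF : IsOrientedFrozenPercolation T P U Fo)
    (F : Ω → Set T.edgeSet) (hFdef : F = fun ω => unorient T (Fo ω)) :
    (∀ F' : Ω → Set T.edgeSet, IsCondIndepCopy P U F F' → ∀ᵐ ω ∂P, F ω ≠ F' ω) ∧
    ¬ ∃ G : Ω → Set T.edgeSet,
        Measurable[MeasurableSpace.comap U inferInstance] G ∧ F =ᵐ[P] G := by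
  subst hFdef
  obtain ⟨ch, hch⟩ := exists_isChildMap hreg
  obtain ⟨v⟩ := hT.connected.nonempty
  obtain ⟨w, hw⟩ := (T.degree_pos_iff_exists_adj v).1 (by rw [hreg v]; norm_num)
  have ha := fun F' h => hF.ae_ne_of_isCondIndepCopy hT hch ⟨(v, w), hw⟩ (F' := F') h
  refine ⟨ha, ?_⟩
  rintro ⟨G, hG, hFG⟩
  have h := ha _ (isCondIndepCopy_self_of_ae_eq hF.activation.measurable
    (measurable_unorient.comp hF.measurable) hG hFG)
  obtain ⟨ω, hω⟩ := h.exists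
  exact hω rfl
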